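/- Let $[0,1]_{Ł}$ be the standard MV algebra: $[0,1]$ with $\wedge=\min$, $\vee=\max$, $a\cdot b=\max\{0,a+b-1\}$, $a\to b=\min\{1,1-a+b\}$, constants $0,1$; put $\neg a=a\to 0$, $a\leftrightarrow b=(a\to b)\cdot(b\to a)$. Modal formulas are built from countably many variables with $\wedge,\vee,\cdot,\to,0,1,\Box,\Diamond$. A Kripke model $\langle W,R,e\rangle$ consists of a non-empty set $W$, a binary (crisp) relation $R$ on $W$ and a valuation $e$ of the variables in $[0,1]$ at each world, extended to formulas by the operations of $[0,1]_{Ł}$ at each world and by $$e(v,\Box\varphi)=\inf_{Rvw}e(w,\varphi),\qquad e(v,\Diamond\varphi)=\sup_{Rvw}e(w,\varphi)\qquad(\inf\emptyset=1,\ \sup\emptyset=0).$$ For a finite set $\Gamma\cup\{\varphi\}$ of modal formulas and a class $\mathsf C$ of such models write $\Gamma\vdash_{\mathsf C}\varphi$ if, in every model of $\mathsf C$ and at every world $v$ of it, $e(v,\gamma)=1$ for all $\gamma\in\Gamma$ implies $e(v,\varphi)=1$. Let $K_{Ł}$ be the class of all such models, $4K_{Ł}$ the class of those with $R$ transitive,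 and $K^{s}_{Ł}$ the class of those in which every world has a successor. Let $\vdash_{Ł}$ be finitary propositional consequence over $[0,1]_{Ł}$ (preservation of the value $1$ under all valuations). Given a finite $\Gamma\cup\{\varphi\}$, rewrite every $\Box\psi$ as $\neg\Diamond\neg\psi$. The propositional subformulas $\mathrm{PSFm}(\psi)$ of $\psi$ are its subformulas that are not in the scope of a $\Diamond$. Let $\Sigma_0$ be the set of formulas $\Diamond\chi$ in $\mathrm{PSFm}(\Gamma\cup\{\varphi\})$, let $\Sigma_{i+1}$ be the set of formulas $\Diamond\chi$ in $\mathrm{PSFm}(\{\psi:\Diamond\psi\in\Sigma_i\})$, and let $N$ be the maximal modal depth of $\Gamma\cup\{\varphi\}$. Form the finite tree of worlds $W_0=\{w_0\}$ (with $w_0=w_{\langle 0\rangle}$), $W_{i+1}=\{w_{\langle\sigma,\Diamond\chi\rangle}: w_{\langle\sigma\rangle}\in W_i,\ \Diamond\chi\in\Sigma_i\}$, for $i<N$. Take propositional variables $x_w$, $\overline{\Diamond\psi}_w$, $s_w$, and let $\psi\mapsto\psi^\sharp(w)$ commute with the propositional connectives and constants, with $x^\sharp(w)=x_w$ and $(\Diamond\psi)^\sharp(w)=\overline{\Diamond\psi}_w$.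 Let $\Psi^{s}(\Gamma\cup\{\varphi\})$ be the finite set of the formulas $$\overline{\Diamond\psi}_{w_{\langle\sigma\rangle}}\leftrightarrow\psi^\sharp(w_{\langle\sigma,\Diamond\psi\rangle}),\qquad \Big(\bigvee_{\Diamond\chi\in\Sigma_i}\psi^\sharp(w_{\langle\sigma,\Diamond\chi\rangle})\Big)\to\psi^\sharp(w_{\langle\sigma,\Diamond\psi\rangle})$$ for $i<N$, $w_{\langle\sigma\rangle}\in W_i$, $\Diamond\psi\in\Sigma_i$. Let $\Psi(\Gamma\cup\{\varphi\})$ be obtained from it by replacing each formula of the first kind by $\overline{\Diamond\psi}_{w_{\langle\sigma\rangle}}\leftrightarrow s_{w_{\langle\sigma\rangle}}\cdot\psi^\sharp(w_{\langle\sigma,\Diamond\psi\rangle})$ and adding $s_{w}\vee\neg s_{w}$ for each $w\in W_i$, $i<N$ (the variable $s_w$ expresses that $w$ has a successor). Then, for all finite $\Gamma\cup\{\varphi\}$: 1. $\Gamma\vdash_{K_{Ł}}\varphi$ if and only if $\Gamma^\sharp(w_0),\Psi(\Gamma\cup\{\varphi\})\vdash_{Ł}\varphi^\sharp(w_0)$.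 2. $\Gamma\vdash_{K^{s}_{Ł}}\varphi$ if and only if $\Gamma^\sharp(w_0),\Psi^{s}(\Gamma\cup\{\varphi\})\vdash_{Ł}\varphi^\sharp(w_0)$. Moreover: 3. The problem of deciding, given a finite $\Gamma$ and $\varphi$, whether $\Gamma\vdash_{K_{Ł}}\varphi$, is decidable. 4. The problem of deciding, given a finite $\Gamma$ and $\varphi$, whether $\Gamma\vdash_{4K_{Ł}}\varphi$, is undecidable. -/

import Mathlib

universe u

namespace LukModal

/-! ### The standard MV algebra on `[0,1]`

The lattice operations, `0` and `1` are those of Mathlib's `unitInterval`; as this is a complete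
lattice, all infima and suprema exist and every Kripke model over it is safe. -/

/-- Strong conjunction `a · b = max {0, a + b - 1}`. -/
noncomputable def lukMul (a b : unitInterval) : unitInterval :=
  ⟨max 0 ((a : ℝ) + (b : ℝ) - 1), le_max_left _ _,
    max_le zero_le_one (by linarith [a.2.2, b.2.2])⟩

/-- Residuum `a → b = min {1, 1 - a + b}`. -/
noncomputable def lukImp (a b : unitInterval) : unitInterval :=
  ⟨min 1 (1 - (a : ℝ) + (b : ℝ)), le_min zero_le_one (by linarith [a.2.2, b.2.1]),
    min_le_left _ _⟩

/-! ### Propositional formulas and propositional Łukasiewicz consequence -/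

/-- Propositional formulas with variables in `V`. -/
inductive PFm (V : Type) : Type
  | var (x : V) : PFm V
  | bot : PFm V
  | top : PFm V
  | and (φ ψ : PFm V) : PFm V
  | or (φ ψ : PFm V) : PFm V
  | mul (φ ψ : PFm V) : PFm V
  | imp (φ ψ : PFm V) : PFm V

namespace PFm

variable {V : Type}

/-- `¬φ`, that is, `φ → 0`. -/
def neg (φ : PFm V) : PFm V := imp φ bot

/-- `φ ↔ ψ`, that is, `(φ → ψ) · (ψ → φ)`. -/
def iff (φ ψ : PFm V) : PFm V := mul (imp φ ψ) (imp ψ φ)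

/-- Finite disjunction (`0` for the empty list). -/
def bigOr (L : List (PFm V)) : PFm V := L.foldr or bot

/-- The homomorphic extension of a valuation of the variables to all formulas. -/
noncomputable def eval (h : V → unitInterval) : PFm V → unitInterval
  | var x => h x
  | bot => 0
  | top => 1
  | and φ ψ => eval h φ ⊓ eval h ψ
  | or φ ψ => eval h φ ⊔ eval h ψ
  | mul φ ψ => lukMul (eval h φ) (eval h ψ)
  | imp φ ψ => lukImp (eval h φ) (eval h ψ)

end PFm

/-- Finitary consequence of propositional Łukasiewicz logic over `[0,1]`. -/
def PropConsequence {V : Type} (Γ : List (PFm V)) (φ : PFm V) : Prop :=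
  ∀ h : V → unitInterval, (∀ γ ∈ Γ, γ.eval h = 1) → φ.eval h = 1

/-! ### Modal formulas and Kripke models -/

/-- Modal formulas over the countable set of variables `ℕ`. -/
inductive MFm : Type
  | var (n : ℕ) : MFm
  | bot : MFm
  | top : MFm
  | and (φ ψ : MFm) : MFm
  | or (φ ψ : MFm) : MFm
  | mul (φ ψ : MFm) : MFm
  | imp (φ ψ : MFm) : MFm
  | box (φ : MFm) : MFm
  | dia (φ : MFm) : MFm

namespace MFm

/-- Gödel number of a modal formula. -/
def toNat : MFm → ℕ
  | bot => 0
  | top => 1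
  | var n => 7 * n + 2
  | and φ ψ => 7 * Nat.pair φ.toNat ψ.toNat + 3
  | or φ ψ => 7 * Nat.pair φ.toNat ψ.toNat + 4
  | mul φ ψ => 7 * Nat.pair φ.toNat ψ.toNat + 5
  | imp φ ψ => 7 * Nat.pair φ.toNat ψ.toNat + 6
  | box φ => 7 * φ.toNat + 7
  | dia φ => 7 * φ.toNat + 8

/-- The modal formula with a given Gödel number. -/
def ofNat : ℕ → MFm
  | 0 => bot
  | 1 => top
  | n + 2 =>
    have h : n / 7 < n + 2 := lt_of_le_of_lt (Nat.div_le_self n 7) (by omega)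
    have hl : (Nat.unpair (n / 7)).1 < n + 2 := lt_of_le_of_lt (Nat.unpair_left_le _) h
    have hr : (Nat.unpair (n / 7)).2 < n + 2 := lt_of_le_of_lt (Nat.unpair_right_le _) h
    match n % 7 with
    | 0 => var (n / 7)
    | 1 => and (ofNat (Nat.unpair (n / 7)).1) (ofNat (Nat.unpair (n / 7)).2)
    | 2 => or (ofNat (Nat.unpair (n / 7)).1) (ofNat (Nat.unpair (n / 7)).2)
    | 3 => mul (ofNat (Nat.unpair (n / 7)).1) (ofNat (Nat.unpair (n / 7)).2)
    | 4 => imp (ofNat (Nat.unpair (n / 7)).1) (ofNat (Nat.unpair (n / 7)).2)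
    | 5 => box (ofNat (n / 7))
    | _ => dia (ofNat (n / 7))

theorem ofNat_toNat (φ : MFm) : ofNat φ.toNat = φ := by
  induction φ with
  | bot => simp [toNat, ofNat]
  | top => simp [toNat, ofNat]
  | var n => simp [toNat, ofNat]
  | and φ ψ ih₁ ih₂ =>
    rw [toNat, ofNat]
    simp [Nat.add_mod, Nat.mul_add_div, ih₁, ih₂]
  | or φ ψ ih₁ ih₂ =>
    rw [toNat, ofNat]
    simp [Nat.add_mod, Nat.mul_add_div, ih₁, ih₂]
  | mul φ ψ ih₁ ih₂ =>
    rw [toNat, ofNat]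
    simp [Nat.add_mod, Nat.mul_add_div, ih₁, ih₂]
  | imp φ ψ ih₁ ih₂ =>
    rw [toNat, ofNat]
    simp [Nat.add_mod, Nat.mul_add_div, ih₁, ih₂]
  | box φ ih =>
    rw [toNat, ofNat]
    simp [Nat.add_mod, Nat.mul_add_div, ih]
  | dia φ ih =>
    rw [toNat, ofNat]
    simp [Nat.add_mod, Nat.mul_add_div, ih]

theorem toNat_ofNat (n : ℕ) : (ofNat n).toNat = n := by
  induction n using Nat.strong_induction_on with
  | _ n ih =>
    match n with
    | 0 => simp [toNat, ofNat]
    | 1 => simp [toNat, ofNat]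
    | n + 2 =>
      have h : n / 7 < n + 2 := lt_of_le_of_lt (Nat.div_le_self n 7) (by omega)
      have hl := ih _ (lt_of_le_of_lt (Nat.unpair_left_le (n / 7)) h)
      have hr := ih _ (lt_of_le_of_lt (Nat.unpair_right_le (n / 7)) h)
      have hd := ih _ h
      have hm : n % 7 = 0 ∨ n % 7 = 1 ∨ n % 7 = 2 ∨ n % 7 = 3 ∨ n % 7 = 4 ∨ n % 7 = 5 ∨
          n % 7 = 6 := by omega
      rw [ofNat]
      rcases hm with h' | h' | h' | h' | h' | h' | h' <;>
        simp only [h', toNat, hl, hr, hd, Nat.pair_unpair] <;> omega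

/-- Modal formulas are in effective bijection with the natural numbers. -/
def equivNat : MFm ≃ ℕ := ⟨toNat, ofNat, ofNat_toNat, toNat_ofNat⟩

instance instPrimcodable : Primcodable MFm := Primcodable.ofEquiv ℕ equivNat

end MFm

/-- Kripke models with a crisp accessibility relation, evaluated over the standard MV algebra. -/
structure Model : Type (u + 1) where
  /-- The worlds. -/
  W : Type u
  nonempty : Nonempty W
  /-- The accessibility relation. -/
  R : W → W → Prop
  /-- The evaluation of the variables. -/
  e : ℕ → W → unitInterval

namespace Model

/-- The value of a modal formula at a world. -/
noncomputable def val (M : Model.{u}) : MFm → M.W → unitInterval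
  | .var n, v => M.e n v
  | .bot, _ => 0
  | .top, _ => 1
  | .and φ ψ, v => M.val φ v ⊓ M.val ψ v
  | .or φ ψ, v => M.val φ v ⊔ M.val ψ v
  | .mul φ ψ, v => lukMul (M.val φ v) (M.val ψ v)
  | .imp φ ψ, v => lukImp (M.val φ v) (M.val ψ v)
  | .box φ, v => ⨅ w : M.W, ⨅ _ : M.R v w, M.val φ w
  | .dia φ, v => ⨆ w : M.W, ⨆ _ : M.R v w, M.val φ w

/-- The accessibility relation is transitive. -/
def IsTransitive (M : Model.{u}) : Prop := ∀ x y z : M.W, M.R x y → M.R y z → M.R x z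

/-- Every world has a successor. -/
def IsSerial (M : Model.{u}) : Prop := ∀ v : M.W, ∃ w : M.W, M.R v w

end Model

/-- `φ` follows locally from the finite set `Γ` in the class `C` of models. -/
def LocalConsequence (C : Model.{u} → Prop) (Γ : List MFm) (φ : MFm) : Prop :=
  ∀ M : Model.{u}, C M → ∀ v : M.W, (∀ γ ∈ Γ, M.val γ v = 1) → M.val φ v = 1

/-- Finitary local consequence of the minimal modal Łukasiewicz logic. -/
def KConsequence (Γ : List MFm) (φ : MFm) : Prop :=
  LocalConsequence.{u} (fun _ => True) Γ φ

/-- Finitary local consequence over the transitive models. -/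
def K4Consequence (Γ : List MFm) (φ : MFm) : Prop :=
  LocalConsequence.{u} Model.IsTransitive Γ φ

/-- Finitary local consequence over the models without dead ends. -/
def SerialConsequence (Γ : List MFm) (φ : MFm) : Prop :=
  LocalConsequence.{u} Model.IsSerial Γ φ

/-! ### The tree of witness worlds and the propositional translation -/

/-- Modal formulas in which `◇` is the only modality. -/
inductive DFm : Type
  | var (n : ℕ) : DFm
  | bot : DFm
  | top : DFm
  | and (φ ψ : DFm) : DFm
  | or (φ ψ : DFm) : DFm
  | mul (φ ψ : DFm) : DFm
  | imp (φ ψ : DFm) : DFm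
  | dia (φ : DFm) : DFm

/-- Rewriting a modal formula by reading `□φ` as `¬◇¬φ`. -/
def MFm.toDia : MFm → DFm
  | .var n => .var n
  | .bot => .bot
  | .top => .top
  | .and φ ψ => .and φ.toDia ψ.toDia
  | .or φ ψ => .or φ.toDia ψ.toDia
  | .mul φ ψ => .mul φ.toDia ψ.toDia
  | .imp φ ψ => .imp φ.toDia ψ.toDia
  | .box φ => .imp (.dia (.imp φ.toDia .bot)) .bot
  | .dia φ => .dia φ.toDia

namespace DFm

/-- The propositional subformulas: formulas `◇φ` are not decomposed. -/
def psfm : DFm → List DFm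
  | var n => [var n]
  | bot => [bot]
  | top => [top]
  | and φ ψ => and φ ψ :: (psfm φ ++ psfm ψ)
  | or φ ψ => or φ ψ :: (psfm φ ++ psfm ψ)
  | mul φ ψ => mul φ ψ :: (psfm φ ++ psfm ψ)
  | imp φ ψ => imp φ ψ :: (psfm φ ++ psfm ψ)
  | dia φ => [dia φ]

/-- `χ` if the formula is `◇χ`, and nothing otherwise. -/
def body? : DFm → Option DFm
  | dia χ => some χ
  | _ => none

/-- The modal depth. -/
def depth : DFm → ℕ
  | var _ => 0
  | bot => 0
  | top => 0
  | and φ ψ => max φ.depth ψ.depth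
  | or φ ψ => max φ.depth ψ.depth
  | mul φ ψ => max φ.depth ψ.depth
  | imp φ ψ => max φ.depth ψ.depth
  | dia φ => φ.depth + 1

end DFm

/-- The formulas `χ` with `◇χ ∈ Σᵢ`, where `Σ₀` consists of the formulas `◇χ` among the
propositional subformulas of `Θ`, and `Σᵢ₊₁` of those among the propositional subformulas of
the `ψ` with `◇ψ ∈ Σᵢ`. -/
def sig (Θ : List DFm) : ℕ → List DFm
  | 0 => (Θ.flatMap DFm.psfm).filterMap DFm.body?
  | i + 1 => ((sig Θ i).flatMap DFm.psfm).filterMap DFm.body?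

/-- The maximal modal depth of the formulas in `Θ`. -/
def maxDepth (Θ : List DFm) : ℕ := (Θ.map DFm.depth).foldr max 0

/-- Names of witness worlds: the root `w₀` is `[]`, and `χ :: σ` is the witness of the value
of `◇χ` at `σ`. -/
abbrev World : Type := List DFm

/-- The worlds of level `i` of the tree. -/
def worlds (Θ : List DFm) : ℕ → List World
  | 0 => [[]]
  | i + 1 => (worlds Θ i).flatMap fun σ => (sig Θ i).map fun χ => χ :: σ

/-- The variables of the translation: `x_w`, `(◇ψ)_w`, and a marker `s_w` used to express
that `w` has a successor. -/
inductive TVar : Type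
  | atom (x : ℕ) (w : World) : TVar
  | dia (ψ : DFm) (w : World) : TVar
  | succ (w : World) : TVar

/-- The translation `φ^♯(w)`. -/
def sharp (w : World) : DFm → PFm TVar
  | .var n => .var (.atom n w)
  | .bot => .bot
  | .top => .top
  | .and φ ψ => .and (sharp w φ) (sharp w ψ)
  | .or φ ψ => .or (sharp w φ) (sharp w ψ)
  | .mul φ ψ => .mul (sharp w φ) (sharp w ψ)
  | .imp φ ψ => .imp (sharp w φ) (sharp w ψ)
  | .dia φ => .var (.dia φ w)

/-- The formula `⋁_χ ψ^♯(w_{σ,◇χ}) → ψ^♯(w_{σ,◇ψ})`, for `σ` of level `i`. -/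
def maxAxiom (Θ : List DFm) (i : ℕ) (σ : World) (ψ : DFm) : PFm TVar :=
  .imp (PFm.bigOr ((sig Θ i).map fun χ => sharp (χ :: σ) ψ)) (sharp (ψ :: σ) ψ)

/-- The set `Ψ(Θ)`: for every world `σ` of level `i` and every `◇ψ ∈ Σᵢ`, the formulas
`(◇ψ)_σ ↔ ψ^♯(w_{σ,◇ψ})` and `⋁_χ ψ^♯(w_{σ,◇χ}) → ψ^♯(w_{σ,◇ψ})`. -/
def PsiSerial (Θ : List DFm) : List (PFm TVar) :=
  (List.range (maxDepth Θ)).flatMap fun i => (worlds Θ i).flatMap fun σ =>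
    (sig Θ i).flatMap fun ψ =>
      [PFm.iff (.var (.dia ψ σ)) (sharp (ψ :: σ) ψ), maxAxiom Θ i σ ψ]

/-- The variant of `Ψ(Θ)` that allows dead ends: the marker `s_σ` is two-valued, and the first
formula becomes `(◇ψ)_σ ↔ s_σ · ψ^♯(w_{σ,◇ψ})`. -/
def Psi (Θ : List DFm) : List (PFm TVar) :=
  (List.range (maxDepth Θ)).flatMap fun i => (worlds Θ i).flatMap fun σ =>
    .or (.var (.succ σ)) (PFm.neg (.var (.succ σ))) ::
      (sig Θ i).flatMap fun ψ =>
        [PFm.iff (.var (.dia ψ σ)) (.mul (.var (.succ σ)) (sharp (ψ :: σ) ψ)),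
          maxAxiom Θ i σ ψ]

/-- The formulas of `Γ ∪ {φ}`, with `□` rewritten. -/
def theta (Γ : List MFm) (φ : MFm) : List DFm := φ.toDia :: Γ.map MFm.toDia

/-- The translation `γ^♯(w₀)` of a modal formula at the root. -/
def rootSharp (γ : MFm) : PFm TVar := sharp [] γ.toDia

end LukModal

/-! Over the class of all models, and over the serial one, attention can be restricted to witnessed
models, in which a supremum over a nonempty set of successors is a maximum. Since the connectives
are continuous and `[0,1]` is compact, the vectors of values that worlds give to all formulas have a
compact closure in a product of intervals. With the closure of the accessibility relation this
becomes a model in which every point realizes itself as its vector of values (`closureModel_val`),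
and the successors of a point form a compact set, so maxima exist (`closureModel_witnessed`).

For the two translations, the names in the tree are read in a witnessed model by choosing, for each
`◇χ`, a successor that attains its value; the values found there satisfy `Psi`. Conversely, a
valuation satisfying `Psi` turns the tree itself into a Kripke model: the maximality formulas say
that the child named after `ψ` has the largest value of `ψ` among its siblings (`treeModel_val`).
Dead ends are the worlds with marker `0`; in the serial case the childless worlds become reflexive.

Decidability is obtained directly from witnessed models. A refutation can be cut down to a finite
tree of computable size (`heapModel_val`). The semantic clauses on it are sign conditions on affine
forms with small integer coefficients, and Fourier-Motzkin elimination moves the real values to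
rationals with a computable common denominator without changing any sign
(`exists_rational_sameSigns`). A bounded search for a table of numerators then decides the problem.

For undecidability, the halting problem of a fixed counter program is reduced to consequence over
transitive models. A clock of value `c` is halved in each step, and a counter with content `a` is
stored as `c(1 + 2^(-a))` together with its complement `c(2 - 2^(-a))`. Different worlds are linked
only through suprema, which need not be attained. However, the two quantities add up to `3c` at
every world and their suprema add up to three times the supremum of the clock; so at a successor
where the clock is close to its supremum, both are close to theirs (`exists_encodes_step`). A
terminating run has finitely many steps, hence can be followed with an error fixed in advance, and
the halting configuration is forbidden. A non-terminating run gives a countermodel on the natural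
numbers with `<`. -/

namespace LukModal
open Set Topology

/-! ### Operations of the standard MV algebra -/

theorem coe_lukMul (a b : unitInterval) : ((lukMul a b : unitInterval) : ℝ) =
    max 0 ((a : ℝ) + b - 1) :=
  rfl

theorem coe_lukImp (a b : unitInterval) : ((lukImp a b : unitInterval) : ℝ) =
    min 1 (1 - (a : ℝ) + b) :=
  rfl

theorem lukImp_eq_one_iff {a b : unitInterval} : lukImp a b = 1 ↔ a ≤ b := by
  rw [← Subtype.coe_inj, coe_lukImp, ← Subtype.coe_le_coe, Set.Icc.coe_one, min_eq_left_iff]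
  constructor <;> intro h <;> linarith

theorem lukImp_zero (a : unitInterval) : lukImp a 0 = unitInterval.symm a := by
  apply Subtype.ext
  rw [coe_lukImp, unitInterval.coe_symm_eq, Set.Icc.coe_zero, min_eq_right] <;>
    linarith [a.2.1]

theorem lukMul_eq_one_iff {a b : unitInterval} : lukMul a b = 1 ↔ a = 1 ∧ b = 1 := by
  rw [← Subtype.coe_inj, coe_lukMul, ← Subtype.coe_inj, ← Subtype.coe_inj, Set.Icc.coe_one]
  have ha := a.2.2
  have hb := b.2.2
  constructor
  · intro h
    rcases le_total (0 : ℝ) ((a : ℝ) + b - 1) with h' | h'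
    · rw [max_eq_right h'] at h
      exact ⟨by linarith, by linarith⟩
    · rw [max_eq_left h'] at h
      exact absurd h zero_ne_one
  · rintro ⟨h, h'⟩
    rw [h, h']
    norm_num

theorem one_lukMul (a : unitInterval) : lukMul 1 a = a := by
  apply Subtype.ext
  rw [coe_lukMul, Set.Icc.coe_one, max_eq_right] <;> linarith [a.2.1]

theorem zero_lukMul (a : unitInterval) : lukMul 0 a = 0 := by
  apply Subtype.ext
  rw [coe_lukMul, Set.Icc.coe_zero, max_eq_left]
  linarith [a.2.2]

theorem continuous_lukMul {X : Type*} [TopologicalSpace X] {f g : X → unitInterval}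
    (hf : Continuous f) (hg : Continuous g) : Continuous fun x => lukMul (f x) (g x) :=
  Continuous.subtype_mk (by fun_prop) _

theorem continuous_lukImp {X : Type*} [TopologicalSpace X] {f g : X → unitInterval}
    (hf : Continuous f) (hg : Continuous g) : Continuous fun x => lukImp (f x) (g x) :=
  Continuous.subtype_mk (by fun_prop) _

/-! ### Witnessed models by compactness -/

namespace Model

theorem val_le_dia (M : Model.{u}) (φ : MFm) {v w : M.W} (h : M.R v w) :
    M.val φ w ≤ M.val (.dia φ) v :=
  le_iSup₂ (f := fun w (_ : M.R v w) => M.val φ w) w h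

theorem val_dia_le (M : Model.{u}) (φ : MFm) {v : M.W} {a : unitInterval}
    (h : ∀ w, M.R v w → M.val φ w ≤ a) : M.val (.dia φ) v ≤ a :=
  iSup₂_le h

/-- Negation is an order-reversing involution of `[0,1]`, so it exchanges infima and suprema, the
empty ones included. -/
theorem val_box (M : Model.{u}) (φ : MFm) (v : M.W) :
    M.val (.box φ) v = lukImp (M.val (.dia (.imp φ .bot)) v) 0 := by
  have hn : ∀ w, M.val (.imp φ .bot) w = unitInterval.symm (M.val φ w) := fun w => lukImp_zero _
  rw [lukImp_zero]
  apply le_antisymm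
  · rw [unitInterval.le_symm_comm]
    refine val_dia_le _ _ fun w hw => ?_
    rw [hn, unitInterval.symm_le_symm]
    exact iInf₂_le (f := fun w (_ : M.R v w) => M.val φ w) w hw
  · refine le_iInf₂ fun w hw => ?_
    rw [unitInterval.symm_le_comm, ← hn]
    exact val_le_dia _ _ hw

theorem val_dia_top (M : Model.{u}) {v w : M.W} (h : M.R v w) : M.val (.dia .top) v = 1 :=
  le_antisymm unitInterval.le_one' (val_le_dia M .top h)

theorem val_dia_of_forall_not (M : Model.{u}) (φ : MFm) {v : M.W} (h : ∀ w, ¬ M.R v w) :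
    M.val (.dia φ) v = 0 :=
  le_antisymm (val_dia_le M φ fun w hw => absurd hw (h w)) unitInterval.nonneg'

theorem val_box_le (M : Model.{u}) (φ : MFm) {v w : M.W} (h : M.R v w) :
    M.val (.box φ) v ≤ M.val φ w :=
  iInf₂_le (f := fun w (_ : M.R v w) => M.val φ w) w h

theorem le_val_box (M : Model.{u}) (φ : MFm) {v : M.W} {a : unitInterval}
    (h : ∀ w, M.R v w → a ≤ M.val φ w) : a ≤ M.val (.box φ) v :=
  le_iInf₂ h

theorem val_box_of_forall_not (M : Model.{u}) (φ : MFm) {v : M.W} (h : ∀ w, ¬ M.R v w) :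
    M.val (.box φ) v = 1 :=
  le_antisymm unitInterval.le_one' (le_val_box M φ fun w hw => absurd hw (h w))

theorem val_box_eq_one_iff (M : Model.{u}) (φ : MFm) (v : M.W) :
    M.val (.box φ) v = 1 ↔ ∀ w, M.R v w → M.val φ w = 1 :=
  ⟨fun h _ hw => le_antisymm unitInterval.le_one' (h.ge.trans (val_box_le M φ hw)),
    fun h => le_antisymm unitInterval.le_one' (le_val_box M φ fun w hw => (h w hw).ge)⟩

/-- Every world with a successor has, for every formula, a successor at which the supremum
defining the value of `◇φ` is attained. -/
def Witnessed (M : Model.{u}) : Prop :=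
  ∀ (v : M.W) (φ : MFm), (∃ w, M.R v w) → ∃ w, M.R v w ∧ M.val φ w = M.val (.dia φ) v

/-- The values of all formulas at a world. -/
noncomputable def type (M : Model.{u}) (v : M.W) : MFm → unitInterval := fun φ => M.val φ v

/-- The model on the closure of the set of types, with the closure of the accessibility relation. -/
noncomputable def closureModel (M : Model.{u}) : Model.{0} where
  W := closure (range M.type)
  nonempty := M.nonempty.elim fun v => ⟨⟨M.type v, subset_closure ⟨v, rfl⟩⟩⟩
  R s t := (s.1, t.1) ∈ closure {p | ∃ v w, M.R v w ∧ p = (M.type v, M.type w)}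
  e n t := t.1 (.var n)

/-- This carries the clauses of the connectives over to limits of types: each is an equation between
continuous functions of the coordinates, hence a closed condition. -/
theorem closure_types_induction (M : Model.{u}) {p : (MFm → unitInterval) → Prop}
    (hc : IsClosed {t | p t}) (h : ∀ v, p (M.type v)) (t : M.closureModel.W) : p t.1 :=
  closure_minimal (t := {t | p t}) (by rintro _ ⟨v, rfl⟩; exact h v) hc t.2

theorem closureModel_le (M : Model.{u}) {s t : M.closureModel.W} (h : M.closureModel.R s t)
    (φ : MFm) : t.1 φ ≤ s.1 (.dia φ) := by
  have hc : IsClosed {p : (MFm → unitInterval) × (MFm → unitInterval) | p.2 φ ≤ p.1 (.dia φ)} :=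
    isClosed_le (by fun_prop) (by fun_prop)
  refine closure_minimal ?_ hc h
  rintro _ ⟨v, w, hvw, rfl⟩
  exact val_le_dia M φ hvw

theorem dia_le_dia_top (M : Model.{u}) (t : M.closureModel.W) (φ : MFm) :
    t.1 (.dia φ) ≤ t.1 (.dia .top) := by
  refine M.closure_types_induction (p := fun t => t (.dia φ) ≤ t (.dia .top))
    (isClosed_le (by fun_prop) (by fun_prop)) (fun v => ?_) t
  exact val_dia_le M φ fun w hw => unitInterval.le_one'.trans (val_dia_top M hw).ge

/-- The value of `◇1` tells dead ends from worlds with a successor. As `{0, 1}` is closed, this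
distinction survives in the limit. -/
theorem dia_top_eq (M : Model.{u}) (t : M.closureModel.W) :
    t.1 (.dia .top) = 0 ∨ t.1 (.dia .top) = 1 := by
  refine M.closure_types_induction (p := fun t => t (.dia .top) = 0 ∨ t (.dia .top) = 1)
    ((isClosed_eq (by fun_prop) (by fun_prop)).union (isClosed_eq (by fun_prop) (by fun_prop)))
    (fun v => ?_) t
  by_cases h : ∃ w, M.R v w
  · obtain ⟨w, hw⟩ := h
    exact .inr (val_dia_top M hw)
  · exact .inl (val_dia_of_forall_not M _ (not_exists.1 h))

theorem exists_near_witness (M : Model.{u}) {v w : M.W} (hv : M.R v w) (φ : MFm) {ε : ℝ}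
    (hε : 0 < ε) : ∃ w, M.R v w ∧ (M.val (.dia φ) v : ℝ) - ε ≤ M.val φ w := by
  by_contra! h
  by_cases hz : (M.val (.dia φ) v : ℝ) - ε < 0
  · exact absurd (h w hv) (not_lt.2 (hz.le.trans (M.val φ w).2.1))
  · have hle : M.val (.dia φ) v ≤ ⟨(M.val (.dia φ) v : ℝ) - ε, not_lt.1 hz,
        by linarith [(M.val (.dia φ) v).2.2]⟩ := val_dia_le M φ fun w hw => (h w hw).le
    have : (M.val (.dia φ) v : ℝ) ≤ (M.val (.dia φ) v : ℝ) - ε := hle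
    linarith

/-- The pairs in the closed relation whose second component almost attains the supremum form a
compact set, so its first projection is closed. This projection contains the types of all worlds
with a successor; they accumulate at `s`, because positivity of `◇1` is an open condition that holds
at `s`. -/
theorem closureModel_exists_near (M : Model.{u}) (s : M.closureModel.W)
    (hs : s.1 (.dia .top) = 1) (φ : MFm) {ε : ℝ} (hε : 0 < ε) :
    ∃ t, M.closureModel.R s t ∧ (s.1 (.dia φ) : ℝ) - ε ≤ t.1 φ := by
  let S := closure {p | ∃ v w, M.R v w ∧ p = (M.type v, M.type w)}
  let Q := S ∩ {p | (p.1 (.dia φ) : ℝ) - ε ≤ p.2 φ}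
  have hQ : IsClosed (Prod.fst '' Q) :=
    ((isClosed_closure.inter (isClosed_le (by fun_prop) (by fun_prop))).isCompact.image
      continuous_fst).isClosed
  have hU : IsOpen {t : MFm → unitInterval | 0 < t (.dia .top)} :=
    isOpen_lt (by fun_prop) (by fun_prop)
  have hmem : s.1 ∈ closure ({t | 0 < t (.dia .top)} ∩ range M.type) :=
    hU.inter_closure ⟨show 0 < s.1 (.dia .top) by rw [hs]; exact zero_lt_one, s.2⟩
  have hsub : {t : MFm → unitInterval | 0 < t (.dia .top)} ∩ range M.type ⊆ Prod.fst '' Q := by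
    rintro _ ⟨h, v, rfl⟩
    have hw : ∃ w, M.R v w := by
      by_contra hn
      exact h.ne' (val_dia_of_forall_not M _ (not_exists.1 hn))
    obtain ⟨w, hw⟩ := hw
    obtain ⟨w', hw', hle⟩ := exists_near_witness M hw φ hε
    exact ⟨(M.type v, M.type w'), ⟨subset_closure ⟨v, w', hw', rfl⟩, hle⟩, rfl⟩
  obtain ⟨⟨a, b⟩, ⟨hab, hle⟩, rfl : a = s.1⟩ := closure_minimal hsub hQ hmem
  have hb : b ∈ closure (range M.type) := by
    have hc : IsClosed {p : (MFm → unitInterval) × (MFm → unitInterval) |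
        p.2 ∈ closure (range M.type)} := isClosed_closure.preimage continuous_snd
    refine closure_minimal ?_ hc hab
    rintro _ ⟨v, w, -, rfl⟩
    exact subset_closure ⟨w, rfl⟩
  exact ⟨⟨b, hb⟩, hab, hle⟩

/-- The propositional clauses are closed conditions on types. For `◇`, the upper bound is closed as
well, and the lower bound comes from almost optimal successors if `◇1` has value `1`; otherwise all
formulas `◇φ` have value `0`. -/
theorem closureModel_val (M : Model.{u}) (φ : MFm) (t : M.closureModel.W) :
    M.closureModel.val φ t = t.1 φ := by
  -- Kept apart from the induction because the case of `□φ` applies it to `φ → 0`, which is not a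
  -- subformula.
  have dia : ∀ φ : MFm, (∀ t, M.closureModel.val φ t = t.1 φ) → ∀ t : M.closureModel.W,
      M.closureModel.val (.dia φ) t = t.1 (.dia φ) := by
    intro φ ih t
    apply le_antisymm
    · exact val_dia_le _ _ fun s hs => (ih s).trans_le (closureModel_le M hs φ)
    · rcases dia_top_eq M t with h | h
      · exact (dia_le_dia_top M t φ).trans (h.le.trans unitInterval.nonneg')
      · rw [← Subtype.coe_le_coe]
        refine le_of_forall_pos_le_add fun ε hε => ?_
        obtain ⟨s, hs, hle⟩ := closureModel_exists_near M t h φ hε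
        have := Subtype.coe_le_coe.2 (val_le_dia _ φ hs)
        rw [ih] at this
        linarith
  have bot : ∀ t : M.closureModel.W, t.1 .bot = 0 :=
    M.closure_types_induction (p := fun t => t .bot = 0)
      (isClosed_eq (by fun_prop) (by fun_prop)) fun v => rfl
  have imp : ∀ (φ ψ : MFm) (t : M.closureModel.W), t.1 (.imp φ ψ) = lukImp (t.1 φ) (t.1 ψ) :=
    fun φ ψ => M.closure_types_induction (p := fun t => t (.imp φ ψ) = lukImp (t φ) (t ψ))
      (isClosed_eq (by fun_prop) (continuous_lukImp (continuous_apply φ) (continuous_apply ψ)))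
        fun v => rfl
  induction φ generalizing t with
  | var n => rfl
  | bot => exact (bot t).symm
  | top =>
    exact (M.closure_types_induction (p := fun t => t .top = 1)
      (isClosed_eq (by fun_prop) (by fun_prop)) (fun v => rfl) t).symm
  | and φ ψ ih₁ ih₂ =>
    rw [val, ih₁, ih₂]
    exact (M.closure_types_induction (p := fun t => t (.and φ ψ) = t φ ⊓ t ψ)
      (isClosed_eq (by fun_prop) (by fun_prop)) (fun v => rfl) t).symm
  | or φ ψ ih₁ ih₂ =>
    rw [val, ih₁, ih₂]
    exact (M.closure_types_induction (p := fun t => t (.or φ ψ) = t φ ⊔ t ψ)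
      (isClosed_eq (by fun_prop) (by fun_prop)) (fun v => rfl) t).symm
  | mul φ ψ ih₁ ih₂ =>
    rw [val, ih₁, ih₂]
    exact (M.closure_types_induction (p := fun t => t (.mul φ ψ) = lukMul (t φ) (t ψ))
      (isClosed_eq (by fun_prop) (continuous_lukMul (continuous_apply φ) (continuous_apply ψ)))
        (fun v => rfl) t).symm
  | imp φ ψ ih₁ ih₂ => rw [val, ih₁, ih₂, imp]
  | dia φ ih => exact dia φ ih t
  | box φ ih =>
    rw [val_box, dia (.imp φ .bot) fun s => by rw [val, ih, imp, bot]; rfl]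
    exact (M.closure_types_induction
      (p := fun t => t (.box φ) = lukImp (t (.dia (.imp φ .bot))) 0)
      (isClosed_eq (by fun_prop) (continuous_lukImp (continuous_apply _) continuous_const))
        (fun v => val_box M φ v) t).symm

/-- The successors of a point form a closed subset of a compact product, on which the coordinate `φ`
attains its maximum. -/
theorem closureModel_witnessed (M : Model.{u}) : M.closureModel.Witnessed := by
  rintro t φ ⟨t', ht'⟩
  have hc : IsCompact {b | (t.1, b) ∈ closure {p | ∃ v w, M.R v w ∧ p = (M.type v, M.type w)}} :=
    (isClosed_closure.preimage (by fun_prop : Continuous fun b => (t.1, b))).isCompact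
  obtain ⟨b, hb, hmax⟩ := hc.exists_isMaxOn ⟨t'.1, ht'⟩ (continuous_apply φ).continuousOn
  have hb' : b ∈ closure (range M.type) := by
    have hcl : IsClosed {p : (MFm → unitInterval) × (MFm → unitInterval) |
        p.2 ∈ closure (range M.type)} := isClosed_closure.preimage continuous_snd
    refine closure_minimal ?_ hcl hb
    rintro _ ⟨v, w, -, rfl⟩
    exact subset_closure ⟨w, rfl⟩
  refine ⟨⟨b, hb'⟩, hb, le_antisymm (val_le_dia _ φ hb) (val_dia_le _ _ fun s hs => ?_)⟩
  exact (closureModel_val M φ s).trans_le ((hmax hs).trans (closureModel_val M φ ⟨b, hb'⟩).ge)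

/-- In a serial model `◇1` has value `1` everywhere. This is a closed condition, and in the closure
model it yields successors again. -/
theorem closureModel_isSerial {M : Model.{u}} (h : M.IsSerial) : M.closureModel.IsSerial := by
  intro t
  have ht : t.1 (.dia .top) = 1 :=
    M.closure_types_induction (p := fun t => t (.dia .top) = 1)
      (isClosed_eq (by fun_prop) (by fun_prop))
      (fun v => (h v).elim fun w hw => val_dia_top M hw) t
  obtain ⟨s, hs, -⟩ := closureModel_exists_near M t ht .top one_pos
  exact ⟨s, hs⟩

theorem exists_witnessed (M : Model.{u}) (v : M.W) : ∃ (N : Model.{0}) (w : N.W), N.Witnessed ∧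
    (M.IsSerial → N.IsSerial) ∧ ∀ φ, N.val φ w = M.val φ v :=
  ⟨M.closureModel, ⟨M.type v, subset_closure ⟨v, rfl⟩⟩, M.closureModel_witnessed,
    closureModel_isSerial, fun φ => closureModel_val M φ _⟩

end Model

end LukModal

namespace LukModal
open Set Topology

/-! ### The translation into propositional logic -/

theorem PFm.eval_bigOr_le_iff {V : Type} (h : V → unitInterval) (L : List (PFm V))
    (a : unitInterval) : (bigOr L).eval h ≤ a ↔ ∀ γ ∈ L, γ.eval h ≤ a := by
  induction L with
  | nil => simp [bigOr, eval]
  | cons γ L ih =>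
    have : (bigOr (γ :: L)).eval h = γ.eval h ⊔ (bigOr L).eval h := rfl
    rw [this, sup_le_iff, ih, List.forall_mem_cons]

theorem PFm.eval_iff_eq_one {V : Type} (h : V → unitInterval) (φ ψ : PFm V) :
    (iff φ ψ).eval h = 1 ↔ φ.eval h = ψ.eval h := by
  rw [iff, eval, eval, eval, lukMul_eq_one_iff, lukImp_eq_one_iff, lukImp_eq_one_iff,
    le_antisymm_iff]

theorem PFm.eval_or_neg_eq_one {V : Type} (h : V → unitInterval) (φ : PFm V) :
    (or φ (neg φ)).eval h = 1 ↔ φ.eval h = 1 ∨ φ.eval h = 0 := by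
  have : (or φ (neg φ)).eval h = φ.eval h ⊔ lukImp (φ.eval h) 0 := rfl
  rw [this, lukImp_zero]
  constructor
  · intro h'
    rcases le_total (φ.eval h) (unitInterval.symm (φ.eval h)) with hl | hl
    · rw [sup_eq_right.2 hl] at h'
      exact .inr (unitInterval.symm_eq_one.1 h')
    · rw [sup_eq_left.2 hl] at h'
      exact .inl h'
  · rintro (h' | h') <;> rw [h'] <;> simp

theorem eval_maxAxiom (h : TVar → unitInterval) (Θ : List DFm) (i : ℕ) (σ : World) (ψ : DFm) :
    (maxAxiom Θ i σ ψ).eval h = 1 ↔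
      ∀ χ ∈ sig Θ i, (sharp (χ :: σ) ψ).eval h ≤ (sharp (ψ :: σ) ψ).eval h := by
  rw [maxAxiom, PFm.eval, lukImp_eq_one_iff, PFm.eval_bigOr_le_iff]
  simp

theorem forall_mem_PsiSerial (h : TVar → unitInterval) (Θ : List DFm) :
    (∀ γ ∈ PsiSerial Θ, γ.eval h = 1) ↔ ∀ i < maxDepth Θ, ∀ σ ∈ worlds Θ i, ∀ ψ ∈ sig Θ i,
      h (.dia ψ σ) = (sharp (ψ :: σ) ψ).eval h ∧
      ∀ χ ∈ sig Θ i, (sharp (χ :: σ) ψ).eval h ≤ (sharp (ψ :: σ) ψ).eval h := by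
  have key : ∀ (i : ℕ) (σ : World) (ψ : DFm),
      (∀ γ ∈ [PFm.iff (.var (.dia ψ σ)) (sharp (ψ :: σ) ψ), maxAxiom Θ i σ ψ], γ.eval h = 1) ↔
      (h (.dia ψ σ) = (sharp (ψ :: σ) ψ).eval h ∧
      ∀ χ ∈ sig Θ i, (sharp (χ :: σ) ψ).eval h ≤ (sharp (ψ :: σ) ψ).eval h) := by
    intro i σ ψ
    simp only [List.forall_mem_cons, PFm.eval_iff_eq_one, eval_maxAxiom]
    simp [PFm.eval]
  simp only [← key]
  simp only [PsiSerial, List.mem_flatMap, List.mem_range, forall_exists_index, and_imp]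
  exact ⟨fun H i hi σ hσ ψ hψ γ hγ => H γ i hi σ hσ ψ hψ hγ,
    fun H γ i hi σ hσ ψ hψ hγ => H i hi σ hσ ψ hψ γ hγ⟩

theorem forall_mem_Psi (h : TVar → unitInterval) (Θ : List DFm) :
    (∀ γ ∈ Psi Θ, γ.eval h = 1) ↔ ∀ i < maxDepth Θ, ∀ σ ∈ worlds Θ i,
      (h (.succ σ) = 1 ∨ h (.succ σ) = 0) ∧ ∀ ψ ∈ sig Θ i,
      h (.dia ψ σ) = lukMul (h (.succ σ)) ((sharp (ψ :: σ) ψ).eval h) ∧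
      ∀ χ ∈ sig Θ i, (sharp (χ :: σ) ψ).eval h ≤ (sharp (ψ :: σ) ψ).eval h := by
  have key : ∀ (i : ℕ) (σ : World) (ψ : DFm),
      (∀ γ ∈ [PFm.iff (.var (.dia ψ σ)) (.mul (.var (.succ σ)) (sharp (ψ :: σ) ψ)),
        maxAxiom Θ i σ ψ], γ.eval h = 1) ↔
      (h (.dia ψ σ) = lukMul (h (.succ σ)) ((sharp (ψ :: σ) ψ).eval h) ∧
      ∀ χ ∈ sig Θ i, (sharp (χ :: σ) ψ).eval h ≤ (sharp (ψ :: σ) ψ).eval h) := by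
    intro i σ ψ
    simp only [List.forall_mem_cons, PFm.eval_iff_eq_one, eval_maxAxiom]
    simp [PFm.eval]
  have key' : ∀ σ, (h (.succ σ) = 1 ∨ h (.succ σ) = 0) ↔
      (PFm.or (.var (.succ σ)) (PFm.neg (.var (.succ σ)))).eval h = 1 := by
    intro σ
    rw [PFm.eval_or_neg_eq_one]
    rfl
  simp only [← key, key']
  simp only [Psi, List.mem_flatMap, List.mem_range, forall_exists_index, and_imp, List.mem_cons]
  constructor
  · intro H i hi σ hσ
    exact ⟨H _ i hi σ hσ (.inl rfl), fun ψ hψ γ hγ => H γ i hi σ hσ (.inr ⟨ψ, hψ, hγ⟩)⟩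
  · rintro H γ i hi σ hσ (rfl | ⟨ψ, hψ, hγ⟩)
    · exact (H i hi σ hσ).1
    · exact (H i hi σ hσ).2 ψ hψ γ hγ

/-- The inclusion of the `◇`-formulas into all modal formulas. -/
def DFm.toMFm : DFm → MFm
  | .var n => .var n
  | .bot => .bot
  | .top => .top
  | .and φ ψ => .and φ.toMFm ψ.toMFm
  | .or φ ψ => .or φ.toMFm ψ.toMFm
  | .mul φ ψ => .mul φ.toMFm ψ.toMFm
  | .imp φ ψ => .imp φ.toMFm ψ.toMFm
  | .dia φ => .dia φ.toMFm

theorem val_toMFm_toDia (M : Model.{u}) (φ : MFm) (v : M.W) :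
    M.val φ.toDia.toMFm v = M.val φ v := by
  induction φ generalizing v with
  | var n => rfl
  | bot => rfl
  | top => rfl
  | and φ ψ ih₁ ih₂ => simp only [MFm.toDia, DFm.toMFm, Model.val, ih₁, ih₂]
  | or φ ψ ih₁ ih₂ => simp only [MFm.toDia, DFm.toMFm, Model.val, ih₁, ih₂]
  | mul φ ψ ih₁ ih₂ => simp only [MFm.toDia, DFm.toMFm, Model.val, ih₁, ih₂]
  | imp φ ψ ih₁ ih₂ => simp only [MFm.toDia, DFm.toMFm, Model.val, ih₁, ih₂]
  | dia φ ih => simp only [MFm.toDia, DFm.toMFm, Model.val, ih]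
  | box φ ih =>
    rw [Model.val_box]
    simp only [MFm.toDia, DFm.toMFm, Model.val, ih]

/-! ### From models to propositional valuations -/

section Unravel

variable (M : Model.{u})

open Classical in
/-- The world of a witnessed model named by a list of formulas. -/
noncomputable def Model.point (v : M.W) : World → M.W
  | [] => v
  | χ :: σ => if h : ∃ w, M.R (Model.point v σ) w ∧
      M.val χ.toMFm w = M.val (.dia χ.toMFm) (Model.point v σ) then h.choose
      else Model.point v σ

open Classical in
/-- The propositional valuation read off from a witnessed model. -/
noncomputable def Model.unravel (v : M.W) : TVar → unitInterval
  | .atom x σ => M.val (.var x) (M.point v σ)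
  | .dia ψ σ => M.val (.dia ψ.toMFm) (M.point v σ)
  | .succ σ => if ∃ w, M.R (M.point v σ) w then 1 else 0

variable {M}

theorem Model.eval_sharp_unravel (v : M.W) (σ : World) (ψ : DFm) :
    (sharp σ ψ).eval (M.unravel v) = M.val ψ.toMFm (M.point v σ) := by
  induction ψ with
  | var n => rfl
  | bot => rfl
  | top => rfl
  | and φ ψ ih₁ ih₂ => simp only [sharp, PFm.eval, DFm.toMFm, Model.val, ih₁, ih₂]
  | or φ ψ ih₁ ih₂ => simp only [sharp, PFm.eval, DFm.toMFm, Model.val, ih₁, ih₂]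
  | mul φ ψ ih₁ ih₂ => simp only [sharp, PFm.eval, DFm.toMFm, Model.val, ih₁, ih₂]
  | imp φ ψ ih₁ ih₂ => simp only [sharp, PFm.eval, DFm.toMFm, Model.val, ih₁, ih₂]
  | dia φ ih => rfl

theorem Model.Witnessed.point_cons (hM : M.Witnessed) (v : M.W) (σ : World) (χ : DFm)
    (h : ∃ w, M.R (M.point v σ) w) : M.R (M.point v σ) (M.point v (χ :: σ)) ∧
      M.val χ.toMFm (M.point v (χ :: σ)) = M.val (.dia χ.toMFm) (M.point v σ) := by
  have h' := hM (M.point v σ) χ.toMFm h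
  have : M.point v (χ :: σ) = h'.choose := dif_pos h'
  rw [this]
  exact h'.choose_spec

theorem Model.point_cons_of_not (v : M.W) (σ : World) (χ : DFm)
    (h : ¬ ∃ w, M.R (M.point v σ) w) : M.point v (χ :: σ) = M.point v σ :=
  dif_neg fun ⟨w, hw, _⟩ => h ⟨w, hw⟩

/-- At a world with a successor the named children attain the suprema. At a dead end every child
name denotes the dead end itself, so the maximality formulas hold as equalities, while the marker
`0` forces the value `0` on `◇ψ`. -/
theorem Model.Witnessed.unravel_Psi (hM : M.Witnessed) (v : M.W) (Θ : List DFm) :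
    ∀ γ ∈ Psi Θ, γ.eval (M.unravel v) = 1 := by
  rw [forall_mem_Psi]
  intro i _ σ _
  by_cases h : ∃ w, M.R (M.point v σ) w
  · have hs : M.unravel v (.succ σ) = 1 := if_pos h
    refine ⟨.inl hs, fun ψ _ => ⟨?_, fun χ _ => ?_⟩⟩
    · rw [hs, one_lukMul, eval_sharp_unravel, (hM.point_cons v σ ψ h).2]
      rfl
    · rw [eval_sharp_unravel, eval_sharp_unravel, (hM.point_cons v σ ψ h).2]
      exact val_le_dia M _ (hM.point_cons v σ χ h).1
  · have hs : M.unravel v (.succ σ) = 0 := if_neg h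
    refine ⟨.inr hs, fun ψ _ => ⟨?_, fun χ _ => ?_⟩⟩
    · rw [hs, zero_lukMul]
      exact val_dia_of_forall_not M _ (not_exists.1 h)
    · rw [eval_sharp_unravel, eval_sharp_unravel, point_cons_of_not v σ χ h,
        point_cons_of_not v σ ψ h]

theorem Model.Witnessed.unravel_PsiSerial (hM : M.Witnessed) (hS : M.IsSerial) (v : M.W)
    (Θ : List DFm) : ∀ γ ∈ PsiSerial Θ, γ.eval (M.unravel v) = 1 := by
  rw [forall_mem_PsiSerial]
  intro i _ σ _ ψ _
  have h := hS (M.point v σ)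
  refine ⟨?_, fun χ _ => ?_⟩
  · rw [eval_sharp_unravel, (hM.point_cons v σ ψ h).2]
    rfl
  · rw [eval_sharp_unravel, eval_sharp_unravel, (hM.point_cons v σ ψ h).2]
    exact val_le_dia M _ (hM.point_cons v σ χ h).1

theorem Model.eval_rootSharp_unravel (v : M.W) (γ : MFm) :
    (rootSharp γ).eval (M.unravel v) = M.val γ v := by
  rw [rootSharp, eval_sharp_unravel, val_toMFm_toDia]
  rfl

end Unravel

/-! ### From propositional valuations to models -/

section Tree

variable (Θ : List DFm) (live : World → Prop) (loop : Prop) (h : TVar → unitInterval)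

/-- `τ` is a child of the live world `σ` in the tree of witnesses. -/
def IsChild (σ τ : World) : Prop :=
  ∃ i < maxDepth Θ, σ ∈ worlds Θ i ∧ live σ ∧ ∃ χ ∈ sig Θ i, τ = χ :: σ

/-- The tree of witnesses, with reflexive worlds in place of leaves if `loop` holds. -/
def treeModel : Model.{u} where
  W := ULift World
  nonempty := ⟨⟨[]⟩⟩
  R σ τ := IsChild Θ live σ.down τ.down ∨
    loop ∧ (∀ τ', ¬ IsChild Θ live σ.down τ') ∧ τ = σ
  e n σ := h (.atom n σ.down)

variable {Θ live loop h}

theorem treeModel_isSerial (hl : loop) : (treeModel.{u} Θ live loop h).IsSerial := by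
  intro σ
  by_cases H : ∃ τ, IsChild Θ live σ.down τ
  · obtain ⟨τ, hτ⟩ := H
    exact ⟨⟨τ⟩, .inl hτ⟩
  · exact ⟨σ, .inr ⟨hl, not_exists.1 H, rfl⟩⟩

theorem length_of_mem_worlds {i : ℕ} {σ : World} (hσ : σ ∈ worlds Θ i) : σ.length = i := by
  induction i generalizing σ with
  | zero => simp_all [worlds]
  | succ i ih =>
    simp only [worlds, List.mem_flatMap, List.mem_map] at hσ
    obtain ⟨τ, hτ, χ, -, rfl⟩ := hσ
    simp [ih hτ]

theorem cons_mem_worlds {i : ℕ} {σ : World} {χ : DFm} (hσ : σ ∈ worlds Θ i) (hχ : χ ∈ sig Θ i) :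
    χ :: σ ∈ worlds Θ (i + 1) :=
  List.mem_flatMap.2 ⟨σ, hσ, List.mem_map.2 ⟨χ, hχ, rfl⟩⟩

/-- The length of a name determines its level, so no world occurs on two levels with different sets
of children. -/
theorem isChild_iff {i : ℕ} {σ τ : World} (hi : i < maxDepth Θ) (hσ : σ ∈ worlds Θ i) :
    IsChild Θ live σ τ ↔ live σ ∧ ∃ χ ∈ sig Θ i, τ = χ :: σ := by
  constructor
  · rintro ⟨j, -, hj, hl, H⟩
    obtain rfl : j = i := (length_of_mem_worlds hj).symm.trans (length_of_mem_worlds hσ)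
    exact ⟨hl, H⟩
  · rintro ⟨hl, H⟩
    exact ⟨i, hi, hσ, hl, H⟩

theorem mem_filterMap_body? {L : List DFm} {χ : DFm} :
    χ ∈ (L.flatMap DFm.psfm).filterMap DFm.body? ↔ ∃ ψ ∈ L, .dia χ ∈ ψ.psfm := by
  simp only [List.mem_filterMap, List.mem_flatMap]
  constructor
  · rintro ⟨a, ⟨ψ, hψ, ha⟩, hb⟩
    cases a <;> simp [DFm.body?] at hb
    exact ⟨ψ, hψ, hb ▸ ha⟩
  · rintro ⟨ψ, hψ, ha⟩
    exact ⟨_, ⟨ψ, hψ, ha⟩, rfl⟩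

/-- The bound on level plus depth guarantees that `◇ψ` is only evaluated above the last level. If
the world is live, the child named after `ψ` exists and dominates its siblings; its existence also
excludes a loop there. If the world is dead, loops are excluded by `hdead` and both sides are `0`.
-/
theorem treeModel_val (hlive : ∀ i < maxDepth Θ, ∀ σ ∈ worlds Θ i, live σ → ∀ ψ ∈ sig Θ i,
      h (.dia ψ σ) = (sharp (ψ :: σ) ψ).eval h ∧
      ∀ χ ∈ sig Θ i, (sharp (χ :: σ) ψ).eval h ≤ (sharp (ψ :: σ) ψ).eval h)
    (hdead : ∀ i < maxDepth Θ, ∀ σ ∈ worlds Θ i, ¬ live σ → ¬ loop ∧ ∀ ψ ∈ sig Θ i,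
      h (.dia ψ σ) = 0)
    (ψ : DFm) (i : ℕ) (σ : World) (hσ : σ ∈ worlds Θ i)
    (hsub : ∀ χ, .dia χ ∈ ψ.psfm → χ ∈ sig Θ i) (hd : i + ψ.depth ≤ maxDepth Θ) :
    (treeModel.{u} Θ live loop h).val ψ.toMFm ⟨σ⟩ = (sharp σ ψ).eval h := by
  induction ψ generalizing i σ with
  | var n => rfl
  | bot => rfl
  | top => rfl
  | and φ ψ ih₁ ih₂ =>
    simp only [DFm.depth] at hd
    simp only [DFm.toMFm, Model.val, sharp, PFm.eval]
    rw [ih₁ i σ hσ (fun χ hχ => hsub χ (by simp [DFm.psfm, hχ])) (by omega),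
      ih₂ i σ hσ (fun χ hχ => hsub χ (by simp [DFm.psfm, hχ])) (by omega)]
  | or φ ψ ih₁ ih₂ =>
    simp only [DFm.depth] at hd
    simp only [DFm.toMFm, Model.val, sharp, PFm.eval]
    rw [ih₁ i σ hσ (fun χ hχ => hsub χ (by simp [DFm.psfm, hχ])) (by omega),
      ih₂ i σ hσ (fun χ hχ => hsub χ (by simp [DFm.psfm, hχ])) (by omega)]
  | mul φ ψ ih₁ ih₂ =>
    simp only [DFm.depth] at hd
    simp only [DFm.toMFm, Model.val, sharp, PFm.eval]
    rw [ih₁ i σ hσ (fun χ hχ => hsub χ (by simp [DFm.psfm, hχ])) (by omega),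
      ih₂ i σ hσ (fun χ hχ => hsub χ (by simp [DFm.psfm, hχ])) (by omega)]
  | imp φ ψ ih₁ ih₂ =>
    simp only [DFm.depth] at hd
    simp only [DFm.toMFm, Model.val, sharp, PFm.eval]
    rw [ih₁ i σ hσ (fun χ hχ => hsub χ (by simp [DFm.psfm, hχ])) (by omega),
      ih₂ i σ hσ (fun χ hχ => hsub χ (by simp [DFm.psfm, hχ])) (by omega)]
  | dia ψ ih =>
    simp only [DFm.depth] at hd
    have hi : i < maxDepth Θ := by omega
    have hψ : ψ ∈ sig Θ i := hsub ψ (by simp [DFm.psfm])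
    have hval : ∀ χ ∈ sig Θ i, (treeModel.{u} Θ live loop h).val ψ.toMFm ⟨χ :: σ⟩ =
        (sharp (χ :: σ) ψ).eval h := fun χ hχ =>
      ih (i + 1) (χ :: σ) (cons_mem_worlds hσ hχ)
        (fun ξ hξ => mem_filterMap_body?.2 ⟨ψ, hψ, hξ⟩) (by omega)
    change (treeModel.{u} Θ live loop h).val (.dia ψ.toMFm) ⟨σ⟩ = h (.dia ψ σ)
    by_cases hl : live σ
    · obtain ⟨heq, hmax⟩ := hlive i hi σ hσ hl ψ hψ
      rw [heq]
      have hchild : IsChild Θ live σ (ψ :: σ) := (isChild_iff hi hσ).2 ⟨hl, ψ, hψ, rfl⟩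
      apply le_antisymm
      · refine Model.val_dia_le _ _ ?_
        rintro ⟨τ⟩ (hτ | ⟨-, hno, -⟩)
        · obtain ⟨-, χ, hχ, rfl⟩ := (isChild_iff hi hσ).1 hτ
          exact (hval χ hχ).trans_le (hmax χ hχ)
        · exact absurd hchild (hno _)
      · rw [← hval ψ hψ]
        exact Model.val_le_dia (treeModel.{u} Θ live loop h) _ (.inl hchild)
    · obtain ⟨hloop, heq⟩ := hdead i hi σ hσ hl
      rw [heq ψ hψ]
      refine Model.val_dia_of_forall_not _ _ ?_
      rintro τ (hτ | ⟨H, -⟩)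
      · exact hl ((isChild_iff hi hσ).1 hτ).1
      · exact hloop H

theorem depth_le_maxDepth {ψ : DFm} (hψ : ψ ∈ Θ) : ψ.depth ≤ maxDepth Θ := by
  induction Θ with
  | nil => simp at hψ
  | cons χ Θ ih =>
    have : maxDepth (χ :: Θ) = max χ.depth (maxDepth Θ) := rfl
    rw [this]
    rcases List.mem_cons.1 hψ with rfl | h'
    · exact le_max_left _ _
    · exact (ih h').trans (le_max_right _ _)

theorem treeModel_val_root (hlive : ∀ i < maxDepth Θ, ∀ σ ∈ worlds Θ i, live σ → ∀ ψ ∈ sig Θ i,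
      h (.dia ψ σ) = (sharp (ψ :: σ) ψ).eval h ∧
      ∀ χ ∈ sig Θ i, (sharp (χ :: σ) ψ).eval h ≤ (sharp (ψ :: σ) ψ).eval h)
    (hdead : ∀ i < maxDepth Θ, ∀ σ ∈ worlds Θ i, ¬ live σ → ¬ loop ∧ ∀ ψ ∈ sig Θ i,
      h (.dia ψ σ) = 0)
    (φ : MFm) (hφ : φ.toDia ∈ Θ) :
    (treeModel.{u} Θ live loop h).val φ ⟨[]⟩ = (rootSharp φ).eval h := by
  exact (val_toMFm_toDia _ φ _).symm.trans (treeModel_val hlive hdead φ.toDia 0 []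
    (List.mem_singleton_self _) (fun χ hχ => mem_filterMap_body?.2 ⟨_, hφ, hχ⟩)
    (by simpa using depth_le_maxDepth hφ))

end Tree

theorem toDia_mem_theta_left (Γ : List MFm) (φ : MFm) : φ.toDia ∈ theta Γ φ :=
  List.mem_cons_self

theorem toDia_mem_theta_right {Γ : List MFm} (φ : MFm) {γ : MFm} (hγ : γ ∈ Γ) :
    γ.toDia ∈ theta Γ φ :=
  List.mem_cons_of_mem _ (List.mem_map_of_mem hγ)

theorem kConsequence_iff (Γ : List MFm) (φ : MFm) :
    KConsequence.{u} Γ φ ↔ PropConsequence (Γ.map rootSharp ++ Psi (theta Γ φ)) (rootSharp φ) := by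
  constructor
  · intro H h hh
    simp only [List.forall_mem_append, List.forall_mem_map, forall_mem_Psi] at hh
    obtain ⟨hΓ, hΨ⟩ := hh
    -- A world keeps its children exactly when its marker has value `1`; the others have to be
    -- genuine dead ends, so there are no loops.
    have key := treeModel_val_root.{u} (Θ := theta Γ φ) (h := h)
      (live := fun σ => h (.succ σ) = 1) (loop := False)
      (fun i hi σ hσ hl ψ hψ => ⟨by rw [((hΨ i hi σ hσ).2 ψ hψ).1, hl, one_lukMul],
        ((hΨ i hi σ hσ).2 ψ hψ).2⟩)
      (fun i hi σ hσ hl => ⟨id, fun ψ hψ => by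
        rw [((hΨ i hi σ hσ).2 ψ hψ).1, (hΨ i hi σ hσ).1.resolve_left hl, zero_lukMul]⟩)
    rw [← key φ (toDia_mem_theta_left Γ φ)]
    refine H _ trivial _ fun γ hγ => ?_
    rw [key γ (toDia_mem_theta_right φ hγ), hΓ γ hγ]
  · intro H M _ v hv
    obtain ⟨N, w, hN, -, hval⟩ := M.exists_witnessed v
    rw [← hval, ← Model.eval_rootSharp_unravel]
    refine H _ ?_
    simp only [List.forall_mem_append, List.forall_mem_map]
    refine ⟨fun γ hγ => ?_, hN.unravel_Psi w _⟩
    rw [Model.eval_rootSharp_unravel, hval, hv γ hγ]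

theorem serialConsequence_iff (Γ : List MFm) (φ : MFm) :
    SerialConsequence.{u} Γ φ ↔
      PropConsequence (Γ.map rootSharp ++ PsiSerial (theta Γ φ)) (rootSharp φ) := by
  constructor
  · intro H h hh
    simp only [List.forall_mem_append, List.forall_mem_map, forall_mem_PsiSerial] at hh
    obtain ⟨hΓ, hΨ⟩ := hh
    -- All worlds are live, and the loops only repair seriality where there is no child.
    have key := treeModel_val_root.{u} (Θ := theta Γ φ) (h := h)
      (live := fun _ => True) (loop := True)
      (fun i hi σ hσ _ ψ hψ => hΨ i hi σ hσ ψ hψ)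
      (fun i hi σ hσ hl => absurd trivial hl)
    rw [← key φ (toDia_mem_theta_left Γ φ)]
    refine H _ (treeModel_isSerial trivial) _ fun γ hγ => ?_
    rw [key γ (toDia_mem_theta_right φ hγ), hΓ γ hγ]
  · intro H M hM v hv
    obtain ⟨N, w, hN, hS, hval⟩ := M.exists_witnessed v
    rw [← hval, ← Model.eval_rootSharp_unravel]
    refine H _ ?_
    simp only [List.forall_mem_append, List.forall_mem_map]
    refine ⟨fun γ hγ => ?_, hN.unravel_PsiSerial (hS hM) w _⟩
    rw [Model.eval_rootSharp_unravel, hval, hv γ hγ]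

end LukModal

namespace LukModal
open Set Topology

/-! ### Rational points with the same order type as a real point -/

/-- Bounds for the coefficients that arise when variables are eliminated one after the other. -/
def coeffBound (B : ℕ) : ℕ → ℕ
  | 0 => B
  | i + 1 => 2 * coeffBound B i ^ 2

theorem coeffBound_two_mul_sq (B i : ℕ) : coeffBound (2 * B ^ 2) i = coeffBound B (i + 1) := by
  induction i with
  | zero => rfl
  | succ i ih => rw [coeffBound, ih]; rfl

/-- A common denominator for points that realize the signs of affine forms in `n` variables. -/
def commonDenom (B n : ℕ) : ℕ := ∏ i ∈ Finset.range n, 2 * (coeffBound B i).factorial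

theorem commonDenom_succ (B n : ℕ) :
    commonDenom B (n + 1) = commonDenom (2 * B ^ 2) n * (2 * B.factorial) := by
  simp only [commonDenom, Finset.prod_range_succ', coeffBound_two_mul_sq]
  rfl

theorem commonDenom_pos (B n : ℕ) : 0 < commonDenom B n :=
  Finset.prod_pos fun _ _ => Nat.mul_pos two_pos (Nat.factorial_pos _)

/-- The value of the affine form with constant term `b` and coefficients `a`. -/
def affine {n : ℕ} (b : ℤ) (a : Fin n → ℤ) (f : Fin n → ℝ) : ℝ := b + ∑ i, a i * f i

/-- Two points are on the same sides of all hyperplanes with integer coefficients up to `B`. -/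
def SameSigns {n : ℕ} (B : ℕ) (f g : Fin n → ℝ) : Prop :=
  ∀ (b : ℤ) (a : Fin n → ℤ), |b| ≤ B → (∀ i, |a i| ≤ B) →
    SignType.sign (affine b a f) = SignType.sign (affine b a g)

/-- If `y` is a threshold, the corresponding threshold on the other side is taken, with `i = j`.
Otherwise `y` lies strictly between two neighbouring thresholds, and the midpoint of their
counterparts has the same position. -/
theorem exists_between_thresholds {ι : Type*} [Finite ι] (τ τ' : ι → ℝ)
    (hτ : ∀ i j, SignType.sign (τ i - τ j) = SignType.sign (τ' i - τ' j)) (y : ℝ)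
    (hlo : ∃ i, τ i ≤ y) (hhi : ∃ i, y ≤ τ i) :
    ∃ i j, ∀ k, SignType.sign (y - τ k) = SignType.sign ((τ' i + τ' j) / 2 - τ' k) := by
  have hlt : ∀ i j, τ i < τ j ↔ τ' i < τ' j := by
    intro i j
    rw [← sub_neg, ← sign_eq_neg_one_iff, hτ, sign_eq_neg_one_iff, sub_neg]
  have hle : ∀ i j, τ i ≤ τ j ↔ τ' i ≤ τ' j := by
    intro i j
    rw [← not_lt, hlt, not_lt]
  by_cases he : ∃ i, τ i = y
  · obtain ⟨i, rfl⟩ := he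
    refine ⟨i, i, fun k => ?_⟩
    rw [hτ, add_self_div_two]
  · have hne : ∀ i, τ i ≠ y := not_exists.1 he
    obtain ⟨i₀, hi₀⟩ := hlo
    obtain ⟨j₀, hj₀⟩ := hhi
    obtain ⟨i, hi, hmax⟩ := Set.exists_max_image {i | τ i < y} τ (Set.toFinite _)
      ⟨i₀, lt_of_le_of_ne hi₀ (hne _)⟩
    obtain ⟨j, hj, hmin⟩ := Set.exists_min_image {i | y < τ i} τ (Set.toFinite _)
      ⟨j₀, lt_of_le_of_ne hj₀ (hne _).symm⟩
    have hij : τ' i < τ' j := (hlt i j).1 (lt_trans hi hj)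
    refine ⟨i, j, fun k => ?_⟩
    rcases lt_or_gt_of_ne (hne k) with hk | hk
    · have := (hle k i).1 (hmax k hk)
      rw [sign_pos (by linarith), sign_pos (by linarith)]
    · have := (hle j k).1 (hmin k hk)
      rw [sign_neg (by linarith), sign_neg (by linarith)]

theorem affine_cons {n : ℕ} (b : ℤ) (a : Fin (n + 1) → ℤ) (y : ℝ) (f : Fin n → ℝ) :
    affine b a (Fin.cons y f) = a 0 * y + affine b (Fin.tail a) f := by
  simp only [affine, Fin.sum_univ_succ, Fin.cons_zero, Fin.cons_succ, Fin.tail]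
  ring

theorem affine_combination {n : ℕ} (b b' c c' : ℤ) (a a' : Fin n → ℤ) (f : Fin n → ℝ) :
    affine (c * b - c' * b') (fun i => c * a i - c' * a' i) f =
      c * affine b a f - c' * affine b' a' f := by
  simp only [affine]
  push_cast
  simp only [sub_mul, Finset.sum_sub_distrib, mul_add, Finset.mul_sum, mul_assoc]
  ring

theorem exists_int_affine {n : ℕ} {D : ℕ} {g : Fin n → ℝ} (hg : ∀ i, ∃ z : ℤ, D * g i = z)
    (b : ℤ) (a : Fin n → ℤ) : ∃ z : ℤ, D * affine b a g = z := by
  choose z hz using hg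
  refine ⟨D * b + ∑ i, a i * z i, ?_⟩
  simp only [affine, mul_add, Finset.mul_sum]
  push_cast
  simp only [← hz]
  congr 1
  exact Finset.sum_congr rfl fun i _ => by ring

theorem abs_comb_le {B : ℕ} {c c' b b' : ℤ} (hc : |c| ≤ B) (hc' : |c'| ≤ B) (hb : |b| ≤ B)
    (hb' : |b'| ≤ B) : |c * b - c' * b'| ≤ (2 * B ^ 2 : ℕ) := by
  have h₁ : |c * b| ≤ B * B := by rw [abs_mul]; gcongr
  have h₂ : |c' * b'| ≤ B * B := by rw [abs_mul]; gcongr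
  have := abs_sub (c * b) (c' * b')
  push_cast
  nlinarith

/-- Fourier-Motzkin elimination of the first variable. The sign of a form containing it says on
which side of a threshold, an affine function of the other variables, it lies. Once the other
variables are replaced so that the thresholds keep their order, the first one is placed at a
threshold or midway between two. -/
theorem exists_rational_sameSigns (n : ℕ) (B : ℕ) (hB : 1 ≤ B) (f : Fin n → ℝ)
    (hf : ∀ i, f i ∈ Icc (0 : ℝ) 1) :
    ∃ g : Fin n → ℝ, (∀ i, ∃ z : ℤ, (commonDenom B n : ℝ) * g i = z) ∧ SameSigns B f g := by
  induction n generalizing B with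
  | zero => exact ⟨f, fun i => i.elim0, fun b a _ _ => rfl⟩
  | succ n ih =>
    obtain ⟨y, f, rfl⟩ : ∃ y f', f = Fin.cons y f' := ⟨f 0, Fin.tail f, (Fin.cons_self_tail f).symm⟩
    have hB' : B ≤ 2 * B ^ 2 := by nlinarith
    obtain ⟨g, hg, hs⟩ := ih (2 * B ^ 2) (hB.trans hB') f fun i => by simpa using hf i.succ
    -- The finitely many forms in which the first variable occurs; each has a threshold.
    let ι := {p : ℤ × (Fin (n + 1) → ℤ) | p.1 ∈ Icc (-(B : ℤ)) B ∧
      p.2 ∈ Set.pi univ (fun _ => Icc (-(B : ℤ)) B) ∧ p.2 0 ≠ 0}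
    have hfin : Finite ι := by
      refine Set.Finite.subset ((Set.finite_Icc (-(B : ℤ)) B).prod
        (Set.Finite.pi' fun _ => Set.finite_Icc (-(B : ℤ)) B)) ?_
      rintro p ⟨h₁, h₂, -⟩
      exact ⟨h₁, fun i => h₂ i trivial⟩
    have habs₁ : ∀ p : ι, |p.1.1| ≤ B := fun p => abs_le.2 p.2.1
    have habs₂ : ∀ (p : ι) i, |p.1.2 i| ≤ B := fun p i => abs_le.2 (p.2.2.1 i trivial)
    let τ (h : Fin n → ℝ) (p : ι) : ℝ := -(affine p.1.1 (Fin.tail p.1.2) h) / (p.1.2 0 : ℝ)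
    have hne : ∀ p : ι, ((p.1.2 0 : ℤ) : ℝ) ≠ 0 := fun p => Int.cast_ne_zero.2 p.2.2.2
    -- Cross-multiplication turns a comparison of thresholds into the sign of a form in the other
    -- variables with coefficients up to `2 * B ^ 2`, the bound used in the induction hypothesis.
    have hτ : ∀ h (p q : ι), τ h p - τ h q =
        affine (p.1.2 0 * q.1.1 - q.1.2 0 * p.1.1)
          (fun i => p.1.2 0 * Fin.tail q.1.2 i - q.1.2 0 * Fin.tail p.1.2 i) h *
          ((p.1.2 0 : ℝ) * (q.1.2 0 : ℝ))⁻¹ := by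
      intro h p q
      have := hne p
      have := hne q
      rw [affine_combination]
      simp only [τ]
      field_simp
      ring
    have hsign : ∀ p q : ι, SignType.sign (τ f p - τ f q) = SignType.sign (τ g p - τ g q) := by
      intro p q
      rw [hτ, hτ, sign_mul, sign_mul, hs (p.1.2 0 * q.1.1 - q.1.2 0 * p.1.1)
        (fun i => p.1.2 0 * Fin.tail q.1.2 i - q.1.2 0 * Fin.tail p.1.2 i)
        (abs_comb_le (habs₂ p 0) (habs₂ q 0) (habs₁ q) (habs₁ p))
        fun i => abs_comb_le (habs₂ p 0) (habs₂ q 0) (habs₂ q i.succ) (habs₂ p i.succ)]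
    have hy : y ∈ Icc (0 : ℝ) 1 := by simpa using hf 0
    -- The constants `0` and `1` are thresholds, so `y` has a threshold on either side.
    have hunit : ∀ c : ℤ, |c| ≤ 1 → ∃ p : ι, τ f p = c := by
      intro c hc
      rw [abs_le] at hc
      have hz : ∀ i, -(B : ℤ) ≤ (Fin.cons 1 0 : Fin (n + 1) → ℤ) i ∧
          (Fin.cons 1 0 : Fin (n + 1) → ℤ) i ≤ B := by
        intro i
        refine Fin.cases ?_ (fun i => ?_) i
        · simp only [Fin.cons_zero]
          omega
        · simp
      refine ⟨⟨(-c, Fin.cons 1 0), ⟨by omega, by omega⟩, fun i _ => hz i, by simp⟩, ?_⟩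
      simp [τ, affine]
    obtain ⟨p₀, hp₀⟩ := hunit 0 (by simp)
    obtain ⟨p₁, hp₁⟩ := hunit 1 (by simp)
    obtain ⟨i, j, hij⟩ := exists_between_thresholds (τ f) (τ g) hsign y
      ⟨p₀, by rw [hp₀]; simpa using hy.1⟩ ⟨p₁, by rw [hp₁]; simpa using hy.2⟩
    -- Dividing by the leading coefficient costs a factor `B!`, of which it is a divisor. The
    -- midpoint costs a further factor `2`.
    have hden : ∀ p : ι, ∃ z : ℤ,
        (commonDenom (2 * B ^ 2) n : ℝ) * B.factorial * τ g p = z := by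
      intro p
      obtain ⟨z, hz⟩ := exists_int_affine hg p.1.1 (Fin.tail p.1.2)
      have hpos : 0 < (p.1.2 0).natAbs := Int.natAbs_pos.2 p.2.2.2
      have hdvd : p.1.2 0 ∣ (B.factorial : ℤ) := by
        rw [← Int.natAbs_dvd, Int.natCast_dvd_natCast]
        refine Nat.dvd_factorial hpos ?_
        have := habs₂ p 0
        rw [Int.abs_eq_natAbs] at this
        exact_mod_cast this
      obtain ⟨w, hw⟩ := hdvd
      have hw' : ((B.factorial : ℕ) : ℝ) = (p.1.2 0 : ℝ) * w := by exact_mod_cast hw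
      refine ⟨-(z * w), ?_⟩
      have := hne p
      push_cast
      rw [← hz, hw']
      simp only [τ]
      field_simp
    refine ⟨Fin.cons ((τ g i + τ g j) / 2) g, fun k => ?_, fun b a hb ha => ?_⟩
    · rw [commonDenom_succ]
      refine Fin.cases ?_ (fun k => ?_) k
      · obtain ⟨z, hz⟩ := hden i
        obtain ⟨w, hw⟩ := hden j
        refine ⟨z + w, ?_⟩
        push_cast
        rw [← hz, ← hw, Fin.cons_zero]
        ring
      · obtain ⟨z, hz⟩ := hg k
        refine ⟨z * (2 * B.factorial), ?_⟩
        push_cast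
        rw [← hz, Fin.cons_succ]
        ring
    · rw [affine_cons, affine_cons]
      by_cases h0 : a 0 = 0
      · rw [h0, Int.cast_zero, zero_mul, zero_mul, zero_add, zero_add]
        exact hs _ _ (hb.trans (by exact_mod_cast hB'))
          fun i => (ha _).trans (by exact_mod_cast hB')
      · let p : ι := ⟨(b, a), abs_le.1 hb, fun i _ => abs_le.1 (ha i), h0⟩
        have key : ∀ (h : Fin n → ℝ) (t : ℝ), a 0 * t + affine b (Fin.tail a) h =
            a 0 * (t - τ h p) := by
          intro h t
          have := hne p
          change a 0 * t + affine b (Fin.tail a) h =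
            a 0 * (t - -(affine b (Fin.tail a) h) / (a 0 : ℝ))
          have h0' : (a 0 : ℝ) ≠ 0 := Int.cast_ne_zero.2 h0
          field_simp
          ring
        rw [key, key, sign_mul, sign_mul, hij p]

/-- Three coordinates suffice for the clause of a binary connective. The indices may coincide, in
which case coefficients add up to at most `3`. -/
theorem SameSigns.compare {n B : ℕ} {f g : Fin n → ℝ} (h : SameSigns B f g) (hB : 3 ≤ B)
    (i j k : Fin n) {α β γ b : ℤ} (hα : |α| ≤ 1) (hβ : |β| ≤ 1) (hγ : |γ| ≤ 1) (hb : |b| ≤ 1) :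
    SignType.sign (b + α * f i + β * f j + γ * f k) =
      SignType.sign (b + α * g i + β * g j + γ * g k) := by
  have key : ∀ f : Fin n → ℝ, affine b (Pi.single i α + Pi.single j β + Pi.single k γ) f =
      b + α * f i + β * f j + γ * f k := by
    intro f
    have hs : ∀ (i : Fin n) (α : ℤ), ∑ l, ((Pi.single i α : Fin n → ℤ) l : ℝ) * f l = α * f i := by
      intro i α
      rw [Finset.sum_eq_single i] <;> simp +contextual
    simp only [affine, Pi.add_apply, Int.cast_add, add_mul, Finset.sum_add_distrib, hs]
    ring
  rw [← key, ← key]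
  refine h _ _ (hb.trans (by exact_mod_cast (by omega : 1 ≤ B))) fun l => ?_
  have hsingle : ∀ (i : Fin n) (α : ℤ), |α| ≤ 1 → |(Pi.single i α : Fin n → ℤ) l| ≤ 1 := by
    intro i α hα
    rw [Pi.single_apply]
    split_ifs
    · exact hα
    · simp
  have h₁ := hsingle i α hα
  have h₂ := hsingle j β hβ
  have h₃ := hsingle k γ hγ
  have hB' : (3 : ℤ) ≤ B := by exact_mod_cast hB
  rw [abs_le] at *
  simp only [Pi.add_apply]
  constructor <;> linarith [h₁.1, h₁.2, h₂.1, h₂.2, h₃.1, h₃.2]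

end LukModal

namespace LukModal
open Set Topology

/-! ### Finite models -/

/-- `w` is a successor of `v` witnessing the value of `ψ` if `ψ` starts with a modality. -/
def Model.IsWitness (M : Model.{u}) (v : M.W) (ψ : MFm) (w : M.W) : Prop :=
  M.R v w ∧ ∀ χ, (ψ = .dia χ ∨ ψ = .box χ) → M.val χ w = M.val ψ v

/-- A minimum of `χ` is a maximum of `¬χ`, so witnesses for `◇` also serve `□`. -/
theorem Model.Witnessed.exists_isWitness {M : Model.{u}} (hM : M.Witnessed) (v : M.W) (ψ : MFm)
    (h : ∃ w, M.R v w) : ∃ w, M.IsWitness v ψ w := by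
  by_cases hd : ∃ χ, ψ = .dia χ
  · obtain ⟨χ, rfl⟩ := hd
    obtain ⟨w, hw, he⟩ := hM v χ h
    refine ⟨w, hw, ?_⟩
    rintro χ' (hχ | hχ) <;> cases hχ
    exact he
  by_cases hb : ∃ χ, ψ = .box χ
  · obtain ⟨χ, rfl⟩ := hb
    obtain ⟨w, hw, he⟩ := hM v (.imp χ .bot) h
    refine ⟨w, hw, ?_⟩
    rintro χ' (hχ | hχ) <;> cases hχ
    rw [val_box, ← he]
    change _ = lukImp (lukImp (M.val χ w) 0) 0
    rw [lukImp_zero, lukImp_zero, unitInterval.symm_symm]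
  · obtain ⟨w, hw⟩ := h
    refine ⟨w, hw, ?_⟩
    rintro χ' (hχ | hχ)
    · exact absurd ⟨χ', hχ⟩ hd
    · exact absurd ⟨χ', hχ⟩ hb

section FiniteTree

variable (M : Model.{u}) (K : ℕ)

open Classical in
/-- The worlds of a witnessed model arranged in a `(K + 1)`-ary tree: the child number `k` of a
world witnesses the formula with Gödel number `k`. -/
noncomputable def Model.heap (v : M.W) : ℕ → M.W
  | 0 => v
  | m + 1 =>
    have : m / (K + 1) < m + 1 := Nat.lt_succ_of_le (Nat.div_le_self _ _)
    if h : ∃ w, M.IsWitness (Model.heap v (m / (K + 1))) (MFm.ofNat (m % (K + 1))) w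
    then h.choose else Model.heap v (m / (K + 1))

/-- The number of worlds of the finite tree. -/
def numWorlds : ℕ := (K + 2) ^ K

theorem numWorlds_pos : 0 < numWorlds K := Nat.pow_pos (by omega)

/-- The finite model cut out of a witnessed model. -/
noncomputable def Model.heapModel (v : M.W) : Model.{0} where
  W := Fin (numWorlds K)
  nonempty := ⟨⟨0, numWorlds_pos K⟩⟩
  R i j := (∃ w, M.R (M.heap K v i) w) ∧ ∃ k ≤ K, (j : ℕ) = i * (K + 1) + k + 1
  e n i := M.e n (M.heap K v i)

variable {M K}

theorem Model.Witnessed.heap_child (hM : M.Witnessed) (v : M.W) (i : ℕ) {k : ℕ} (hk : k ≤ K)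
    (h : ∃ w, M.R (M.heap K v i) w) :
    M.IsWitness (M.heap K v i) (MFm.ofNat k) (M.heap K v (i * (K + 1) + k + 1)) := by
  have h1 : (i * (K + 1) + k) / (K + 1) = i := by
    rw [mul_comm, Nat.mul_add_div (by omega), Nat.div_eq_of_lt (by omega), add_zero]
  have h2 : (i * (K + 1) + k) % (K + 1) = k := by
    rw [mul_comm, Nat.mul_add_mod, Nat.mod_eq_of_lt (by omega)]
  have h' := hM.exists_isWitness (M.heap K v i) (MFm.ofNat k) h
  have : M.heap K v (i * (K + 1) + k + 1) = h'.choose := by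
    rw [Model.heap, h1, h2]
    exact dif_pos h'
  rw [this]
  exact h'.choose_spec

/-- Nodes of depth `j` have an index below `(K + 2) ^ j`, so `numWorlds K` indices cover depth `K`.
-/
theorem child_lt {i j k : ℕ} (hi : i < (K + 2) ^ j) (hk : k ≤ K) :
    i * (K + 1) + k + 1 < (K + 2) ^ (j + 1) := by
  have : (i + 1) * (K + 2) ≤ (K + 2) ^ j * (K + 2) := Nat.mul_le_mul_right _ hi
  rw [pow_succ]
  nlinarith

theorem Model.Witnessed.heapModel_exists (hM : M.Witnessed) (v : M.W) {i : Fin (numWorlds K)}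
    {j : ℕ} (hi : (i : ℕ) < (K + 2) ^ j) (hj : j < K) (h : ∃ w, M.R (M.heap K v i) w)
    {ψ : MFm} (hψ : ψ.toNat ≤ K) : ∃ i' : Fin (numWorlds K),
      (M.heapModel K v).R i i' ∧ M.IsWitness (M.heap K v i) ψ (M.heap K v i') := by
  have hlt : (i : ℕ) * (K + 1) + ψ.toNat + 1 < numWorlds K :=
    (child_lt hi hψ).trans_le (Nat.pow_le_pow_right (by omega) hj)
  refine ⟨⟨_, hlt⟩, ⟨h, ψ.toNat, hψ, rfl⟩, ?_⟩
  have := hM.heap_child v i hψ h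
  rwa [MFm.ofNat_toNat] at this

theorem Model.Witnessed.heapModel_R (hM : M.Witnessed) (v : M.W) {i i' : Fin (numWorlds K)}
    {j : ℕ} (hi : (i : ℕ) < (K + 2) ^ j) (h : (M.heapModel K v).R i i') :
    M.R (M.heap K v i) (M.heap K v i') ∧ (i' : ℕ) < (K + 2) ^ (j + 1) := by
  obtain ⟨h, k, hk, he⟩ := h
  rw [he]
  exact ⟨(hM.heap_child v i hk h).1, child_lt hi hk⟩

/-- Every modality consumes one level of the tree and strictly lowers the Gödel number, so the sum
of level and Gödel number never exceeds `K` and the truncation is not reached. The children are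
successors in the original model and include a witness for every modal formula of code at most `K`.
-/
theorem Model.Witnessed.heapModel_val (hM : M.Witnessed) (v : M.W) (ψ : MFm) (j : ℕ)
    (i : Fin (numWorlds K)) (hi : (i : ℕ) < (K + 2) ^ j) (hj : j + ψ.toNat ≤ K) :
    (M.heapModel K v).val ψ i = M.val ψ (M.heap K v i) := by
  induction ψ generalizing j i with
  | var n => rfl
  | bot => rfl
  | top => rfl
  | and φ ψ ih₁ ih₂ =>
    have h1 := Nat.left_le_pair φ.toNat ψ.toNat
    have h2 := Nat.right_le_pair φ.toNat ψ.toNat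
    simp only [MFm.toNat] at hj
    simp only [val]
    rw [ih₁ j i hi (by omega), ih₂ j i hi (by omega)]
  | or φ ψ ih₁ ih₂ =>
    have h1 := Nat.left_le_pair φ.toNat ψ.toNat
    have h2 := Nat.right_le_pair φ.toNat ψ.toNat
    simp only [MFm.toNat] at hj
    simp only [val]
    rw [ih₁ j i hi (by omega), ih₂ j i hi (by omega)]
  | mul φ ψ ih₁ ih₂ =>
    have h1 := Nat.left_le_pair φ.toNat ψ.toNat
    have h2 := Nat.right_le_pair φ.toNat ψ.toNat
    simp only [MFm.toNat] at hj
    simp only [val]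
    rw [ih₁ j i hi (by omega), ih₂ j i hi (by omega)]
  | imp φ ψ ih₁ ih₂ =>
    have h1 := Nat.left_le_pair φ.toNat ψ.toNat
    have h2 := Nat.right_le_pair φ.toNat ψ.toNat
    simp only [MFm.toNat] at hj
    simp only [val]
    rw [ih₁ j i hi (by omega), ih₂ j i hi (by omega)]
  | dia φ ih =>
    have hφ : φ.toNat < (MFm.dia φ).toNat := by simp only [MFm.toNat]; omega
    have hval : ∀ i' : Fin (numWorlds K), (M.heapModel K v).R i i' →
        (M.heapModel K v).val φ i' = M.val φ (M.heap K v i') := fun i' hi' =>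
      ih (j + 1) i' (hM.heapModel_R v hi hi').2 (by omega)
    apply le_antisymm
    · exact val_dia_le _ _ fun i' hi' => (hval i' hi').trans_le
        (val_le_dia M φ (hM.heapModel_R v hi hi').1)
    · by_cases h : ∃ w, M.R (M.heap K v i) w
      · obtain ⟨i', hi', hw⟩ := hM.heapModel_exists v hi (by omega) h (ψ := .dia φ) (by omega)
        rw [← hw.2 φ (.inl rfl), ← hval i' hi']
        exact val_le_dia _ φ hi'
      · rw [val_dia_of_forall_not M φ (not_exists.1 h)]
        exact unitInterval.nonneg'
  | box φ ih =>
    have hφ : φ.toNat < (MFm.box φ).toNat := by simp only [MFm.toNat]; omega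
    have hval : ∀ i' : Fin (numWorlds K), (M.heapModel K v).R i i' →
        (M.heapModel K v).val φ i' = M.val φ (M.heap K v i') := fun i' hi' =>
      ih (j + 1) i' (hM.heapModel_R v hi hi').2 (by omega)
    apply le_antisymm
    · by_cases h : ∃ w, M.R (M.heap K v i) w
      · obtain ⟨i', hi', hw⟩ := hM.heapModel_exists v hi (by omega) h (ψ := .box φ) (by omega)
        rw [← hw.2 φ (.inr rfl), ← hval i' hi']
        exact val_box_le _ φ hi'
      · rw [val_box_of_forall_not M φ (not_exists.1 h)]
        exact unitInterval.le_one'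
    · exact le_val_box _ _ fun i' hi' =>
        (val_box_le M φ (hM.heapModel_R v hi hi').1).trans_eq (hval i' hi').symm

end FiniteTree

/-! ### Tables of values with a common denominator -/

/-- The rational table `T`, with denominator `d`, satisfies the clause for the value of the formula
at the world `w` of the frame `r` on the worlds below `n`. -/
def ClauseAt (d n : ℕ) (T : ℕ → ℕ → ℕ) (r : ℕ → ℕ → Prop) (w : ℕ) : MFm → Prop
  | .bot => T 0 w = 0
  | .top => T 1 w = d
  | .var _ => True
  | .and φ ψ => T (MFm.and φ ψ).toNat w = min (T φ.toNat w) (T ψ.toNat w)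
  | .or φ ψ => T (MFm.or φ ψ).toNat w = max (T φ.toNat w) (T ψ.toNat w)
  | .mul φ ψ => T (MFm.mul φ ψ).toNat w = T φ.toNat w + T ψ.toNat w - d
  | .imp φ ψ => T (MFm.imp φ ψ).toNat w = min d (d - T φ.toNat w + T ψ.toNat w)
  | .box φ => (∀ w' < n, r w w' → T (MFm.box φ).toNat w ≤ T φ.toNat w') ∧
      (T (MFm.box φ).toNat w = d ∨ ∃ w' < n, r w w' ∧ T φ.toNat w' = T (MFm.box φ).toNat w)
  | .dia φ => (∀ w' < n, r w w' → T φ.toNat w' ≤ T (MFm.dia φ).toNat w) ∧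
      (T (MFm.dia φ).toNat w = 0 ∨ ∃ w' < n, r w w' ∧ T φ.toNat w' = T (MFm.dia φ).toNat w)

/-- A table that satisfies all clauses below `K` and refutes `p`. -/
def IsRefutation (d n K : ℕ) (T : ℕ → ℕ → ℕ) (r : ℕ → ℕ → Prop) (p : List MFm × MFm) : Prop :=
  (∀ k < K + 1, ∀ w < n, ClauseAt d n T r w (MFm.ofNat k)) ∧
    (∀ γ ∈ p.1, T γ.toNat 0 = d) ∧ T p.2.toNat 0 ≠ d

section Table

variable (d n K : ℕ) (T : ℕ → ℕ → ℕ) (r : ℕ → ℕ → Prop)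

/-- The value given by a table. -/
noncomputable def tableValue (hT : ∀ k w, T k w ≤ d) (k w : ℕ) : unitInterval :=
  ⟨(T k w : ℝ) / d, by positivity, div_le_one_of_le₀ (by exact_mod_cast hT k w) (by positivity)⟩

/-- The finite model given by a table. -/
noncomputable def tableModel (hn : 0 < n) (hT : ∀ k w, T k w ≤ d) : Model.{u} where
  W := ULift (Fin n)
  nonempty := ⟨⟨⟨0, hn⟩⟩⟩
  R i j := r i.down j.down
  e m i := tableValue d T hT (MFm.var m).toNat i.down

variable {d n K T r}

theorem tableValue_le_iff (hd : 0 < d) (hT : ∀ k w, T k w ≤ d) (k w k' w' : ℕ) :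
    tableValue d T hT k w ≤ tableValue d T hT k' w' ↔ T k w ≤ T k' w' := by
  have hd' : (0 : ℝ) < d := by exact_mod_cast hd
  rw [← Subtype.coe_le_coe]
  simp only [tableValue]
  rw [div_le_div_iff_of_pos_right hd', Nat.cast_le]

theorem tableValue_eq_one_iff (hd : 0 < d) (hT : ∀ k w, T k w ≤ d) (k w : ℕ) :
    tableValue d T hT k w = 1 ↔ T k w = d := by
  have hd' : (d : ℝ) ≠ 0 := by exact_mod_cast hd.ne'
  rw [← Subtype.coe_inj]
  simp only [tableValue, Set.Icc.coe_one]
  rw [div_eq_one_iff_eq hd', Nat.cast_inj]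

theorem tableValue_eq_zero (hT : ∀ k w, T k w ≤ d) {k w : ℕ} (h : T k w = 0) :
    tableValue d T hT k w = 0 := by
  apply Subtype.ext
  simp [tableValue, h]

/-- The clauses determine the values by recursion on the formula. The alternatives `d` for `□` and
`0` for `◇` cover dead ends; elsewhere they are harmless, since the accompanying inequalities force
these extreme values at all successors. -/
theorem tableModel_val (hd : 0 < d) (hn : 0 < n) (hT : ∀ k w, T k w ≤ d)
    (hcl : ∀ k < K + 1, ∀ w < n, ClauseAt d n T r w (MFm.ofNat k)) (ψ : MFm) (hψ : ψ.toNat ≤ K)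
    (i : Fin n) :
    (tableModel.{u} d n T r hn hT).val ψ ⟨i⟩ = tableValue d T hT ψ.toNat i := by
  have hd' : (0 : ℝ) < d := by exact_mod_cast hd
  have hcl' : ∀ ψ : MFm, ψ.toNat ≤ K → ∀ i : Fin n, ClauseAt d n T r i ψ := by
    intro ψ hψ i
    have h := hcl ψ.toNat (by omega) i i.2
    rwa [MFm.ofNat_toNat] at h
  induction ψ generalizing i with
  | var n => rfl
  | bot => exact (tableValue_eq_zero hT (hcl' _ hψ i)).symm
  | top => exact ((tableValue_eq_one_iff hd hT _ _).2 (hcl' _ hψ i)).symm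
  | and φ ψ ih₁ ih₂ =>
    have h1 := Nat.left_le_pair φ.toNat ψ.toNat
    have h2 := Nat.right_le_pair φ.toNat ψ.toNat
    have hlt := hψ
    simp only [MFm.toNat] at hlt
    have h : T (MFm.and φ ψ).toNat i = _ := hcl' _ hψ i
    simp only [Model.val]
    rw [ih₁ (by omega) i, ih₂ (by omega) i]
    rcases le_total (T φ.toNat i) (T ψ.toNat i) with hle | hle
    · rw [inf_eq_left.2 ((tableValue_le_iff hd hT _ _ _ _).2 hle)]
      simp only [tableValue, h, min_eq_left hle]
    · rw [inf_eq_right.2 ((tableValue_le_iff hd hT _ _ _ _).2 hle)]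
      simp only [tableValue, h, min_eq_right hle]
  | or φ ψ ih₁ ih₂ =>
    have h1 := Nat.left_le_pair φ.toNat ψ.toNat
    have h2 := Nat.right_le_pair φ.toNat ψ.toNat
    have hlt := hψ
    simp only [MFm.toNat] at hlt
    have h : T (MFm.or φ ψ).toNat i = _ := hcl' _ hψ i
    simp only [Model.val]
    rw [ih₁ (by omega) i, ih₂ (by omega) i]
    rcases le_total (T φ.toNat i) (T ψ.toNat i) with hle | hle
    · rw [sup_eq_right.2 ((tableValue_le_iff hd hT _ _ _ _).2 hle)]
      simp only [tableValue, h, max_eq_right hle]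
    · rw [sup_eq_left.2 ((tableValue_le_iff hd hT _ _ _ _).2 hle)]
      simp only [tableValue, h, max_eq_left hle]
  | mul φ ψ ih₁ ih₂ =>
    have h1 := Nat.left_le_pair φ.toNat ψ.toNat
    have h2 := Nat.right_le_pair φ.toNat ψ.toNat
    have hlt := hψ
    simp only [MFm.toNat] at hlt
    have h : T (MFm.mul φ ψ).toNat i = _ := hcl' _ hψ i
    simp only [Model.val]
    rw [ih₁ (by omega) i, ih₂ (by omega) i]
    apply Subtype.ext
    simp only [coe_lukMul, tableValue, h]
    rcases le_total d (T φ.toNat i + T ψ.toNat i) with hle | hle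
    · have hle' : (d : ℝ) ≤ T φ.toNat i + T ψ.toNat i := by exact_mod_cast hle
      rw [Nat.cast_sub hle, max_eq_right]
      · push_cast
        field_simp
      · rw [← add_div, sub_nonneg, one_le_div hd']
        exact hle'
    · have hle' : (T φ.toNat i : ℝ) + T ψ.toNat i ≤ d := by exact_mod_cast hle
      rw [Nat.sub_eq_zero_of_le hle, max_eq_left]
      · simp
      · rw [← add_div, sub_nonpos, div_le_one hd']
        exact hle'
  | imp φ ψ ih₁ ih₂ =>
    have h1 := Nat.left_le_pair φ.toNat ψ.toNat
    have h2 := Nat.right_le_pair φ.toNat ψ.toNat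
    have hlt := hψ
    simp only [MFm.toNat] at hlt
    have h : T (MFm.imp φ ψ).toNat i = _ := hcl' _ hψ i
    simp only [Model.val]
    rw [ih₁ (by omega) i, ih₂ (by omega) i]
    apply Subtype.ext
    simp only [coe_lukImp, tableValue, h]
    rw [Nat.cast_min, Nat.cast_add, Nat.cast_sub (hT _ _), ← min_div_div_right hd'.le,
      div_self hd'.ne']
    congr 1
    field_simp
  | dia φ ih =>
    have hφ : φ.toNat < (MFm.dia φ).toNat := by simp only [MFm.toNat]; omega
    obtain ⟨h1, h2⟩ := hcl' _ hψ i
    have ih' := ih (by omega)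
    apply le_antisymm
    · refine Model.val_dia_le _ _ ?_
      rintro ⟨j⟩ hj
      rw [ih', tableValue_le_iff hd hT]
      exact h1 j j.2 hj
    · rcases h2 with h2 | ⟨w, hw, hr, he⟩
      · rw [tableValue_eq_zero hT h2]
        exact unitInterval.nonneg'
      · refine le_trans ?_ (Model.val_le_dia (tableModel.{u} d n T r hn hT) φ
          (v := ⟨i⟩) (w := ⟨⟨w, hw⟩⟩) hr)
        rw [ih', tableValue_le_iff hd hT]
        exact he.ge
  | box φ ih =>
    have hφ : φ.toNat < (MFm.box φ).toNat := by simp only [MFm.toNat]; omega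
    obtain ⟨h1, h2⟩ := hcl' _ hψ i
    have ih' := ih (by omega)
    apply le_antisymm
    · rcases h2 with h2 | ⟨w, hw, hr, he⟩
      · rw [(tableValue_eq_one_iff hd hT _ _).2 h2]
        exact unitInterval.le_one'
      · refine (Model.val_box_le (tableModel.{u} d n T r hn hT) φ
          (v := ⟨i⟩) (w := ⟨⟨w, hw⟩⟩) hr).trans ?_
        rw [ih', tableValue_le_iff hd hT]
        exact he.le
    · refine Model.le_val_box _ _ ?_
      rintro ⟨j⟩ hj
      rw [ih', tableValue_le_iff hd hT]
      exact h1 j j.2 hj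

end Table

/-- The values of all formulas at all worlds are treated as independent coordinates of one real
vector. Each semantic clause amounts to comparisons with coefficients `-1`, `0`, `1`, so it survives
the passage to rationals although it is not imposed there. -/
theorem exists_table (K n : ℕ) (v : ℕ → Fin n → unitInterval) :
    ∃ T : ℕ → ℕ → ℕ, (∀ k w, T k w ≤ commonDenom 3 ((K + 1) * n)) ∧
      ∀ k₁ ≤ K, ∀ k₂ ≤ K, ∀ k₃ ≤ K, ∀ w₁ w₂ w₃ : Fin n, ∀ α β γ b : ℤ,
        |α| ≤ 1 → |β| ≤ 1 → |γ| ≤ 1 → |b| ≤ 1 →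
        ((0 : ℝ) ≤ b + α * v k₁ w₁ + β * v k₂ w₂ + γ * v k₃ w₃ ↔
          0 ≤ b * (commonDenom 3 ((K + 1) * n) : ℤ) + α * T k₁ w₁ + β * T k₂ w₂ + γ * T k₃ w₃) := by
  let N := (K + 1) * n
  let e : Fin (K + 1) × Fin n ≃ Fin N := finProdFinEquiv
  obtain ⟨g, hg, hs⟩ := exists_rational_sameSigns N 3 (by norm_num)
    (fun i => (v (e.symm i).1 (e.symm i).2 : ℝ)) fun i => (v (e.symm i).1 (e.symm i).2).2
  choose z hz using hg
  have hD : (0 : ℝ) < commonDenom 3 N := by exact_mod_cast commonDenom_pos 3 N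
  have key : ∀ i j k : Fin N, ∀ α β γ b : ℤ, |α| ≤ 1 → |β| ≤ 1 → |γ| ≤ 1 → |b| ≤ 1 →
      ((0 : ℝ) ≤ b + α * v (e.symm i).1 (e.symm i).2 + β * v (e.symm j).1 (e.symm j).2 +
        γ * v (e.symm k).1 (e.symm k).2 ↔
      0 ≤ b * (commonDenom 3 N : ℤ) + α * z i + β * z j + γ * z k) := by
    intro i j k α β γ b hα hβ hγ hb
    rw [← sign_nonneg_iff, hs.compare le_rfl i j k hα hβ hγ hb, sign_nonneg_iff,
      ← mul_nonneg_iff_of_pos_left hD, ← Int.cast_nonneg_iff (R := ℝ)]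
    push_cast
    rw [← hz, ← hz, ← hz]
    ring_nf
  have hz0 : ∀ i, 0 ≤ z i := by
    intro i
    have := (key i i i 1 0 0 0 (by simp) (by simp) (by simp) (by simp)).1
      (by simpa using (v (e.symm i).1 (e.symm i).2).2.1)
    simpa using this
  have hz1 : ∀ i, z i ≤ commonDenom 3 N := by
    intro i
    have := (key i i i (-1) 0 0 1 (by simp) (by simp) (by simp) (by simp)).1
      (by simpa using (v (e.symm i).1 (e.symm i).2).2.2)
    simpa using this
  refine ⟨fun k w => if h : k < K + 1 ∧ w < n then (z (e (⟨k, h.1⟩, ⟨w, h.2⟩))).toNat else 0,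
    fun k w => ?_, ?_⟩
  · dsimp only
    split_ifs with h
    · exact Int.toNat_le.2 (hz1 _)
    · exact Nat.zero_le _
  · intro k₁ h₁ k₂ h₂ k₃ h₃ w₁ w₂ w₃ α β γ b hα hβ hγ hb
    have := key (e (⟨k₁, by omega⟩, w₁)) (e (⟨k₂, by omega⟩, w₂)) (e (⟨k₃, by omega⟩, w₃))
      α β γ b hα hβ hγ hb
    simp only [Equiv.symm_apply_apply] at this
    rw [this]
    simp only [Fin.is_lt, and_true, dif_pos (show k₁ < K + 1 by omega),
      dif_pos (show k₂ < K + 1 by omega), dif_pos (show k₃ < K + 1 by omega), Fin.eta,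
      Int.toNat_of_nonneg (hz0 _)]
    rfl

theorem Model.witnessed_of_finite (M : Model.{u}) [Finite M.W] : M.Witnessed := by
  intro v φ h
  obtain ⟨w, hw, hmax⟩ := Set.exists_max_image {w | M.R v w} (M.val φ) (Set.toFinite _) h
  exact ⟨w, hw, le_antisymm (val_le_dia M φ hw) (val_dia_le M φ hmax)⟩

theorem exists_clauseAt (K n : ℕ) (hn : Nonempty (Fin n)) (R : Fin n → Fin n → Prop)
    (e : ℕ → Fin n → unitInterval) :
    ∃ (T : ℕ → ℕ → ℕ) (r : ℕ → ℕ → Prop), (∀ k w, T k w ≤ commonDenom 3 ((K + 1) * n)) ∧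
      (∀ k < K + 1, ∀ w < n,
        ClauseAt (commonDenom 3 ((K + 1) * n)) n T r w (MFm.ofNat k)) ∧
      ∀ ψ : MFm, ψ.toNat ≤ K → ∀ w : Fin n, T ψ.toNat w = commonDenom 3 ((K + 1) * n) ↔
        Model.val ⟨Fin n, hn, R, e⟩ ψ w = 1 := by
  let v : MFm → Fin n → unitInterval := Model.val ⟨Fin n, hn, R, e⟩
  obtain ⟨T, hT, key⟩ := exists_table K n fun k w => v (MFm.ofNat k) w
  set d := commonDenom 3 ((K + 1) * n)
  have cmp : ∀ φ ψ χ : MFm, φ.toNat ≤ K → ψ.toNat ≤ K → χ.toNat ≤ K → ∀ w₁ w₂ w₃ : Fin n,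
      ∀ α β γ b : ℤ, |α| ≤ 1 → |β| ≤ 1 → |γ| ≤ 1 → |b| ≤ 1 →
      ((0 : ℝ) ≤ b + α * v φ w₁ + β * v ψ w₂ + γ * v χ w₃ ↔
        0 ≤ b * (d : ℤ) + α * T φ.toNat w₁ + β * T ψ.toNat w₂ + γ * T χ.toNat w₃) := by
    intro φ ψ χ hφ hψ hχ w₁ w₂ w₃ α β γ b hα hβ hγ hb
    have := key _ hφ _ hψ _ hχ w₁ w₂ w₃ α β γ b hα hβ hγ hb
    simpa only [MFm.ofNat_toNat] using this
  have le_iff : ∀ φ ψ : MFm, φ.toNat ≤ K → ψ.toNat ≤ K → ∀ w₁ w₂ : Fin n,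
      v φ w₁ ≤ v ψ w₂ ↔ T φ.toNat w₁ ≤ T ψ.toNat w₂ := by
    intro φ ψ hφ hψ w₁ w₂
    have := cmp φ ψ ψ hφ hψ hψ w₁ w₂ w₂ (-1) 1 0 0 (by simp) (by simp) (by simp) (by simp)
    rw [← Subtype.coe_le_coe]
    constructor
    · intro h
      have := this.1 (by push_cast; linarith)
      omega
    · intro h
      have := this.2 (by omega)
      push_cast at this
      linarith
  have eq_of : ∀ φ ψ : MFm, φ.toNat ≤ K → ψ.toNat ≤ K → ∀ w₁ w₂ : Fin n,
      v φ w₁ = v ψ w₂ → T φ.toNat w₁ = T ψ.toNat w₂ := fun φ ψ hφ hψ w₁ w₂ h =>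
    le_antisymm ((le_iff φ ψ hφ hψ w₁ w₂).1 h.le) ((le_iff ψ φ hψ hφ w₂ w₁).1 h.ge)
  have one_iff : ∀ φ : MFm, φ.toNat ≤ K → ∀ w : Fin n, T φ.toNat w = d ↔ v φ w = 1 := by
    intro φ hφ w
    have := cmp φ φ φ hφ hφ hφ w w w 1 0 0 (-1) (by simp) (by simp) (by simp) (by simp)
    have h1 : v φ w = 1 ↔ (1 : ℝ) ≤ v φ w :=
      ⟨fun h => by rw [h]; exact le_rfl, fun h => le_antisymm unitInterval.le_one' h⟩
    rw [h1]
    push_cast at this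
    have hle := hT φ.toNat w
    constructor
    · intro h
      have := this.2 (by omega)
      linarith
    · intro h
      have := this.1 (by linarith)
      omega
  have zero_of : ∀ φ : MFm, φ.toNat ≤ K → ∀ w : Fin n, v φ w = 0 → T φ.toNat w = 0 := by
    intro φ hφ w h
    have := (cmp φ φ φ hφ hφ hφ w w w (-1) 0 0 0 (by simp) (by simp) (by simp) (by simp)).1
      (by simp [h])
    omega
  let r : ℕ → ℕ → Prop := fun i j => ∃ i' j' : Fin n, (i' : ℕ) = i ∧ (j' : ℕ) = j ∧ R i' j'
  have hr : ∀ i j : Fin n, r i j ↔ R i j := by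
    intro i j
    constructor
    · rintro ⟨i', j', hi, hj, h⟩
      rwa [Fin.ext hi, Fin.ext hj] at h
    · intro h
      exact ⟨i, j, rfl, rfl, h⟩
  have clause : ∀ ψ : MFm, ψ.toNat ≤ K → ∀ w : Fin n, ClauseAt d n T r w ψ := by
    intro ψ hψ w
    cases ψ with
    | var n => trivial
    | bot => exact zero_of .bot hψ w rfl
    | top => exact (one_iff .top hψ w).2 rfl
    | and φ ψ =>
      have h1 := Nat.left_le_pair φ.toNat ψ.toNat
      have h2 := Nat.right_le_pair φ.toNat ψ.toNat
      have hlt := hψ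
      simp only [MFm.toNat] at hlt
      rcases le_total (v φ w) (v ψ w) with hle | hle
      · exact (eq_of _ _ hψ (by omega) w w (inf_eq_left.2 hle)).trans
          (min_eq_left ((le_iff _ _ (by omega) (by omega) w w).1 hle)).symm
      · exact (eq_of _ _ hψ (by omega) w w (inf_eq_right.2 hle)).trans
          (min_eq_right ((le_iff _ _ (by omega) (by omega) w w).1 hle)).symm
    | or φ ψ =>
      have h1 := Nat.left_le_pair φ.toNat ψ.toNat
      have h2 := Nat.right_le_pair φ.toNat ψ.toNat
      have hlt := hψ
      simp only [MFm.toNat] at hlt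
      rcases le_total (v φ w) (v ψ w) with hle | hle
      · exact (eq_of _ _ hψ (by omega) w w (sup_eq_right.2 hle)).trans
          (max_eq_right ((le_iff _ _ (by omega) (by omega) w w).1 hle)).symm
      · exact (eq_of _ _ hψ (by omega) w w (sup_eq_left.2 hle)).trans
          (max_eq_left ((le_iff _ _ (by omega) (by omega) w w).1 hle)).symm
    | mul φ ψ =>
      have h1 := Nat.left_le_pair φ.toNat ψ.toNat
      have h2 := Nat.right_le_pair φ.toNat ψ.toNat
      have hlt := hψ
      simp only [MFm.toNat] at hlt
      have hv : (v (.mul φ ψ) w : ℝ) = max 0 ((v φ w : ℝ) + v ψ w - 1) := rfl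
      have hs := cmp φ ψ ψ (by omega) (by omega) (by omega) w w w 1 1 0 (-1)
        (by simp) (by simp) (by simp) (by simp)
      have h1 := cmp (.mul φ ψ) φ ψ hψ (by omega) (by omega) w w w 1 (-1) (-1) 1
        (by simp) (by simp) (by simp) (by simp)
      have h2 := cmp (.mul φ ψ) φ ψ hψ (by omega) (by omega) w w w (-1) 1 1 (-1)
        (by simp) (by simp) (by simp) (by simp)
      push_cast at hs h1 h2
      change T (MFm.mul φ ψ).toNat w = T φ.toNat w + T ψ.toNat w - d
      rcases le_total (0 : ℝ) ((v φ w : ℝ) + v ψ w - 1) with hle | hle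
      · rw [max_eq_right hle] at hv
        have := hs.1 (by linarith)
        have := h1.1 (by linarith)
        have := h2.1 (by linarith)
        omega
      · rw [max_eq_left hle] at hv
        have := zero_of _ hψ w (Subtype.ext hv)
        have := h1.1 (by linarith)
        omega
    | imp φ ψ =>
      have h1 := Nat.left_le_pair φ.toNat ψ.toNat
      have h2 := Nat.right_le_pair φ.toNat ψ.toNat
      have hlt := hψ
      simp only [MFm.toNat] at hlt
      have hv : (v (.imp φ ψ) w : ℝ) = min 1 (1 - (v φ w : ℝ) + v ψ w) := rfl
      have hs := le_iff φ ψ (by omega) (by omega) w w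
      have h1 := cmp (.imp φ ψ) φ ψ hψ (by omega) (by omega) w w w 1 1 (-1) (-1)
        (by simp) (by simp) (by simp) (by simp)
      have h2 := cmp (.imp φ ψ) φ ψ hψ (by omega) (by omega) w w w (-1) (-1) 1 1
        (by simp) (by simp) (by simp) (by simp)
      have hb := hT φ.toNat w
      push_cast at h1 h2
      change T (MFm.imp φ ψ).toNat w = min d (d - T φ.toNat w + T ψ.toNat w)
      rcases le_total (v φ w) (v ψ w) with hle | hle
      · have := hs.1 hle
        rw [min_eq_left (by omega), one_iff _ hψ]
        exact lukImp_eq_one_iff.2 hle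
      · rw [min_eq_right (by linarith [Subtype.coe_le_coe.2 hle])] at hv
        have := h1.1 (by linarith)
        have := h2.1 (by linarith)
        have := (le_iff ψ φ (by omega) (by omega) w w).1 hle
        omega
    | dia φ =>
      have hφ : φ.toNat < (MFm.dia φ).toNat := by simp only [MFm.toNat]; omega
      constructor
      · intro w' hw' hww
        exact (le_iff φ (.dia φ) (by omega) hψ ⟨w', hw'⟩ w).1
          (Model.val_le_dia ⟨Fin n, hn, R, e⟩ φ ((hr w ⟨w', hw'⟩).1 hww))
      · by_cases h : ∃ w', R w w'
        · have : Finite (Model.mk (Fin n) hn R e).W := inferInstanceAs (Finite (Fin n))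
          obtain ⟨w', hw', he⟩ := Model.witnessed_of_finite ⟨Fin n, hn, R, e⟩ w φ h
          exact .inr ⟨w', w'.2, (hr w w').2 hw', eq_of φ (.dia φ) (by omega) hψ w' w he⟩
        · exact .inl (zero_of _ hψ w (Model.val_dia_of_forall_not _ φ (not_exists.1 h)))
    | box φ =>
      have hφ : φ.toNat < (MFm.box φ).toNat := by simp only [MFm.toNat]; omega
      constructor
      · intro w' hw' hww
        exact (le_iff (.box φ) φ hψ (by omega) w ⟨w', hw'⟩).1
          (Model.val_box_le ⟨Fin n, hn, R, e⟩ φ ((hr w ⟨w', hw'⟩).1 hww))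
      · by_cases h : ∃ w', R w w'
        · have : Finite (Model.mk (Fin n) hn R e).W := inferInstanceAs (Finite (Fin n))
          obtain ⟨w', hw', he⟩ := (Model.witnessed_of_finite
            ⟨Fin n, hn, R, e⟩).exists_isWitness w (.box φ) h
          exact .inr ⟨w', w'.2, (hr w w').2 hw',
            eq_of φ (.box φ) (by omega) hψ w' w (he φ (.inr rfl))⟩
        · exact .inl ((one_iff _ hψ w).2 (Model.val_box_of_forall_not _ φ (not_exists.1 h)))
  refine ⟨T, r, hT, fun k hk w hw => clause (MFm.ofNat k) ?_ ⟨w, hw⟩, one_iff⟩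
  rw [MFm.toNat_ofNat]
  omega

/-- A countermodel is made witnessed, then cut down to a finite tree, then made rational.
Conversely, a table is itself a finite countermodel. -/
theorem not_kConsequence_iff (Γ : List MFm) (φ : MFm) (K : ℕ) (hΓ : ∀ γ ∈ Γ, γ.toNat ≤ K)
    (hφ : φ.toNat ≤ K) : ¬ KConsequence.{u} Γ φ ↔ ∃ (T : ℕ → ℕ → ℕ) (r : ℕ → ℕ → Prop),
      (∀ k w, T k w ≤ commonDenom 3 ((K + 1) * numWorlds K)) ∧
      IsRefutation (commonDenom 3 ((K + 1) * numWorlds K)) (numWorlds K) K T r (Γ, φ) := by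
  constructor
  · intro h
    simp only [KConsequence, LocalConsequence, not_forall] at h
    obtain ⟨M, -, v, hv, hn⟩ := h
    obtain ⟨N, w, hN, -, hval⟩ := M.exists_witnessed v
    have hroot : ∀ ψ : MFm, ψ.toNat ≤ K →
        (N.heapModel K w).val ψ (⟨0, numWorlds_pos K⟩ : Fin _) = M.val ψ v := by
      intro ψ hψ
      exact (hN.heapModel_val w ψ 0 ⟨0, numWorlds_pos K⟩ (by simp) (by omega)).trans
        ((congrArg (N.val ψ) (by rw [Model.heap])).trans (hval ψ))
    obtain ⟨T, r, hT, hcl, hone⟩ := exists_clauseAt K (numWorlds K) (N.heapModel K w).nonempty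
      (N.heapModel K w).R (N.heapModel K w).e
    refine ⟨T, r, hT, hcl, fun γ hγ => ?_, fun h => hn ?_⟩
    · exact (hone γ (hΓ γ hγ) ⟨0, numWorlds_pos K⟩).2 ((hroot γ (hΓ γ hγ)).trans (hv γ hγ))
    · exact (hroot φ hφ).symm.trans ((hone φ hφ ⟨0, numWorlds_pos K⟩).1 h)
  · rintro ⟨T, r, hT, hcl, hp, hq⟩ h
    have hd := commonDenom_pos 3 ((K + 1) * numWorlds K)
    have hval := tableModel_val.{u} hd (numWorlds_pos K) hT hcl
    refine hq ((tableValue_eq_one_iff hd hT _ _).1 ((hval φ hφ ⟨0, numWorlds_pos K⟩).symm.trans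
      (h _ trivial _ fun γ hγ => ?_)))
    exact (hval γ (hΓ γ hγ) ⟨0, numWorlds_pos K⟩).trans
      ((tableValue_eq_one_iff hd hT _ _).2 (hp γ hγ))

end LukModal

namespace LukModal

/-! ### Deciding local consequence in the minimal logic -/

/-- The digit number `i` of `c` in base `b`. -/
def digit (b c i : ℕ) : ℕ := c / b ^ i % b

theorem exists_digits (b : ℕ) (hb : 0 < b) (a : ℕ → ℕ) (ha : ∀ i, a i < b) (m : ℕ) :
    ∃ c < b ^ m, ∀ i < m, digit b c i = a i := by
  induction m with
  | zero => exact ⟨0, by simp, by simp⟩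
  | succ m ih =>
    obtain ⟨c, hc, h⟩ := ih
    refine ⟨c + a m * b ^ m, ?_, fun i hi => ?_⟩
    · have : (a m + 1) * b ^ m ≤ b * b ^ m := Nat.mul_le_mul_right _ (ha m)
      rw [pow_succ]
      linarith
    · rcases Nat.lt_succ_iff_lt_or_eq.1 hi with hi | rfl
      · rw [← h i hi, digit, digit]
        obtain ⟨j, rfl⟩ := Nat.exists_eq_add_of_lt hi
        have : c + a (i + j + 1) * b ^ (i + j + 1) =
            c + b ^ i * (b * (a (i + j + 1) * b ^ j)) := by ring
        rw [this, Nat.add_mul_div_left _ _ (Nat.pow_pos hb), Nat.add_mul_mod_self_left]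
      · rw [digit, Nat.add_mul_div_right _ _ (Nat.pow_pos hb), Nat.div_eq_of_lt hc, zero_add,
          Nat.mod_eq_of_lt (ha i)]

/-- The table of values coded by a number. -/
def codedTable (d c k w : ℕ) : ℕ := digit (d + 1) c (Nat.pair k w)

/-- The relation coded by a number. -/
def codedRel (c i j : ℕ) : Prop := digit 2 c (Nat.pair i j) = 1

/-- A bound for the positions of the digits that matter. -/
def numDigits (K : ℕ) : ℕ := (K + 1 + numWorlds K) ^ 2

theorem pair_lt_numDigits {K k w : ℕ} (hk : k < K + 1 + numWorlds K)
    (hw : w < K + 1 + numWorlds K) : Nat.pair k w < numDigits K :=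
  (Nat.pair_lt_max_add_one_sq k w).trans_le (Nat.pow_le_pow_left (max_lt hk hw) 2)

/-- Clauses only inspect finitely many entries, so tables and relations can be replaced by those
coded in the digits of a number. -/
theorem ClauseAt.congr {d n : ℕ} {T T' : ℕ → ℕ → ℕ} {r r' : ℕ → ℕ → Prop} {w : ℕ} (hw : w < n)
    {ψ : MFm} (hT : ∀ k ≤ ψ.toNat, ∀ w < n, T k w = T' k w)
    (hr : ∀ i < n, ∀ j < n, r i j ↔ r' i j) (h : ClauseAt d n T r w ψ) :
    ClauseAt d n T' r' w ψ := by
  cases ψ with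
  | var m => trivial
  | bot => exact (hT 0 (Nat.zero_le _) w hw).symm.trans h
  | top => exact (hT 1 le_rfl w hw).symm.trans h
  | and φ ψ | or φ ψ | mul φ ψ | imp φ ψ =>
    have h1 := Nat.left_le_pair φ.toNat ψ.toNat
    have h2 := Nat.right_le_pair φ.toNat ψ.toNat
    have h3 := hT _ le_rfl w hw
    have h4 := hT φ.toNat (by simp only [MFm.toNat]; omega) w hw
    have h5 := hT ψ.toNat (by simp only [MFm.toNat]; omega) w hw
    simp only [ClauseAt] at h ⊢
    rw [← h3, ← h4, ← h5, h]
  | box φ | dia φ =>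
    have h3 := hT _ le_rfl w hw
    have h4 := hT φ.toNat (by simp only [MFm.toNat]; omega)
    refine ⟨fun w' hw' hww => ?_, ?_⟩
    · rw [← h3, ← h4 w' hw']
      exact h.1 w' hw' ((hr w hw w' hw').2 hww)
    · rcases h.2 with h' | ⟨w', hw', hww, he⟩
      · exact .inl (h3.symm.trans h')
      · refine .inr ⟨w', hw', (hr w hw w' hw').1 hww, ?_⟩
        rw [← h3, ← h4 w' hw', he]

/-- The common denominator of the values in a refutation of formulas with codes up to `K`. -/
def tableDenom (K : ℕ) : ℕ := commonDenom 3 ((K + 1) * numWorlds K)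

theorem toNat_le_encode_left {p : List MFm × MFm} {γ : MFm} (hγ : γ ∈ p.1) :
    γ.toNat ≤ Encodable.encode p := by
  have aux : ∀ L : List MFm, γ ∈ L → γ.toNat ≤ Encodable.encode L := by
    intro L
    induction L with
    | nil => simp
    | cons χ L ih =>
      intro h
      rw [Encodable.encode_list_cons]
      rcases List.mem_cons.1 h with rfl | h
      · exact (Nat.left_le_pair _ _).trans (Nat.le_succ _)
      · exact (ih h).trans ((Nat.right_le_pair _ _).trans (Nat.le_succ _))
  exact (aux _ hγ).trans (Nat.left_le_pair _ _)

theorem toNat_le_encode_right (p : List MFm × MFm) : p.2.toNat ≤ Encodable.encode p :=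
  Nat.right_le_pair _ _

theorem not_kConsequence_iff_coded (p : List MFm × MFm) : ¬ KConsequence.{u} p.1 p.2 ↔
    ∃ c < (tableDenom (Encodable.encode p) + 1) ^ numDigits (Encodable.encode p),
    ∃ c' < 2 ^ numDigits (Encodable.encode p),
      IsRefutation (tableDenom (Encodable.encode p)) (numWorlds (Encodable.encode p))
        (Encodable.encode p) (codedTable (tableDenom (Encodable.encode p)) c) (codedRel c') p := by
  -- The code of the whole problem bounds the Gödel numbers of all its formulas, because pairing
  -- dominates its components.
  set K := Encodable.encode p with hK
  rw [not_kConsequence_iff p.1 p.2 K (fun γ hγ => toNat_le_encode_left hγ)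
    (toNat_le_encode_right p)]
  constructor
  · rintro ⟨T, r, hT, hcl, hp, hq⟩
    classical
    obtain ⟨c, hc, hcT⟩ := exists_digits (tableDenom K + 1) (Nat.succ_pos _)
      (fun i => T i.unpair.1 i.unpair.2) (fun i => Nat.lt_succ_of_le (hT _ _)) (numDigits K)
    obtain ⟨c', hc', hcr⟩ := exists_digits 2 two_pos
      (fun i => if r i.unpair.1 i.unpair.2 then 1 else 0) (fun i => by split_ifs <;> norm_num)
      (numDigits K)
    have hTc : ∀ k ≤ K, ∀ w < numWorlds K, T k w = codedTable (tableDenom K) c k w := by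
      intro k hk w hw
      rw [codedTable, hcT _ (pair_lt_numDigits (by omega) (by omega)), Nat.unpair_pair]
    have hrc : ∀ i < numWorlds K, ∀ j < numWorlds K, r i j ↔ codedRel c' i j := by
      intro i hi j hj
      rw [codedRel, hcr _ (pair_lt_numDigits (by omega) (by omega)), Nat.unpair_pair]
      simp
    refine ⟨c, hc, c', hc', fun k hk w hw => ?_, fun γ hγ => ?_, ?_⟩
    · exact (hcl k hk w hw).congr hw (fun k' hk' => hTc k' (by rw [MFm.toNat_ofNat] at hk'; omega))
        hrc
    · rw [← hTc _ (toNat_le_encode_left hγ) _ (numWorlds_pos K)]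
      exact hp γ hγ
    · rw [← hTc _ (toNat_le_encode_right p) _ (numWorlds_pos K)]
      exact hq
  · rintro ⟨c, -, c', -, h⟩
    exact ⟨_, _, fun k w => Nat.lt_succ_iff.1 (Nat.mod_lt _ (Nat.succ_pos _)), h⟩

/-! ### Primitive recursiveness of the bounded search -/

section Primrec

open Primrec

variable {α : Type*} [Primcodable α]

theorem PrimrecPred.imp {p q : α → Prop} (hp : PrimrecPred p) (hq : PrimrecPred q) :
    PrimrecPred fun a => p a → q a :=
  (hp.not.or hq).of_eq fun _ => imp_iff_not_or.symm

theorem PrimrecPred.ball_lt {f : α → ℕ} {R : α → ℕ → Prop} (hf : Primrec f)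
    (hR : PrimrecPred fun p : α × ℕ => R p.1 p.2) : PrimrecPred fun a => ∀ x < f a, R a x := by
  have h : PrimrecRel fun (x : ℕ) (a : α) => R a x := hR.comp (Primrec.pair snd fst)
  exact (PrimrecPred.comp h.forall_mem_list
    (Primrec.pair (list_range.comp hf) Primrec.id)).of_eq fun a => by simp

theorem PrimrecPred.bex_lt {f : α → ℕ} {R : α → ℕ → Prop} (hf : Primrec f)
    (hR : PrimrecPred fun p : α × ℕ => R p.1 p.2) : PrimrecPred fun a => ∃ x < f a, R a x := by
  have h : PrimrecRel fun (x : ℕ) (a : α) => R a x := hR.comp (Primrec.pair snd fst)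
  exact (PrimrecPred.comp h.exists_mem_list
    (Primrec.pair (list_range.comp hf) Primrec.id)).of_eq fun a => by simp

theorem primrec_pow {f g : α → ℕ} (hf : Primrec f) (hg : Primrec g) :
    Primrec fun a => f a ^ g a := by
  refine (nat_rec' hg (const 1) (h := fun a p => p.2 * f a) ?_).of_eq fun a => ?_
  · exact nat_mul.comp (snd.comp snd) (hf.comp fst)
  · induction g a with
    | zero => rfl
    | succ n ih => rw [pow_succ, ← ih]

theorem primrec_factorial : Primrec Nat.factorial := by
  refine (nat_rec₁ 1 (f := fun n r => (n + 1) * r) ?_).of_eq fun n => ?_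
  · exact nat_mul.comp (succ.comp fst) snd
  · induction n with
    | zero => rfl
    | succ n ih => rw [Nat.factorial_succ, ← ih]

theorem primrec_coeffBound (B : ℕ) : Primrec (coeffBound B) := by
  refine (nat_rec₁ B (f := fun _ r => 2 * r ^ 2) ?_).of_eq fun n => ?_
  · exact nat_mul.comp (const 2) (primrec_pow snd (const 2))
  · induction n with
    | zero => rfl
    | succ n ih => rw [coeffBound, ← ih]

theorem primrec_commonDenom (B : ℕ) : Primrec (commonDenom B) := by
  refine (nat_rec₁ 1 (f := fun n r => r * (2 * (coeffBound B n).factorial)) ?_).of_eq fun n => ?_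
  · exact nat_mul.comp snd (nat_mul.comp (const 2)
      (primrec_factorial.comp ((primrec_coeffBound B).comp fst)))
  · induction n with
    | zero => rfl
    | succ n ih => rw [commonDenom, Finset.prod_range_succ, ← commonDenom, ← ih]

theorem primrec_numWorlds : Primrec numWorlds :=
  primrec_pow (nat_add.comp Primrec.id (const 2)) Primrec.id

theorem primrec_numDigits : Primrec numDigits :=
  primrec_pow (nat_add.comp (nat_add.comp Primrec.id (const 1)) primrec_numWorlds) (const 2)

theorem primrec_tableDenom : Primrec tableDenom :=
  (primrec_commonDenom 3).comp (nat_mul.comp (nat_add.comp Primrec.id (const 1)) primrec_numWorlds)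

theorem primrec_digit {b c i : α → ℕ} (hb : Primrec b) (hc : Primrec c) (hi : Primrec i) :
    Primrec fun a => digit (b a) (c a) (i a) :=
  nat_mod.comp (nat_div.comp hc (primrec_pow hb hi)) hb

theorem primrec_codedTable {d c k w : α → ℕ} (hd : Primrec d) (hc : Primrec c) (hk : Primrec k)
    (hw : Primrec w) : Primrec fun a => codedTable (d a) (c a) (k a) (w a) :=
  primrec_digit (succ.comp hd) hc (Primrec₂.natPair.comp hk hw)

theorem primrecPred_codedRel {c i j : α → ℕ} (hc : Primrec c) (hi : Primrec i)
    (hj : Primrec j) : PrimrecPred fun a => codedRel (c a) (i a) (j a) :=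
  Primrec.eq.comp (primrec_digit (const 2) hc (Primrec₂.natPair.comp hi hj)) (const 1)

/-- The clause for the formula with code `k`, spelled out on codes. -/
def CodeClauseAt (d n : ℕ) (T : ℕ → ℕ → ℕ) (r : ℕ → ℕ → Prop) (w k : ℕ) : Prop :=
  (k = 0 → T k w = 0) ∧ (k = 1 → T k w = d) ∧ (1 < k →
    ((k - 2) % 7 = 1 → T k w =
      min (T ((k - 2) / 7).unpair.1 w) (T ((k - 2) / 7).unpair.2 w)) ∧
    ((k - 2) % 7 = 2 → T k w =
      max (T ((k - 2) / 7).unpair.1 w) (T ((k - 2) / 7).unpair.2 w)) ∧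
    ((k - 2) % 7 = 3 → T k w =
      T ((k - 2) / 7).unpair.1 w + T ((k - 2) / 7).unpair.2 w - d) ∧
    ((k - 2) % 7 = 4 → T k w =
      min d (d - T ((k - 2) / 7).unpair.1 w + T ((k - 2) / 7).unpair.2 w)) ∧
    ((k - 2) % 7 = 5 → (∀ w' < n, r w w' → T k w ≤ T ((k - 2) / 7) w') ∧
      (T k w = d ∨ ∃ w' < n, r w w' ∧ T ((k - 2) / 7) w' = T k w)) ∧
    ((k - 2) % 7 = 6 → (∀ w' < n, r w w' → T ((k - 2) / 7) w' ≤ T k w) ∧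
      (T k w = 0 ∨ ∃ w' < n, r w w' ∧ T ((k - 2) / 7) w' = T k w)))

theorem clauseAt_ofNat_iff (d n : ℕ) (T : ℕ → ℕ → ℕ) (r : ℕ → ℕ → Prop) (w k : ℕ) :
    ClauseAt d n T r w (MFm.ofNat k) ↔ CodeClauseAt d n T r w k := by
  obtain ⟨ψ, rfl⟩ : ∃ ψ : MFm, k = ψ.toNat := ⟨MFm.ofNat k, (MFm.toNat_ofNat k).symm⟩
  rw [MFm.ofNat_toNat]
  cases ψ <;> simp [ClauseAt, CodeClauseAt, MFm.toNat, Nat.mul_add_div]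

theorem primrecPred_codeClauseAt {d n c c' w k : α → ℕ} (hd : Primrec d) (hn : Primrec n)
    (hc : Primrec c) (hc' : Primrec c') (hw : Primrec w) (hk : Primrec k) :
    PrimrecPred fun a => CodeClauseAt (d a) (n a) (codedTable (d a) (c a)) (codedRel (c' a))
      (w a) (k a) := by
  have hk2 := nat_sub.comp hk (const 2)
  have hq := nat_div.comp hk2 (const 7)
  have hm := nat_mod.comp hk2 (const 7)
  have hl := fst.comp (unpair.comp hq)
  have hr := snd.comp (unpair.comp hq)
  have hT := primrec_codedTable hd hc hk hw
  have hTl := primrec_codedTable hd hc hl hw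
  have hTr := primrec_codedTable hd hc hr hw
  have hT' := primrec_codedTable (hd.comp fst) (hc.comp fst) (hq.comp fst) (snd (α := α) (β := ℕ))
  have hR := primrecPred_codedRel (hc'.comp fst) (hw.comp fst) (snd (α := α) (β := ℕ))
  have case : ∀ (m : ℕ) {p : α → Prop}, PrimrecPred p →
      PrimrecPred fun a => (k a - 2) % 7 = m → p a :=
    fun m p hp => PrimrecPred.imp (Primrec.eq.comp hm (const m)) hp
  have hwit := PrimrecPred.bex_lt (R := fun a w' => codedRel (c' a) (w a) w' ∧
    codedTable (d a) (c a) ((k a - 2) / 7) w' = codedTable (d a) (c a) (k a) (w a)) hn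
      (hR.and (Primrec.eq.comp hT' (hT.comp fst)))
  refine (PrimrecPred.imp (Primrec.eq.comp hk (const 0)) (Primrec.eq.comp hT (const 0))).and
    ((PrimrecPred.imp (Primrec.eq.comp hk (const 1)) (Primrec.eq.comp hT hd)).and
    (PrimrecPred.imp (nat_lt.comp (const 1) hk) (PrimrecPred.and (case 1 ?_)
      (PrimrecPred.and (case 2 ?_) (PrimrecPred.and (case 3 ?_) (PrimrecPred.and (case 4 ?_)
      (PrimrecPred.and (case 5 ?_) (case 6 ?_))))))))
  · exact Primrec.eq.comp hT (nat_min.comp hTl hTr)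
  · exact Primrec.eq.comp hT (nat_max.comp hTl hTr)
  · exact Primrec.eq.comp hT (nat_sub.comp (nat_add.comp hTl hTr) hd)
  · exact Primrec.eq.comp hT (nat_min.comp hd (nat_add.comp (nat_sub.comp hd hTl) hTr))
  · exact (PrimrecPred.ball_lt hn (PrimrecPred.imp hR (nat_le.comp (hT.comp fst) hT'))).and
      ((Primrec.eq.comp hT hd).or hwit)
  · exact (PrimrecPred.ball_lt hn (PrimrecPred.imp hR (nat_le.comp hT' (hT.comp fst)))).and
      ((Primrec.eq.comp hT (const 0)).or hwit)

theorem primrec_toNat : Primrec MFm.toNat := Primrec.encode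

theorem primrecPred_forall_mem {f : α → List MFm} {R : α → MFm → Prop} (hf : Primrec f)
    (hR : PrimrecPred fun p : α × MFm => R p.1 p.2) : PrimrecPred fun a => ∀ x ∈ f a, R a x := by
  have h : PrimrecRel fun (x : MFm) (a : α) => R a x := hR.comp (Primrec.pair snd fst)
  exact PrimrecPred.comp h.forall_mem_list (Primrec.pair hf Primrec.id)

theorem computablePred_kConsequence : ComputablePred fun p : List MFm × MFm =>
    KConsequence.{u} p.1 p.2 := by
  have hK : Primrec fun p : List MFm × MFm => Encodable.encode p := Primrec.encode
  have hK' := (hK.comp fst).comp (fst (α := (List MFm × MFm) × ℕ) (β := ℕ))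
  have hd := primrec_tableDenom.comp hK'
  have hn := primrec_numWorlds.comp hK'
  have hc := (snd (α := List MFm × MFm) (β := ℕ)).comp
    (fst (α := (List MFm × MFm) × ℕ) (β := ℕ))
  have hc' := snd (α := (List MFm × MFm) × ℕ) (β := ℕ)
  have hp := fst.comp (fst (α := (List MFm × MFm) × ℕ) (β := ℕ))
  refine (PrimrecPred.not (PrimrecPred.bex_lt
    (primrec_pow (succ.comp (primrec_tableDenom.comp hK)) (primrec_numDigits.comp hK))
    (R := fun p c => ∃ c' < 2 ^ numDigits (Encodable.encode p),
      IsRefutation (tableDenom (Encodable.encode p)) (numWorlds (Encodable.encode p))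
        (Encodable.encode p) (codedTable (tableDenom (Encodable.encode p)) c) (codedRel c') p)
    (PrimrecPred.bex_lt (primrec_pow (const 2) (primrec_numDigits.comp (hK.comp fst)))
    (R := fun (q : (List MFm × MFm) × ℕ) c' =>
      IsRefutation (tableDenom (Encodable.encode q.1)) (numWorlds (Encodable.encode q.1))
        (Encodable.encode q.1) (codedTable (tableDenom (Encodable.encode q.1)) q.2)
        (codedRel c') q.1)
    (PrimrecPred.and ?_ (PrimrecPred.and ?_ (PrimrecPred.not ?_)))))).of_eq (fun p => ?_)
      |>.computablePred
  · exact PrimrecPred.ball_lt (succ.comp hK') (PrimrecPred.ball_lt (hn.comp fst)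
      ((primrecPred_codeClauseAt (hd.comp (fst.comp fst)) (hn.comp (fst.comp fst))
        (hc.comp (fst.comp fst)) (hc'.comp (fst.comp fst)) snd (snd.comp fst)).of_eq
        fun q => (clauseAt_ofNat_iff _ _ _ _ _ _).symm))
  · exact primrecPred_forall_mem (fst.comp hp) (Primrec.eq.comp
      (primrec_codedTable (hd.comp fst) (hc.comp fst) (primrec_toNat.comp snd) (const 0))
      (hd.comp fst))
  · exact Primrec.eq.comp (primrec_codedTable hd hc (primrec_toNat.comp (snd.comp hp)) (const 0)) hd
  · rw [← not_kConsequence_iff_coded, not_not]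

end Primrec

end LukModal

namespace LukModal

/-! ### Counter programs -/

/-- Programs for counter machines; `loop r body next` repeats `body` after decrementing `r`, as long
as `r` is not zero, and then continues with `next`. -/
inductive Prog : Type
  | halt : Prog
  | inc (r : ℕ) (next : Prog) : Prog
  | loop (r : ℕ) (body next : Prog) : Prog
  deriving DecidableEq

/-- The contents of the counters. -/
abbrev Store : Type := ℕ → ℕ

namespace Prog

open Function

/-- Sequential composition. -/
def append : Prog → Prog → Prog
  | halt, q => q
  | inc r p, q => inc r (append p q)
  | loop r b p, q => loop r b (append p q)

/-- One step of the computation. -/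
def step : Prog × Store → Option (Prog × Store)
  | (halt, _) => none
  | (inc r p, s) => some (p, update s r (s r + 1))
  | (loop r b p, s) =>
    if s r = 0 then some (p, s) else some (b.append (loop r b p), update s r (s r - 1))

/-- Finitely many steps of the computation. -/
def Steps : Prog × Store → Prog × Store → Prop :=
  Relation.ReflTransGen fun c c' => step c = some c'

/-- The program terminates with the given final store. -/
def Runs (p : Prog) (s s' : Store) : Prop := Steps (p, s) (halt, s')

theorem append_assoc (p q q' : Prog) : (p.append q).append q' = p.append (q.append q') := by
  induction p with
  | halt => rfl
  | inc r p ih => simp only [append, ih]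
  | loop r b p _ ih => simp only [append, ih]

theorem step_append {p p' : Prog} {s s' : Store} (h : step (p, s) = some (p', s')) (q : Prog) :
    step (p.append q, s) = some (p'.append q, s') := by
  cases p with
  | halt => simp [step] at h
  | inc r p =>
    simp only [step, Option.some.injEq, Prod.mk.injEq] at h
    obtain ⟨rfl, rfl⟩ := h
    rfl
  | loop r b p =>
    simp only [step, append] at h ⊢
    split_ifs at h ⊢ with h0
    · simp only [Option.some.injEq, Prod.mk.injEq] at h ⊢
      obtain ⟨rfl, rfl⟩ := h
      exact ⟨rfl, rfl⟩
    · simp only [Option.some.injEq, Prod.mk.injEq] at h ⊢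
      obtain ⟨rfl, rfl⟩ := h
      exact ⟨by rw [append_assoc]; rfl, rfl⟩

theorem Steps.append {c c' : Prog × Store} (h : Steps c c') (q : Prog) :
    Steps (c.1.append q, c.2) (c'.1.append q, c'.2) := by
  induction h with
  | refl => exact .refl
  | tail _ h ih => exact ih.tail (step_append h q)

theorem Runs.steps_append {p : Prog} {s s' : Store} (h : Runs p s s') (q : Prog) :
    Steps (p.append q, s) (q, s') :=
  Steps.append h q

theorem Runs.append {p q : Prog} {s s' s'' : Store} (h : Runs p s s') (h' : Runs q s' s'') :
    Runs (p.append q) s s'' :=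
  (h.steps_append q).trans h'

theorem runs_halt (s : Store) : Runs halt s s := .refl

theorem runs_inc (r : ℕ) (s : Store) : Runs (inc r halt) s (update s r (s r + 1)) :=
  .single rfl

/-- Here `σ k` is the store before iteration `k`. The body may change the loop counter as well,
which makes unbounded search possible. -/
theorem runs_loop {r : ℕ} {b : Prog} (σ : ℕ → Store) (N : ℕ)
    (hb : ∀ k < N, σ k r ≠ 0 ∧ Runs b (update (σ k) r (σ k r - 1)) (σ (k + 1)))
    (hN : σ N r = 0) : Runs (loop r b halt) (σ 0) (σ N) := by
  have h : ∀ k ≤ N, Steps (loop r b halt, σ 0) (loop r b halt, σ k) := by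
    intro k hk
    induction k with
    | zero => exact .refl
    | succ k ih =>
      obtain ⟨h0, h1⟩ := hb k hk
      exact (ih (by omega)).trans (.head (by rw [step, if_neg h0]) (h1.steps_append _))
  exact (h N le_rfl).tail (by rw [step, if_pos hN])

/-- Set a counter to zero. -/
def clear (r : ℕ) : Prog := loop r halt halt

/-- Add one counter to another, setting the first to zero. -/
def move (a b : ℕ) : Prog := loop a (inc b halt) halt

/-- Add one counter to another, using an auxiliary counter. -/
def copy (a b t : ℕ) : Prog := (loop a (inc b (inc t halt)) halt).append (move t a)

theorem Runs.congr {p : Prog} {s s' t t' : Store} (h : Runs p s s') (hs : s = t) (hs' : s' = t') :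
    Runs p t t' := hs ▸ hs' ▸ h

theorem runs_clear (r : ℕ) (s : Store) : Runs (clear r) s (update s r 0) := by
  refine (runs_loop (fun k => update s r (s r - k)) (s r) (fun k hk => ⟨?_, ?_⟩) ?_).congr ?_ ?_
  · simp only [update_self]
    omega
  · simp only [update_self, update_idem]
    exact (runs_halt _).congr rfl (by rw [Nat.sub_sub])
  · simp
  · simp
  · simp

theorem runs_move {a b : ℕ} (hab : a ≠ b) (s : Store) :
    Runs (move a b) s (update (update s a 0) b (s b + s a)) := by
  refine (runs_loop (fun k => update (update s a (s a - k)) b (s b + k)) (s a)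
    (fun k hk => ⟨?_, (runs_inc b _).congr rfl ?_⟩) ?_).congr ?_ ?_
  · simp only [update_of_ne hab, update_self]
    omega
  · funext j
    grind
  · simp [hab]
  · simp
  · simp

theorem runs_copy {a b t : ℕ} (hab : a ≠ b) (hat : a ≠ t) (hbt : b ≠ t) (s : Store)
    (ht : s t = 0) : Runs (copy a b t) s (update s b (s b + s a)) := by
  refine Runs.append (s' := update (update (update s a 0) b (s b + s a)) t (s a)) ?_
    ((runs_move hat.symm _).congr rfl ?_)
  · refine (runs_loop (fun k => update (update (update s a (s a - k)) b (s b + k)) t k) (s a)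
      (fun k hk => ⟨?_, ((runs_inc b _).append (runs_inc t _)).congr rfl ?_⟩) ?_).congr ?_ ?_
    · grind
    · funext j
      grind
    · grind
    · funext j
      grind
    · funext j
      grind
  · funext j
    grind

/-- The program `p` computes `f` from the counters `ins` into `out`, using only counters from `base`
on as auxiliary counters. -/
def ComputesWith {n : ℕ} (f : List.Vector ℕ n → ℕ) (ins : Fin n → ℕ) (out base : ℕ) (p : Prog) :
    Prop :=
  ∀ s : Store, (∀ j, base ≤ j → s j = 0) → s out = 0 →
    Runs p s (update s out (f (List.Vector.ofFn fun i => s (ins i))))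

/-- The function is computed by a counter program for every choice of the input and output
counters. -/
def IsComputed {n : ℕ} (f : List.Vector ℕ n → ℕ) : Prop :=
  ∀ (ins : Fin n → ℕ) (out base : ℕ), (∀ i, ins i < base) → out < base → (∀ i, ins i ≠ out) →
    ∃ p, ComputesWith f ins out base p

theorem isComputed_get {n : ℕ} (i : Fin n) : IsComputed fun v => v.get i := by
  intro ins out base hins hout hne
  refine ⟨copy (ins i) out base, fun s hs h0 => ?_⟩
  have hi := hins i
  refine (runs_copy (hne i) (by omega) (by omega) s (hs _ le_rfl)).congr rfl ?_
  simp [h0]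

theorem isComputed_succ : IsComputed (n := 1) fun v => v.head.succ := by
  intro ins out base hins hout hne
  obtain ⟨p, hp⟩ := isComputed_get (0 : Fin 1) ins out base hins hout hne
  refine ⟨p.append (inc out halt), fun s hs h0 => ?_⟩
  refine ((hp s hs h0).append (runs_inc out _)).congr rfl ?_
  simp

/-- The results are collected in the counters from `base` on. All subprograms take their auxiliary
counters from `base + m` on, so they leave the earlier results intact. -/
theorem exists_runs_all {m n : ℕ} (g : Fin m → List.Vector ℕ n → ℕ) (hg : ∀ i, IsComputed (g i))
    (ins : Fin n → ℕ) (base : ℕ) (hins : ∀ i, ins i < base) (k : ℕ) (hk : k ≤ m) :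
    ∃ p, ∀ s : Store, (∀ j, base ≤ j → s j = 0) → Runs p s fun j =>
      if h : base ≤ j ∧ j < base + k then
        g ⟨j - base, by omega⟩ (List.Vector.ofFn fun i => s (ins i)) else s j := by
  induction k with
  | zero => exact ⟨halt, fun s _ => (runs_halt s).congr rfl (by funext j; rw [dif_neg]; omega)⟩
  | succ k ih =>
    obtain ⟨p, hp⟩ := ih (by omega)
    obtain ⟨q, hq⟩ := hg ⟨k, hk⟩ ins (base + k) (base + m) (fun i => (hins i).trans_le (by omega))
      (by omega) (fun i => by have := hins i; omega)
    refine ⟨p.append q, fun s hs => ((hp s hs).append (hq _ (fun j hj => ?_) ?_)).congr rfl ?_⟩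
    · rw [dif_neg (by omega)]
      exact hs j (by omega)
    · rw [dif_neg (by omega)]
      exact hs _ (by omega)
    · have hsame : (fun i => if h : base ≤ ins i ∧ ins i < base + k then
          g ⟨ins i - base, by omega⟩ (List.Vector.ofFn fun i => s (ins i)) else s (ins i)) =
          fun i => s (ins i) := by
        funext i
        have := hins i
        rw [dif_neg (by omega)]
      rw [hsame]
      funext j
      rw [update_apply]
      by_cases h1 : j = base + k
      · subst h1
        rw [if_pos rfl, dif_pos ⟨by omega, by omega⟩]
        congr 2
        simp
      · rw [if_neg h1]
        by_cases h2 : base ≤ j ∧ j < base + k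
        · rw [dif_pos h2, dif_pos ⟨h2.1, by omega⟩]
        · rw [dif_neg h2, dif_neg (by omega)]

theorem exists_runs_clear (base m : ℕ) : ∃ p, ∀ s : Store, Runs p s fun j =>
    if base ≤ j ∧ j < base + m then 0 else s j := by
  induction m with
  | zero => exact ⟨halt, fun s => (runs_halt s).congr rfl (by funext j; rw [if_neg]; omega)⟩
  | succ m ih =>
    obtain ⟨p, hp⟩ := ih
    refine ⟨p.append (clear (base + m)), fun s => ((hp s).append (runs_clear _ _)).congr rfl ?_⟩
    funext j
    grind

theorem isComputed_comp {m n : ℕ} {f : List.Vector ℕ m → ℕ} (g : Fin m → List.Vector ℕ n → ℕ)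
    (hf : IsComputed f) (hg : ∀ i, IsComputed (g i)) :
    IsComputed fun a => f (List.Vector.ofFn fun i => g i a) := by
  intro ins out base hins hout hne
  obtain ⟨p, hp⟩ := exists_runs_all g hg ins base hins m le_rfl
  obtain ⟨q, hq⟩ := hf (fun i => base + i) out (base + m) (fun i => by omega) (by omega)
    (fun i => by omega)
  obtain ⟨c, hc⟩ := exists_runs_clear base m
  refine ⟨(p.append q).append c, fun s hs h0 =>
    (((hp s hs).append (hq _ (fun j hj => ?_) ?_)).append (hc _)).congr rfl ?_⟩
  · rw [dif_neg (by omega)]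
    exact hs j (by omega)
  · rw [dif_neg (by omega)]
    exact h0
  · funext j
    by_cases h1 : base ≤ j ∧ j < base + m
    · rw [if_pos h1, update_of_ne (by omega), hs j h1.1]
    · rw [if_neg h1, update_apply, update_apply]
      by_cases h2 : j = out
      · rw [if_pos h2, if_pos h2]
        congr 2
        funext i
        have hi : base ≤ base + (i : ℕ) ∧ base + (i : ℕ) < base + m := ⟨by omega, by omega⟩
        rw [dif_pos hi]
        congr 2
        simp
      · rw [if_neg h2, if_neg h2, dif_neg h1]

/-- Layout of the auxiliary counters: `base` holds the remaining iterations, `base + 1` the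
recursion index, `base + 2` the accumulated value and `base + 3` the value just computed by `g`. -/
theorem isComputed_prec {n : ℕ} {f : List.Vector ℕ n → ℕ} {g : List.Vector ℕ (n + 2) → ℕ}
    (hf : IsComputed f) (hg : IsComputed g) : IsComputed fun v : List.Vector ℕ (n + 1) =>
      Nat.rec (f v.tail) (fun y IH => g (y ::ᵥ IH ::ᵥ v.tail)) v.head := by
  intro ins out base hins hout hne
  obtain ⟨p, hp⟩ := hf (fun i => ins i.succ) (base + 2) (base + 4)
    (fun i => by have := hins i.succ; omega) (by omega) (fun i => by have := hins i.succ; omega)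
  obtain ⟨q, hq⟩ := hg (Fin.cons (base + 1) (Fin.cons (base + 2) fun i => ins i.succ))
    (base + 3) (base + 4)
    (fun i => by
      refine Fin.cases ?_ (fun i => Fin.cases ?_ (fun i => ?_) i) i
      · simp
      · simp
      · have := hins i.succ
        simp only [Fin.cons_succ]
        omega)
    (by omega)
    (fun i => by
      refine Fin.cases ?_ (fun i => Fin.cases ?_ (fun i => ?_) i) i
      · simp
      · simp
      · have := hins i.succ
        simp only [Fin.cons_succ]
        omega)
  let body := ((q.append (clear (base + 2))).append (move (base + 3) (base + 2))).append
    (inc (base + 1) halt)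
  refine ⟨((((copy (ins 0) base (base + 3)).append p).append (loop base body halt)).append
    (move (base + 2) out)).append (clear (base + 1)), fun s hs h0 => ?_⟩
  set v : List.Vector ℕ n := List.Vector.ofFn fun i => s (ins i.succ) with hv
  obtain ⟨F, hF0, hFs, hF⟩ : ∃ F : ℕ → ℕ, F 0 = f v ∧ (∀ k, F (k + 1) = g (k ::ᵥ F k ::ᵥ v)) ∧
      F (s (ins 0)) = (fun v : List.Vector ℕ (n + 1) =>
        (Nat.rec (f v.tail) (fun y IH => g (y ::ᵥ IH ::ᵥ v.tail)) v.head : ℕ))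
        (List.Vector.ofFn fun i => s (ins i)) :=
    ⟨fun k => Nat.rec (f v) (fun y IH => g (y ::ᵥ IH ::ᵥ v)) k, rfl, fun _ => rfl, rfl⟩
  let σ : ℕ → Store := fun k =>
    update (update (update s base (s (ins 0) - k)) (base + 1) k) (base + 2) (F k)
  have hi0 := hins 0
  have hσ : ∀ k i, σ k (ins i) = s (ins i) := by
    intro k i
    have := hins i
    simp only [σ]
    rw [update_of_ne (by omega), update_of_ne (by omega), update_of_ne (by omega)]
  have h1 : Runs ((copy (ins 0) base (base + 3)).append p) s (σ 0) := by
    refine ((runs_copy (by omega) (by omega) (by omega) s (hs _ (by omega))).append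
      (hp _ (fun j hj => ?_) ?_)).congr rfl ?_
    · rw [update_of_ne (by omega)]
      exact hs j (by omega)
    · rw [update_of_ne (by omega)]
      exact hs _ (by omega)
    · have : (fun i : Fin n => update s base (s base + s (ins 0)) (ins i.succ)) =
          fun i => s (ins i.succ) := by
        funext i
        have := hins i.succ
        rw [update_of_ne (by omega)]
      rw [this, ← hv, ← hF0, hs base le_rfl, zero_add]
      have h10 := hs (base + 1) (by omega)
      funext j
      simp only [σ, update_apply]
      grind
  have h2 : Runs (loop base body halt) (σ 0) (σ (s (ins 0))) := by
    refine runs_loop σ _ (fun k hk => ⟨?_, ?_⟩) ?_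
    · simp only [σ]
      grind
    · have hvec : (List.Vector.ofFn fun i => update (σ k) base (σ k base - 1)
          ((Fin.cons (base + 1) (Fin.cons (base + 2) fun i => ins i.succ) : Fin (n + 2) → ℕ) i)) =
          k ::ᵥ F k ::ᵥ v := by
        have ht : ∀ i : Fin n, update (σ k) base (σ k base - 1) (ins i.succ) = s (ins i.succ) := by
          intro i
          have := hins i.succ
          rw [update_of_ne (by omega), hσ]
        simp only [List.Vector.ofFn, Fin.cons_zero, Fin.cons_succ, ht]
        rw [update_of_ne (by omega), update_of_ne (by omega)]
        simp only [σ]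
        rw [update_self, update_of_ne (by omega), update_self]
      have hq' := hq (update (σ k) base (σ k base - 1)) (fun j hj => ?_) ?_
      · rw [hvec] at hq'
        refine (((hq'.append (runs_clear _ _)).append (runs_move (by omega) _)).append
          (runs_inc _ _)).congr rfl ?_
        have h30 := hs (base + 3) (by omega)
        rw [← hFs k]
        funext j
        simp only [σ, update_apply]
        grind
      · simp only [σ]
        rw [update_of_ne (by omega), update_of_ne (by omega), update_of_ne (by omega),
          update_of_ne (by omega)]
        exact hs j (by omega)
      · simp only [σ]
        rw [update_of_ne (by omega), update_of_ne (by omega), update_of_ne (by omega),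
          update_of_ne (by omega)]
        exact hs _ (by omega)
    · simp only [σ]
      grind
  refine (((h1.append h2).append (runs_move (by omega) _)).append (runs_clear _ _)).congr rfl ?_
  rw [← hF]
  have e0 := hs base le_rfl
  have e1 := hs (base + 1) (by omega)
  have e2 := hs (base + 2) (by omega)
  funext j
  simp only [σ, update_apply]
  grind

theorem isComputed_of_primrec {n : ℕ} {f : List.Vector ℕ n → ℕ} (hf : Nat.Primrec' f) :
    IsComputed f := by
  induction hf with
  | zero => exact fun ins out base _ _ _ => ⟨halt, fun s _ h0 =>
      (runs_halt s).congr rfl (eq_update_iff.2 ⟨h0, fun _ _ => rfl⟩)⟩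
  | succ => exact isComputed_succ
  | get i => exact isComputed_get i
  | comp g _ _ hf hg => exact isComputed_comp g hf hg
  | prec _ _ hf hg => exact isComputed_prec hf hg

/-- The initial store with input `n`. -/
def initial (n : ℕ) : Store := update (fun _ => 0) 0 n

/-- The program terminates on the input `n`. -/
def Halts (p : Prog) (n : ℕ) : Prop := ∃ s, Runs p (initial n) s

/-- Computation is deterministic, so the only path from a terminating configuration is finite. -/
theorem Steps.acc {c : Prog × Store} {s : Store} (h : Steps c (halt, s)) :
    Acc (fun c' c => step c = some c') c := by
  induction h using Relation.ReflTransGen.head_induction_on with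
  | refl => exact .intro _ fun c hc => by simp [step] at hc
  | head h _ ih =>
    refine .intro _ fun c hc => ?_
    rw [h, Option.some.injEq] at hc
    exact hc ▸ ih

theorem Steps.acc_of_acc {c c' : Prog × Store} (h : Steps c c')
    (hc : Acc (fun c' c => step c = some c') c) : Acc (fun c' c => step c = some c') c' := by
  induction h with
  | refl => exact hc
  | tail _ h ih => exact ih.inv h

theorem ne_of_acc_transGen {α : Type*} {r : α → α → Prop} {f : ℕ → α}
    (hf : ∀ k, Relation.TransGen r (f (k + 1)) (f k)) {x : α} (h : Acc (Relation.TransGen r) x)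
    (k : ℕ) : f k ≠ x := by
  induction h generalizing k with
  | intro x _ ih =>
    rintro rfl
    exact ih _ (hf k) (k + 1) rfl

/-- Counter `0` holds the input, `1` the candidate, `2` the value of `g`, and `3` a flag that keeps
the main loop running as long as no zero has been found. -/
theorem exists_search {g : ℕ → ℕ → ℕ} (hg : Primrec₂ g) :
    ∃ p, ∀ n, Halts p n ↔ ∃ k, g n k = 0 := by
  obtain ⟨q, hq⟩ := isComputed_of_primrec (Nat.Primrec'.prim_iff₂.2 hg)
    (fun i => (i : ℕ)) 2 4 (fun i => by omega) (by omega) (fun i => by omega)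
  -- The body clears its own loop counter, so this loop acts as a conditional: the flag is set if
  -- `g` is not zero.
  let test := loop 2 ((clear 2).append (inc 3 halt)) halt
  let body := (q.append test).append (inc 1 halt)
  let st : ℕ → ℕ → ℕ → Store := fun n k b =>
    update (update (update (fun _ => 0) 0 n) 1 k) 3 b
  have hbody : ∀ n k, Runs body (st n k 0) (st n (k + 1) (if g n k = 0 then 0 else 1)) := by
    intro n k
    have h1 : Runs q (st n k 0) (update (st n k 0) 2 (g n k)) := by
      refine (hq (st n k 0) (fun j hj => ?_) ?_).congr rfl ?_
      · simp only [st, update_apply]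
        grind
      · simp [st]
      · congr 1
    have h2 : Runs test (update (st n k 0) 2 (g n k)) (st n k (if g n k = 0 then 0 else 1)) := by
      by_cases h0 : g n k = 0
      · refine (runs_loop (fun _ => st n k 0) 0 (fun _ h => absurd h (Nat.not_lt_zero _))
          (by simp [st])).congr ?_ ?_
        · funext j
          simp only [st, h0, update_apply]
          grind
        · rw [if_pos h0]
      · refine (runs_loop (fun i => if i = 0 then update (st n k 0) 2 (g n k) else st n k 1) 1
          (fun i hi => ?_) (by simp [st])).congr (by simp) (by simp [h0])
        obtain rfl : i = 0 := by omega
        refine ⟨by simp [h0], ((runs_clear 2 _).append (runs_inc 3 _)).congr rfl ?_⟩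
        funext j
        simp only [st, update_apply]
        grind
    refine ((h1.append h2).append (runs_inc 1 _)).congr rfl ?_
    funext j
    simp only [st, update_apply]
    grind
  have hdec : ∀ n k, update (st n k 1) 3 (st n k 1 3 - 1) = st n k 0 := by
    intro n k
    simp [st]
  have hinit : ∀ n, Runs (inc 3 halt) (initial n) (st n 0 1) := by
    intro n
    refine (runs_inc 3 _).congr rfl ?_
    funext j
    simp only [st, initial, update_apply]
    grind
  refine ⟨(inc 3 halt).append (loop 3 body halt), fun n => ⟨?_, ?_⟩⟩
  · rintro ⟨s, hs⟩
    by_contra! hno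
    -- Without a zero, the main loop is entered again for every candidate. This infinite descent
    -- contradicts accessibility of a terminating configuration.
    have hchain : ∀ k, Relation.TransGen (fun c' c => step c = some c')
        (loop 3 body halt, st n (k + 1) 1) (loop 3 body halt, st n k 1) := by
      intro k
      have h1 : step (loop 3 body halt, st n k 1) =
          some (body.append (loop 3 body halt), st n k 0) := by
        rw [step, if_neg (by simp [st]), hdec]
      have h2 := (hbody n k).steps_append (loop 3 body halt)
      rw [if_neg (hno k)] at h2
      rw [← Relation.transGen_swap]
      exact .head' h1 h2
    have hacc := Steps.acc_of_acc ((hinit n).steps_append (loop 3 body halt)) (Steps.acc hs)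
    exact ne_of_acc_transGen (f := fun k => (loop 3 body halt, st n k 1)) hchain hacc.transGen 0 rfl
  · intro h
    classical
    refine ⟨st n (Nat.find h + 1) 0, (hinit n).append ?_⟩
    refine (runs_loop (fun k => st n k (if k ≤ Nat.find h then 1 else 0)) (Nat.find h + 1)
      (fun k hk => ⟨?_, ?_⟩) ?_).congr ?_ ?_
    · simp only [if_pos (show k ≤ Nat.find h by omega)]
      simp [st]
    · simp only [if_pos (show k ≤ Nat.find h by omega), hdec]
      refine (hbody n k).congr rfl ?_
      congr 1
      by_cases hk' : g n k = 0
      · rw [if_pos hk', if_neg]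
        have := Nat.find_min' h hk'
        omega
      · rw [if_neg hk', if_pos]
        have : k ≠ Nat.find h := fun he => hk' (he ▸ Nat.find_spec h)
        omega
    · simp [st]
    · simp
    · simp

/-- One program searches, for the partial recursive code given as input, for a time bound within
which it halts on `0`. The program being fixed, only the input varies in the later reduction. -/
theorem exists_undecidable : ∃ p, ¬ ComputablePred (Halts p) := by
  have hg : Primrec₂ fun n k : ℕ =>
      if (Nat.Partrec.Code.evaln k (Denumerable.ofNat Nat.Partrec.Code n) 0).isSome then
        0 else 1 := by
    refine Primrec.ite (c := fun p : ℕ × ℕ => (Nat.Partrec.Code.evaln p.2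
      (Denumerable.ofNat Nat.Partrec.Code p.1) 0).isSome = true) ?_ (.const 0) (.const 1)
    refine Primrec.eq.comp (Primrec.option_isSome.comp (Nat.Partrec.Code.primrec_evaln.comp
      (Primrec.pair (Primrec.pair .snd ((Primrec.ofNat _).comp .fst)) (.const 0)))) (.const true)
  obtain ⟨p, hp⟩ := exists_search hg
  refine ⟨p, fun h => ComputablePred.halting_problem 0
    (ComputablePred.computable_of_manyOneReducible ⟨Encodable.encode, Computable.encode, fun c => ?_⟩
      h)⟩
  rw [hp]
  simp only [Denumerable.ofNat_encode, ite_eq_left_iff, one_ne_zero, imp_false, not_not]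
  rw [Part.dom_iff_mem]
  simp only [Nat.Partrec.Code.evaln_complete, Option.isSome_iff_exists]
  exact exists_comm

end Prog

end LukModal

namespace LukModal

/-! ### Formulas describing the computations of a counter program -/

namespace Prog

/-- The programs that can remain to be executed in the course of the computation. -/
def conts : Prog → List Prog
  | halt => [halt]
  | inc r p => inc r p :: conts p
  | loop r b p => loop r b p :: (conts p ++ (conts b).map fun q => q.append (loop r b p))

theorem self_mem_conts (p : Prog) : p ∈ conts p := by
  cases p <;> simp [conts]

/-- Unfolding a loop only creates remainders of its body followed by the same loop, so a finite list
of control states is closed under computation. -/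
theorem mem_conts_of_step {p q q' : Prog} {s s' : Store} (hq : q ∈ conts p)
    (h : step (q, s) = some (q', s')) : q' ∈ conts p := by
  induction p generalizing q q' s s' with
  | halt =>
    simp only [conts, List.mem_singleton] at hq
    subst hq
    simp [step] at h
  | inc r p ih =>
    rcases List.mem_cons.1 hq with rfl | hq
    · simp only [step, Option.some.injEq, Prod.mk.injEq] at h
      exact List.mem_cons_of_mem _ (h.1 ▸ self_mem_conts p)
    · exact List.mem_cons_of_mem _ (ih hq h)
  | loop r b p ihb ihp =>
    have hb : ∀ a ∈ conts b, a.append (loop r b p) ∈ conts (loop r b p) := fun a ha =>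
      List.mem_cons_of_mem _ (List.mem_append_right _ (List.mem_map_of_mem ha))
    have hloop : ∀ {s s' : Store} {q' : Prog}, step (loop r b p, s) = some (q', s') →
        q' ∈ conts (loop r b p) := by
      intro s s' q' h
      simp only [step] at h
      split_ifs at h
      · simp only [Option.some.injEq, Prod.mk.injEq] at h
        exact List.mem_cons_of_mem _ (List.mem_append_left _ (h.1 ▸ self_mem_conts p))
      · simp only [Option.some.injEq, Prod.mk.injEq] at h
        exact h.1 ▸ hb b (self_mem_conts b)
    rcases List.mem_cons.1 hq with rfl | hq
    · exact hloop h
    · rcases List.mem_append.1 hq with hq | hq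
      · exact List.mem_cons_of_mem _ (List.mem_append_left _ (ihp hq h))
      · obtain ⟨a, ha, rfl⟩ := List.mem_map.1 hq
        -- If the remainder `a` of the body is exhausted, the loop itself is executed next;
        -- otherwise the step takes place inside `a`.
        cases hstep : step (a, s) with
        | none =>
          have : a = halt := by
            cases a with
            | halt => rfl
            | inc r p => simp [step] at hstep
            | loop r b p =>
              simp only [step] at hstep
              split_ifs at hstep
          subst this
          exact hloop h
        | some c =>
          obtain ⟨a', t⟩ := c
          rw [step_append hstep, Option.some.injEq, Prod.mk.injEq] at h
          exact h.1 ▸ hb a' (ihb ha hstep)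

/-- The counter that the first instruction of a program acts on. -/
def headCounter : Prog → ℕ
  | halt => 0
  | inc r _ => r
  | loop r _ _ => r

/-- A strict upper bound for the counters used in the computation. -/
def numCounters (p : Prog) : ℕ := ((conts p).map headCounter).foldr max 0 + 1

theorem headCounter_lt {p q : Prog} (hq : q ∈ conts p) : headCounter q < numCounters p := by
  have aux : ∀ L : List Prog, q ∈ L → headCounter q ≤ (L.map headCounter).foldr max 0 := by
    intro L hL
    induction L with
    | nil => simp at hL
    | cons a L ih =>
      rcases List.mem_cons.1 hL with rfl | hL
      · exact le_max_left _ _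
      · exact (ih hL).trans (le_max_right _ _)
  exact Nat.lt_succ_of_le (aux _ hq)

/-- A numbering of the programs. -/
def code : Prog → ℕ
  | halt => 0
  | inc r p => 2 * Nat.pair r (code p) + 1
  | loop r b p => 2 * Nat.pair r (Nat.pair (code b) (code p)) + 2

theorem code_injective : Function.Injective code := by
  intro p
  induction p with
  | halt =>
    intro q h
    cases q <;> simp [code] at h ⊢
  | inc r p ih =>
    intro q h
    cases q with
    | halt => simp [code] at h
    | inc r' q =>
      have h' : Nat.pair r (code p) = Nat.pair r' (code q) := by simp only [code] at h; omega
      rw [Nat.pair_eq_pair] at h'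
      rw [h'.1, ih h'.2]
    | loop r' b q => simp only [code] at h; omega
  | loop r b p ihb ihp =>
    intro q h
    cases q with
    | halt => simp [code] at h
    | inc r' q => simp only [code] at h; omega
    | loop r' b' q =>
      have h' : Nat.pair r (Nat.pair (code b) (code p)) =
        Nat.pair r' (Nat.pair (code b') (code q)) := by simp only [code] at h; omega
      rw [Nat.pair_eq_pair, Nat.pair_eq_pair] at h'
      rw [h'.1, ihb h'.2.1, ihp h'.2.2]

end Prog

/-! ### Truncated arithmetic with formulas -/

namespace MFm

/-- `¬φ` -/
def neg (φ : MFm) : MFm := imp φ bot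

/-- Strong disjunction `min {1, a + b}`. -/
def plus (φ ψ : MFm) : MFm := imp (neg φ) ψ

/-- `min {1, 2a}` -/
def dbl (φ : MFm) : MFm := plus φ φ

/-- `φ ↔ ψ` -/
def bic (φ ψ : MFm) : MFm := mul (imp φ ψ) (imp ψ φ)

/-- Truncated difference `max {0, a - b}`. -/
def tsub (φ ψ : MFm) : MFm := neg (imp φ ψ)

end MFm

namespace Model

variable (M : Model.{u}) (w : M.W)

theorem coe_val_neg (φ : MFm) : (M.val φ.neg w : ℝ) = 1 - M.val φ w := by
  change ((lukImp (M.val φ w) 0 : unitInterval) : ℝ) = _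
  rw [lukImp_zero, unitInterval.coe_symm_eq]

theorem coe_val_plus (φ ψ : MFm) : (M.val (φ.plus ψ) w : ℝ) =
    min 1 ((M.val φ w : ℝ) + M.val ψ w) := by
  change min 1 (1 - (M.val φ.neg w : ℝ) + M.val ψ w) = _
  rw [coe_val_neg]
  congr 1
  ring

theorem coe_val_dbl (φ : MFm) : (M.val φ.dbl w : ℝ) = min 1 (2 * (M.val φ w : ℝ)) := by
  rw [MFm.dbl, coe_val_plus, two_mul]

theorem coe_val_tsub (φ ψ : MFm) :
    (M.val (φ.tsub ψ) w : ℝ) = max 0 ((M.val φ w : ℝ) - M.val ψ w) := by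
  rw [MFm.tsub, coe_val_neg]
  change 1 - min 1 (1 - (M.val φ w : ℝ) + M.val ψ w) = _
  rcases le_total (1 - (M.val φ w : ℝ) + M.val ψ w) 1 with h | h
  · rw [min_eq_right h, max_eq_right] <;> linarith
  · rw [min_eq_left h, max_eq_left] <;> linarith

theorem coe_val_iterate_dbl (φ : MFm) (n : ℕ) :
    (M.val (MFm.dbl^[n] φ) w : ℝ) = min 1 (2 ^ n * (M.val φ w : ℝ)) := by
  induction n with
  | zero => simp [(M.val φ w).2.2]
  | succ n ih =>
    rw [Function.iterate_succ_apply', coe_val_dbl, ih]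
    have : (0 : ℝ) ≤ 2 ^ n * M.val φ w := mul_nonneg (by positivity) (M.val φ w).2.1
    have h2 : (2 : ℝ) ^ (n + 1) * M.val φ w = 2 * (2 ^ n * M.val φ w) := by ring
    rw [h2]
    simp only [min_def]
    split_ifs <;> linarith

theorem val_imp_eq_one_iff (φ ψ : MFm) :
    M.val (.imp φ ψ) w = 1 ↔ (M.val φ w : ℝ) ≤ M.val ψ w :=
  lukImp_eq_one_iff

theorem val_bic_eq_one_iff (φ ψ : MFm) :
    M.val (φ.bic ψ) w = 1 ↔ (M.val φ w : ℝ) = M.val ψ w := by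
  change lukMul (lukImp _ _) (lukImp _ _) = 1 ↔ _
  rw [lukMul_eq_one_iff, lukImp_eq_one_iff, lukImp_eq_one_iff, ← le_antisymm_iff, Subtype.coe_inj]

theorem val_or_neg_eq_one_iff (φ : MFm) :
    M.val (.or φ φ.neg) w = 1 ↔ (M.val φ w : ℝ) = 1 ∨ (M.val φ w : ℝ) = 0 := by
  rw [← Subtype.coe_inj, Set.Icc.coe_one]
  have h : (M.val (.or φ φ.neg) w : ℝ) = max (M.val φ w : ℝ) (1 - M.val φ w) := by
    rw [← coe_val_neg]
    exact Monotone.map_sup (fun _ _ h => h) _ _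
  rw [h]
  constructor
  · intro h
    rcases max_choice (M.val φ w : ℝ) (1 - M.val φ w) with h' | h' <;> rw [h'] at h
    · exact .inl h
    · exact .inr (by linarith)
  · rintro (h | h) <;> rw [h] <;> norm_num

theorem val_neg_eq_one_iff (φ : MFm) : M.val φ.neg w = 1 ↔ (M.val φ w : ℝ) = 0 := by
  rw [← Subtype.coe_inj, coe_val_neg, Set.Icc.coe_one]
  constructor <;> intro h <;> linarith

theorem val_imp_of_zero {φ : MFm} (h : (M.val φ w : ℝ) = 0) (ψ : MFm) :
    M.val (.imp φ ψ) w = 1 := by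
  rw [val_imp_eq_one_iff, h]
  exact (M.val ψ w).2.1

theorem val_eq_one_of_imp {φ ψ : MFm} (h : M.val (.imp φ ψ) w = 1) (hφ : (M.val φ w : ℝ) = 1) :
    M.val ψ w = 1 := by
  rw [val_imp_eq_one_iff, hφ] at h
  exact le_antisymm unitInterval.le_one' h

theorem coe_val_mul (φ ψ : MFm) :
    (M.val (.mul φ ψ) w : ℝ) = max 0 ((M.val φ w : ℝ) + M.val ψ w - 1) := rfl

end Model

/-! ### Axioms for clock, counters and control state -/

namespace Prog

open MFm

/-- The clock: its value is halved in each step. -/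
def clock : MFm := .var 0

/-- The value of the clock, multiplied by `1 + 2 ^ (-a)` if `a` is the content of the counter. -/
def pos (r : ℕ) : MFm := .var (4 * r + 1)

/-- The value of the clock, multiplied by `2 - 2 ^ (-a)` if `a` is the content of the counter. -/
def opp (r : ℕ) : MFm := .var (4 * r + 2)

/-- The counter is zero. -/
def isZero (r : ℕ) : MFm := .var (4 * r + 3)

/-- The program remains to be executed. -/
def ctrl (q : Prog) : MFm := .var (4 * q.code + 4)

/-- Three times the value. -/
def triple (φ : MFm) : MFm := plus φ (dbl φ)

/-- At successors where the clock is close to its supremum, `q` is to be executed. -/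
def next (q : Prog) : MFm := imp (dbl (dbl (dia (and clock (neg (ctrl q)))))) clock

/-- The counter does not change. -/
def keep (r : ℕ) : MFm := bic (dbl (dia (pos r))) (pos r)

/-- No counter other than `r` changes. -/
def keepExcept (m r : ℕ) : List MFm := ((List.range m).filter (· ≠ r)).map keep

/-- The formulas describing the first instruction of a program. -/
def rules (m : ℕ) : Prog → List MFm
  | halt => [neg (ctrl halt)]
  | inc r p => (next p :: bic (dbl (dbl (dia (pos r)))) (plus clock (pos r)) ::
      keepExcept m r).map (imp (ctrl (inc r p)))
  | loop r b p =>
    (next p :: (List.range m).map keep).map (imp (mul (ctrl (loop r b p)) (isZero r))) ++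
    (next (b.append (loop r b p)) :: bic (plus (dbl (dia (pos r))) clock) (dbl (pos r)) ::
      keepExcept m r).map (imp (mul (ctrl (loop r b p)) (neg (isZero r))))

/-- The formulas describing the encoding of a counter. -/
def counterAxioms (r : ℕ) : List MFm :=
  [bic (plus (pos r) (opp r)) (triple clock),
    bic (plus (dia (pos r)) (dia (opp r))) (triple (dia clock)),
    or (isZero r) (neg (isZero r)), imp (isZero r) (bic (pos r) (dbl clock)),
    imp (neg (isZero r)) (imp (dbl (pos r)) (triple clock))]

/-- The formulas that hold at all worlds. -/
def globalAxioms (p : Prog) : List MFm :=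
  imp (dbl clock) (neg (dbl (dbl (dbl clock)))) :: bic clock (dbl (dia clock)) ::
    ((List.range (numCounters p)).flatMap counterAxioms ++
      (conts p).flatMap fun q => or (ctrl q) (neg (ctrl q)) :: rules (numCounters p) q)

/-- The formulas describing the computation of the program. -/
def runAxioms (p : Prog) : List MFm :=
  globalAxioms p ++ (globalAxioms p).map box ++ ctrl p ::
    ((List.range (numCounters p)).filter (· ≠ 0)).map fun r => bic (pos r) (dbl clock)

/-- The formula stating that the content of the first counter is `n`. -/
def inputAxiom (n : ℕ) : MFm := bic (dbl^[n] (tsub (pos 0) clock)) clock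

end Prog
end LukModal

/-! ### From a transitive countermodel to a non-terminating run -/

namespace LukModal
namespace Prog
open MFm Model

/-- Removes the truncation at `1`; the smallness of the clock provides the hypothesis. -/
theorem eq_of_min_one_eq {a b : ℝ} (h : min 1 a = min 1 b) (hb : b < 1) : a = b := by
  rw [min_eq_right hb.le] at h
  rcases min_choice 1 a with h' | h' <;> rw [h'] at h
  · linarith
  · exact h

section Soundness

variable {p : Prog} {M : Model.{u}} {w : M.W}

theorem coe_val_triple (M : Model.{u}) (w : M.W) (φ : MFm) :
    (M.val (triple φ) w : ℝ) = min 1 (3 * (M.val φ w : ℝ)) := by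
  rw [triple, coe_val_plus, coe_val_dbl]
  have := (M.val φ w).2.1
  simp only [min_def]
  split_ifs <;> linarith

/-- The first axiom reads `2c ≤ 1 - 8c`. The bound `1/10` keeps the sums formed with the clock and
the counters away from truncation. -/
theorem clock_facts (h : ∀ γ ∈ globalAxioms p, M.val γ w = 1) :
    (M.val clock w : ℝ) ≤ 1 / 10 ∧ (M.val (dia clock) w : ℝ) = M.val clock w / 2 := by
  have h1 := h (imp (dbl clock) (neg (dbl (dbl (dbl clock))))) (by simp [globalAxioms])
  have h2 := h (bic clock (dbl (dia clock))) (by simp [globalAxioms])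
  rw [val_imp_eq_one_iff, coe_val_neg, coe_val_dbl, coe_val_dbl, coe_val_dbl, coe_val_dbl] at h1
  rw [val_bic_eq_one_iff, coe_val_dbl] at h2
  have h0 := (M.val clock w).2.1
  have hle : (M.val clock w : ℝ) ≤ 1 / 10 := by
    simp only [min_def] at h1
    split_ifs at h1 <;> linarith
  refine ⟨hle, ?_⟩
  simp only [min_def] at h2
  split_ifs at h2 <;> linarith

theorem counter_facts (h : ∀ γ ∈ globalAxioms p, M.val γ w = 1) {r : ℕ}
    (hr : r < numCounters p) :
    (M.val (pos r) w : ℝ) + M.val (opp r) w = 3 * (M.val clock w : ℝ) ∧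
    (M.val (dia (pos r)) w : ℝ) + M.val (dia (opp r)) w = 3 * (M.val (dia clock) w : ℝ) ∧
    ((M.val (isZero r) w : ℝ) = 1 ∧ (M.val (pos r) w : ℝ) = 2 * (M.val clock w : ℝ) ∨
      (M.val (isZero r) w : ℝ) = 0 ∧ 2 * (M.val (pos r) w : ℝ) ≤ 3 * (M.val clock w : ℝ)) := by
  obtain ⟨hc, hd⟩ := clock_facts h
  have hmem : ∀ γ ∈ counterAxioms r, M.val γ w = 1 := fun γ hγ => h γ (by
    simp only [globalAxioms, List.mem_cons, List.mem_append, List.mem_flatMap, List.mem_range]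
    exact .inr (.inr (.inl ⟨r, hr, hγ⟩)))
  simp only [counterAxioms, List.forall_mem_cons] at hmem
  obtain ⟨h1, h2, h3, h4, h5, -⟩ := hmem
  rw [val_bic_eq_one_iff, coe_val_plus, coe_val_triple] at h1 h2
  rw [val_or_neg_eq_one_iff] at h3
  refine ⟨eq_of_min_one_eq h1 (by linarith), eq_of_min_one_eq h2 (by linarith), ?_⟩
  rcases h3 with h3 | h3
  · have h4' := val_eq_one_of_imp M w h4 h3
    rw [val_bic_eq_one_iff, coe_val_dbl, min_eq_right (by linarith)] at h4'
    exact .inl ⟨h3, h4'⟩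
  · have h5' := val_eq_one_of_imp M w h5 (by rw [coe_val_neg, h3, sub_zero])
    rw [val_imp_eq_one_iff, coe_val_dbl, coe_val_triple,
      min_eq_right (a := 1) (b := 3 * (M.val clock w : ℝ)) (by linarith)] at h5'
    refine .inr ⟨h3, ?_⟩
    rcases min_choice 1 (2 * (M.val (pos r) w : ℝ)) with h' | h' <;> rw [h'] at h5'
    · linarith
    · exact h5'

theorem ctrl_facts (h : ∀ γ ∈ globalAxioms p, M.val γ w = 1) {q : Prog} (hq : q ∈ conts p) :
    ((M.val (ctrl q) w : ℝ) = 1 ∨ (M.val (ctrl q) w : ℝ) = 0) ∧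
    ∀ γ ∈ rules (numCounters p) q, M.val γ w = 1 := by
  have hmem : ∀ γ ∈ or (ctrl q) (neg (ctrl q)) :: rules (numCounters p) q, M.val γ w = 1 :=
    fun γ hγ => h γ (by
      simp only [globalAxioms, List.mem_cons, List.mem_append, List.mem_flatMap, List.mem_range]
      exact .inr (.inr (.inr ⟨q, hq, List.mem_cons.1 hγ⟩)))
  rw [List.forall_mem_cons, val_or_neg_eq_one_iff] at hmem
  exact hmem

theorem dia_pos_of_keep (h : ∀ γ ∈ globalAxioms p, M.val γ w = 1) {r : ℕ}
    (hr : r < numCounters p) (hk : M.val (keep r) w = 1) :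
    (M.val (dia (pos r)) w : ℝ) = M.val (pos r) w / 2 := by
  obtain ⟨hc, -⟩ := clock_facts h
  obtain ⟨h1, -, -⟩ := counter_facts h hr
  have hy := (M.val (opp r) w).2.1
  rw [keep, val_bic_eq_one_iff, coe_val_dbl] at hk
  rcases min_choice 1 (2 * (M.val (dia (pos r)) w : ℝ)) with h' | h' <;> rw [h'] at hk <;> linarith

theorem keep_of_keepExcept {m r r' : ℕ} (hr' : r' < m) (hne : r' ≠ r) :
    keep r' ∈ keepExcept m r :=
  List.mem_map_of_mem (by simp [hr', hne])

/-- Writing `x` for `pos r`, the rules give `◇x = x/2` for an unchanged counter, `4◇x = c + x` for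
an increment and `2◇x + c = 2x` for a decrement. With `x = c(1 + 2^(-a))` each yields the right
value for the clock `c/2`, and the absolute error never exceeds the old one. An error of `c/4` still
separates the content zero, where `x = 2c`, from positive contents, where `x ≤ 3c/2`. -/
theorem rules_sound (h : ∀ γ ∈ globalAxioms p, M.val γ w = 1) {q : Prog} (hq : q ∈ conts p)
    (hP : (M.val (ctrl q) w : ℝ) = 1) (hpos : (0 : ℝ) < M.val clock w) {s : Store} {δ : ℝ}
    (hδ : δ ≤ 1 / 4)
    (happ : ∀ r < numCounters p,
      |(M.val (pos r) w : ℝ) - M.val clock w * (1 + (1 / 2) ^ s r)| ≤ δ * M.val clock w) :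
    ∃ q' s', step (q, s) = some (q', s') ∧ M.val (next q') w = 1 ∧ ∀ r < numCounters p,
      |(M.val (dia (pos r)) w : ℝ) - M.val clock w / 2 * (1 + (1 / 2) ^ s' r)| ≤
        δ * M.val clock w := by
  obtain ⟨hc, hd⟩ := clock_facts h
  have hrules := (ctrl_facts h hq).2
  have hhead := headCounter_lt hq
  have hδc : δ * M.val clock w ≤ 1 / 4 * M.val clock w :=
    mul_le_mul_of_nonneg_right hδ hpos.le
  have hkeep : ∀ r < numCounters p, ∀ s' : Store, M.val (keep r) w = 1 → s' r = s r →
      |(M.val (dia (pos r)) w : ℝ) - M.val clock w / 2 * (1 + (1 / 2) ^ s' r)| ≤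
        δ * M.val clock w := by
    intro r hr s' hk hs
    have h1 := happ r hr
    rw [dia_pos_of_keep h hr hk, hs]
    rw [abs_le] at h1 ⊢
    constructor <;> linarith [h1.1, h1.2]
  cases q with
  | halt =>
    have := hrules (neg (ctrl halt)) (by simp [rules])
    rw [val_neg_eq_one_iff, hP] at this
    exact absurd this one_ne_zero
  | inc r q =>
    simp only [headCounter] at hhead
    have hall : ∀ γ ∈ next q :: bic (dbl (dbl (dia (pos r)))) (plus clock (pos r)) ::
        keepExcept (numCounters p) r, M.val γ w = 1 := fun γ hγ =>
      val_eq_one_of_imp M w (hrules _ (List.mem_map_of_mem hγ)) hP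
    rw [List.forall_mem_cons, List.forall_mem_cons] at hall
    obtain ⟨hn, hu, hk⟩ := hall
    refine ⟨q, _, rfl, hn, fun r' hr' => ?_⟩
    by_cases hne : r' = r
    · subst hne
      obtain ⟨h1, -, -⟩ := counter_facts h hr'
      have hy := (M.val (opp r') w).2.1
      have ha := happ r' hr'
      rw [val_bic_eq_one_iff, coe_val_dbl, coe_val_dbl, coe_val_plus,
        min_eq_right (a := 1) (b := (M.val clock w : ℝ) + M.val (pos r') w) (by linarith)] at hu
      have hu' : 4 * (M.val (dia (pos r')) w : ℝ) = M.val clock w + M.val (pos r') w := by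
        simp only [min_def] at hu
        split_ifs at hu <;> linarith
      rw [Function.update_self, pow_succ]
      rw [abs_le] at ha ⊢
      constructor <;> linarith [ha.1, ha.2]
    · exact hkeep r' hr' _ (hk _ (keep_of_keepExcept hr' hne)) (by
        rw [Function.update_of_ne hne])
  | loop r b q =>
    simp only [headCounter] at hhead
    obtain ⟨hxy, -, hz⟩ := counter_facts h hhead
    have hy := (M.val (opp r) w).2.1
    have ha := happ r hhead
    rw [abs_le] at ha
    by_cases hs : s r = 0
    · rw [hs, pow_zero] at ha
      -- Here `x` is at least `7c/4`, too large for the bound `3c/2` that a false zero flag would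
      -- impose.
      have hz1 : (M.val (isZero r) w : ℝ) = 1 := by
        rcases hz with hz | hz
        · exact hz.1
        · linarith [hz.2, ha.1]
      have hg : (M.val (mul (ctrl (loop r b q)) (isZero r)) w : ℝ) = 1 := by
        rw [coe_val_mul, hP, hz1]
        norm_num
      have hall : ∀ γ ∈ next q :: (List.range (numCounters p)).map keep, M.val γ w = 1 :=
        fun γ hγ => val_eq_one_of_imp M w
          (hrules _ (List.mem_append_left _ (List.mem_map_of_mem hγ))) hg
      rw [List.forall_mem_cons] at hall
      refine ⟨q, s, by rw [step, if_pos hs], hall.1, fun r' hr' => hkeep r' hr' _ (hall.2 _ ?_) rfl⟩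
      exact List.mem_map_of_mem (List.mem_range.2 hr')
    · obtain ⟨a, ha'⟩ := Nat.exists_eq_succ_of_ne_zero hs
      have hξ : ((1 : ℝ) / 2) ^ a ≤ 1 := pow_le_one₀ (by norm_num) (by norm_num)
      have hcξ : (M.val clock w : ℝ) * (1 / 2) ^ a ≤ M.val clock w := by
        simpa using mul_le_mul_of_nonneg_left hξ hpos.le
      rw [ha', Nat.succ_eq_add_one, pow_succ] at ha
      have hz0 : (M.val (isZero r) w : ℝ) = 0 := by
        rcases hz with hz | hz
        · linarith [hz.2, ha.2]
        · exact hz.1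
      have hg : (M.val (mul (ctrl (loop r b q)) (neg (isZero r))) w : ℝ) = 1 := by
        rw [coe_val_mul, coe_val_neg, hP, hz0]
        norm_num
      have hall : ∀ γ ∈ next (b.append (loop r b q)) ::
          bic (plus (dbl (dia (pos r))) clock) (dbl (pos r)) :: keepExcept (numCounters p) r,
          M.val γ w = 1 :=
        fun γ hγ => val_eq_one_of_imp M w
          (hrules _ (List.mem_append_right _ (List.mem_map_of_mem hγ))) hg
      rw [List.forall_mem_cons, List.forall_mem_cons] at hall
      obtain ⟨hn, hu, hk⟩ := hall
      refine ⟨b.append (loop r b q), _, by rw [step, if_neg hs], hn, fun r' hr' => ?_⟩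
      by_cases hne : r' = r
      · subst hne
        rw [val_bic_eq_one_iff, coe_val_plus, coe_val_dbl, coe_val_dbl,
          min_eq_right (a := 1) (b := 2 * (M.val (pos r') w : ℝ)) (by linarith)] at hu
        have hu' : 2 * (M.val (dia (pos r')) w : ℝ) + M.val clock w = 2 * M.val (pos r') w := by
          simp only [min_def] at hu
          split_ifs at hu <;> linarith
        rw [Function.update_self, ha', Nat.succ_sub_one]
        rw [abs_le]
        constructor <;> linarith [ha.1, ha.2]
      · exact hkeep r' hr' _ (hk _ (keep_of_keepExcept hr' hne)) (by
          rw [Function.update_of_ne hne])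

/-- The world `w` encodes the configuration up to the error `δ`. -/
def Encodes (p : Prog) (M : Model.{u}) (w : M.W) (δ : ℝ) (c : Prog × Store) : Prop :=
  (0 : ℝ) < M.val clock w ∧ (M.val (ctrl c.1) w : ℝ) = 1 ∧ ∀ r < numCounters p,
    |(M.val (pos r) w : ℝ) - M.val clock w * (1 + (1 / 2) ^ c.2 r)| ≤ δ * M.val clock w

/-- A successor whose clock is nearly the supremum is chosen. Neither `pos r` nor `opp r` exceeds
its supremum there, while their sum is three times the clock, hence nearly the sum of the two
suprema. So neither can fall far below its supremum, and the rules fix the supremum of `pos r`. -/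
theorem exists_encodes_step (h : ∀ γ ∈ globalAxioms p, M.val γ w = 1)
    (hR : ∀ w', M.R w w' → ∀ γ ∈ globalAxioms p, M.val γ w' = 1) {c : Prog × Store}
    (hq : c.1 ∈ conts p) {δ : ℝ} (hδ0 : 0 < δ) (hδ : δ ≤ 1)
    (hE : Encodes p M w (δ / 8) c) :
    ∃ c' w', step c = some c' ∧ M.R w w' ∧ Encodes p M w' δ c' := by
  obtain ⟨q, s⟩ := c
  obtain ⟨hpos, hP, happ⟩ := hE
  obtain ⟨q', s', hstep, hnext, hdia⟩ := rules_sound h hq hP hpos (by linarith) happ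
  obtain ⟨hc, hd⟩ := clock_facts h
  have hsucc : ∃ w₀, M.R w w₀ := by
    by_contra hno
    rw [val_dia_of_forall_not M clock (not_exists.1 hno)] at hd
    simp only [Set.Icc.coe_zero] at hd
    linarith
  obtain ⟨w₀, hw₀⟩ := hsucc
  have hδc : 0 < δ * M.val clock w := mul_pos hδ0 hpos
  have hδc' : δ * M.val clock w ≤ M.val clock w := by
    simpa using mul_le_mul_of_nonneg_right hδ hpos.le
  -- With `c` the clock at `w`, the error of `pos r` is at most `δc/8` from the rules plus `3δc/40`
  -- from the choice of the successor. The total `δc/5` is below `δ` times the new clock, which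
  -- exceeds `c/4`.
  obtain ⟨w', hw', hnear⟩ := exists_near_witness M hw₀ clock (ε := δ * M.val clock w / 40)
    (by linarith)
  have hle : (M.val clock w' : ℝ) ≤ M.val (dia clock) w := val_le_dia M clock hw'
  rw [hd] at hnear hle
  have hquarter : (M.val clock w : ℝ) / 4 < M.val clock w' := by linarith
  have hax := hR w' hw'
  refine ⟨(q', s'), w', hstep, hw', by linarith, ?_, fun r hr => ?_⟩
  -- If the control variable were `0` at `w'`, the formula `next q'` would bound the clock there by
  -- `c/4`.
  · rcases (ctrl_facts hax (mem_conts_of_step hq hstep)).1 with h1 | h0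
    · exact h1
    · rw [next, val_imp_eq_one_iff, coe_val_dbl, coe_val_dbl] at hnext
      have h2 : (M.val (and clock (neg (ctrl q'))) w' : ℝ) ≤
          M.val (dia (and clock (neg (ctrl q')))) w := val_le_dia M _ hw'
      have h3 : M.val (and clock (neg (ctrl q'))) w' = M.val clock w' := by
        have : M.val (neg (ctrl q')) w' = 1 := (val_neg_eq_one_iff M w' _).2 h0
        change M.val clock w' ⊓ M.val (neg (ctrl q')) w' = _
        rw [this]
        exact inf_eq_left.2 unitInterval.le_one'
      rw [h3] at h2
      simp only [min_def] at hnext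
      split_ifs at hnext <;> linarith
  · obtain ⟨h1, -, -⟩ := counter_facts hax hr
    obtain ⟨-, h2, -⟩ := counter_facts h hr
    have hx : (M.val (pos r) w' : ℝ) ≤ M.val (dia (pos r)) w := val_le_dia M _ hw'
    have hy : (M.val (opp r) w' : ℝ) ≤ M.val (dia (opp r)) w := val_le_dia M _ hw'
    have h3 := hdia r hr
    rw [hd] at h2
    have hξ0 : (0 : ℝ) ≤ (1 / 2) ^ s' r := by positivity
    have hξ1 : ((1 : ℝ) / 2) ^ s' r ≤ 1 := pow_le_one₀ (by norm_num) (by norm_num)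
    have h4 : (M.val clock w / 2 - M.val clock w' : ℝ) * (1 + (1 / 2) ^ s' r) ≤
        δ * M.val clock w / 40 * 2 :=
      mul_le_mul (by linarith) (by linarith) (by linarith) (by linarith)
    have h5 : 0 ≤ (M.val clock w / 2 - M.val clock w' : ℝ) * (1 + (1 / 2) ^ s' r) :=
      mul_nonneg (by linarith) (by linarith)
    have h6 : δ * (M.val clock w / 4) ≤ δ * M.val clock w' :=
      mul_le_mul_of_nonneg_left hquarter.le hδ0.le
    simp only
    rw [abs_le] at h3 ⊢
    constructor <;> nlinarith [h3.1, h3.2]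

/-- By transitivity a single box at `v` governs all worlds that the simulated run visits. -/
theorem forall_val_eq_one_of_runAxioms {v : M.W} (hM : M.IsTransitive)
    (h : ∀ γ ∈ runAxioms p, M.val γ v = 1) (w : M.W) (hw : w = v ∨ M.R v w) :
    (∀ γ ∈ globalAxioms p, M.val γ w = 1) ∧
      ∀ w', M.R w w' → (w' = v ∨ M.R v w') ∧ ∀ γ ∈ globalAxioms p, M.val γ w' = 1 := by
  have hglob : ∀ w, (w = v ∨ M.R v w) → ∀ γ ∈ globalAxioms p, M.val γ w = 1 := by
    rintro w (rfl | hw) γ hγ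
    · exact h γ (by simp [runAxioms, hγ])
    · exact (val_box_eq_one_iff M γ v).1 (h (box γ) (by simp [runAxioms, hγ])) w hw
  refine ⟨hglob w hw, fun w' hw' => ?_⟩
  have hw'' : w' = v ∨ M.R v w' := by
    rcases hw with rfl | hw
    · exact .inr hw'
    · exact .inr (hM _ _ _ hw hw')
  exact ⟨hw'', hglob w' hw''⟩

theorem encodes_initial {v : M.W} (h : ∀ γ ∈ runAxioms p, M.val γ v = 1) {n : ℕ}
    (hn : M.val (inputAxiom n) v = 1) (hpos : (0 : ℝ) < M.val clock v) {δ : ℝ} (hδ : 0 ≤ δ) :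
    Encodes p M v δ (p, initial n) := by
  have hglob : ∀ γ ∈ globalAxioms p, M.val γ v = 1 := fun γ hγ => h γ (by simp [runAxioms, hγ])
  obtain ⟨hc, -⟩ := clock_facts hglob
  refine ⟨hpos, ?_, fun r hr => ?_⟩
  · rw [h (ctrl p) (by simp [runAxioms])]
    rfl
  · refine le_of_eq_of_le ?_ (mul_nonneg hδ hpos.le)
    rw [abs_eq_zero, sub_eq_zero]
    by_cases hr0 : r = 0
    · subst hr0
      simp only [initial, Function.update_self]
      rw [inputAxiom, val_bic_eq_one_iff, coe_val_iterate_dbl, coe_val_tsub] at hn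
      have h2 : (2 : ℝ) ^ n * max 0 ((M.val (pos 0) v : ℝ) - M.val clock v) = M.val clock v := by
        rcases min_choice 1 ((2 : ℝ) ^ n * max 0 ((M.val (pos 0) v : ℝ) - M.val clock v)) with
          h' | h' <;> rw [h'] at hn
        · linarith
        · exact hn
      rcases max_choice 0 ((M.val (pos 0) v : ℝ) - M.val clock v) with h' | h' <;> rw [h'] at h2
      · linarith
      · have h3 : (2 : ℝ) ^ n * (1 / 2) ^ n = 1 := by rw [← mul_pow]; norm_num
        have h4 : (M.val (pos 0) v : ℝ) - M.val clock v = M.val clock v * (1 / 2) ^ n := by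
          calc (M.val (pos 0) v : ℝ) - M.val clock v
              = 2 ^ n * (1 / 2) ^ n * ((M.val (pos 0) v : ℝ) - M.val clock v) := by
                rw [h3, one_mul]
            _ = 2 ^ n * ((M.val (pos 0) v : ℝ) - M.val clock v) * (1 / 2) ^ n := by ring
            _ = _ := by rw [h2]
        linarith
    · have h1 := h (bic (pos r) (dbl clock)) (by
        simp only [runAxioms, List.mem_append, List.mem_cons]
        exact .inr (.inr (List.mem_map.2 ⟨r, by simp [hr, hr0], rfl⟩)))
      rw [val_bic_eq_one_iff, coe_val_dbl, min_eq_right (by linarith)] at h1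
      rw [h1]
      simp only [initial, Function.update_of_ne hr0, pow_zero]
      ring

/-- Each configuration of the run is encoded somewhere with arbitrarily small error: precision `δ`
after a step is obtained from precision `δ/8` before it. A halting configuration cannot be encoded,
since an encoded configuration always has a next step. -/
theorem not_halts_of_countermodel (hM : M.IsTransitive) {v : M.W}
    (h : ∀ γ ∈ runAxioms p, M.val γ v = 1) {n : ℕ} (hn : M.val (inputAxiom n) v = 1)
    (hpos : (0 : ℝ) < M.val clock v) : ¬ Halts p n := by
  rintro ⟨s, hs⟩
  have key : ∀ c, Steps (p, initial n) c → c.1 ∈ conts p ∧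
      ∀ δ : ℝ, 0 < δ → δ ≤ 1 → ∃ w, (w = v ∨ M.R v w) ∧ Encodes p M w δ c := by
    intro c hc
    induction hc with
    | refl => exact ⟨self_mem_conts p, fun δ hδ _ => ⟨v, .inl rfl, encodes_initial h hn hpos hδ.le⟩⟩
    | @tail c c' _ hstep ih =>
      refine ⟨mem_conts_of_step ih.1 (s := c.2) (s' := c'.2) hstep, fun δ hδ hδ1 => ?_⟩
      obtain ⟨w, hw, hE⟩ := ih.2 (δ / 8) (by linarith) (by linarith)
      obtain ⟨hax, hsucc⟩ := forall_val_eq_one_of_runAxioms hM h w hw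
      obtain ⟨c'', w', hstep', hw', hE'⟩ :=
        exists_encodes_step hax (fun w' hw' => (hsucc w' hw').2) ih.1 hδ hδ1 hE
      rw [hstep, Option.some.injEq] at hstep'
      exact ⟨w', (hsucc w' hw').1, hstep' ▸ hE'⟩
  obtain ⟨hq, hE⟩ := key _ hs
  obtain ⟨w, hw, hE⟩ := hE (1 / 8) (by norm_num) (by norm_num)
  obtain ⟨hax, hsucc⟩ := forall_val_eq_one_of_runAxioms hM h w hw
  obtain ⟨c, -, hstep, -⟩ := exists_encodes_step hax (fun w' hw' => (hsucc w' hw').2) hq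
    one_pos le_rfl hE
  simp [step] at hstep

end Soundness

end Prog
end LukModal

/-! ### From a non-terminating run to a transitive countermodel -/

namespace LukModal
namespace Prog
open MFm Model

section Completeness

variable (C : ℕ → Prog × Store)

/-- The value of the clock after `t` steps. -/
noncomputable def clockValue (t : ℕ) : ℝ := (1 / 2) ^ (t + 4)

theorem clockValue_pos (t : ℕ) : 0 < clockValue t := by unfold clockValue; positivity

theorem clockValue_succ (t : ℕ) : clockValue (t + 1) = clockValue t / 2 := by
  rw [clockValue, clockValue, show t + 1 + 4 = t + 4 + 1 by ring, pow_succ]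
  ring

theorem clockValue_le_of_lt {t t' : ℕ} (h : t < t') : clockValue t' ≤ clockValue t / 2 := by
  rw [← clockValue_succ]
  exact pow_le_pow_of_le_one (by norm_num) (by norm_num) (by omega)

theorem clockValue_le (t : ℕ) : clockValue t ≤ 1 / 16 := by
  have : clockValue t ≤ (1 / 2) ^ 4 := pow_le_pow_of_le_one (by norm_num) (by norm_num) (by omega)
  norm_num at this ⊢
  exact this

theorem half_pow_mem (a : ℕ) : 0 < ((1 : ℝ) / 2) ^ a ∧ ((1 : ℝ) / 2) ^ a ≤ 1 :=
  ⟨by positivity, pow_le_one₀ (by norm_num) (by norm_num)⟩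

/-- The values of the variables along the computation `C`. -/
noncomputable def runValue (t : ℕ) : ℕ → ℝ
  | 0 => clockValue t
  | k + 1 =>
    if k % 4 = 0 then clockValue t * (1 + (1 / 2) ^ (C t).2 (k / 4))
    else if k % 4 = 1 then clockValue t * (2 - (1 / 2) ^ (C t).2 (k / 4))
    else if k % 4 = 2 then (if (C t).2 (k / 4) = 0 then 1 else 0)
    else if code (C t).1 = k / 4 then 1 else 0

theorem runValue_mem (t k : ℕ) : runValue C t k ∈ Set.Icc (0 : ℝ) 1 := by
  have h1 := clockValue_pos t
  have h2 := clockValue_le t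
  cases k with
  | zero => exact ⟨h1.le, by simp only [runValue]; linarith⟩
  | succ k =>
    obtain ⟨h3, h4⟩ := half_pow_mem ((C t).2 (k / 4))
    simp only [runValue]
    split_ifs
    · exact ⟨by nlinarith, by nlinarith⟩
    · exact ⟨by nlinarith, by nlinarith⟩
    all_goals simp

/-- The model describing a non-terminating computation. -/
noncomputable def runModel : Model.{u} where
  W := ULift ℕ
  nonempty := ⟨⟨0⟩⟩
  R i j := i.down < j.down
  e k t := ⟨runValue C t.down k, runValue_mem C t.down k⟩

/-- The world of `runModel` reached after `t` steps. -/
def runWorld (t : ℕ) : (runModel.{u} C).W := ⟨t⟩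

theorem runModel_isTransitive : (runModel.{u} C).IsTransitive := fun _ _ _ h h' => lt_trans h h'

variable (t : ℕ)

theorem runModel_clock : ((runModel.{u} C).val clock (runWorld C t) : ℝ) = clockValue t := rfl

theorem runModel_pos (r : ℕ) : ((runModel.{u} C).val (pos r) (runWorld C t) : ℝ) =
    clockValue t * (1 + (1 / 2) ^ (C t).2 r) := by
  change runValue C t (4 * r + 1) = _
  rw [runValue, if_pos (by omega), Nat.mul_div_cancel_left _ (by norm_num)]

theorem runModel_opp (r : ℕ) : ((runModel.{u} C).val (opp r) (runWorld C t) : ℝ) =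
    clockValue t * (2 - (1 / 2) ^ (C t).2 r) := by
  change runValue C t (4 * r + 1 + 1) = _
  rw [runValue, if_neg (by omega), if_pos (by omega), show (4 * r + 1) / 4 = r by omega]

theorem runModel_isZero (r : ℕ) : ((runModel.{u} C).val (isZero r) (runWorld C t) : ℝ) =
    if (C t).2 r = 0 then 1 else 0 := by
  change runValue C t (4 * r + 2 + 1) = _
  rw [runValue, if_neg (by omega), if_neg (by omega), if_pos (by omega),
    show (4 * r + 2) / 4 = r by omega]

theorem runModel_ctrl (q : Prog) : ((runModel.{u} C).val (ctrl q) (runWorld C t) : ℝ) =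
    if (C t).1 = q then 1 else 0 := by
  change runValue C t (4 * q.code + 3 + 1) = _
  rw [runValue, if_neg (by omega), if_neg (by omega), if_neg (by omega),
    show (4 * q.code + 3) / 4 = q.code by omega]
  simp only [code_injective.eq_iff]

/-- Transitivity makes all later times successors, but for the encoding variables the next one
dominates. Counter values lie between one and two times the clock, and from time `t + 2` on the
clock is at most half its value at `t + 1`. -/
theorem runModel_dia (φ : MFm) (h : ∀ t', t + 1 < t' →
      ((runModel.{u} C).val φ (runWorld C t') : ℝ) ≤
        (runModel.{u} C).val φ (runWorld C (t + 1))) :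
    (runModel.{u} C).val (dia φ) (runWorld C t) = (runModel.{u} C).val φ (runWorld C (t + 1)) := by
  apply le_antisymm
  · refine val_dia_le _ _ ?_
    rintro ⟨t'⟩ ht'
    rcases Nat.lt_or_ge (t + 1) t' with h' | h'
    · exact h t' h'
    · obtain rfl : t' = t + 1 := le_antisymm h' ht'
      exact le_rfl
  · exact val_le_dia (runModel.{u} C) φ (v := runWorld C t) (w := runWorld C (t + 1))
      (Nat.lt_succ_self t)

theorem runModel_dia_clock :
    ((runModel.{u} C).val (dia clock) (runWorld C t) : ℝ) = clockValue t / 2 := by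
  rw [runModel_dia, runModel_clock, clockValue_succ]
  intro t' ht'
  rw [runModel_clock, runModel_clock]
  linarith [clockValue_le_of_lt ht', clockValue_pos (t + 1)]

theorem runModel_dia_pos (r : ℕ) : ((runModel.{u} C).val (dia (pos r)) (runWorld C t) : ℝ) =
    clockValue t / 2 * (1 + (1 / 2) ^ (C (t + 1)).2 r) := by
  rw [runModel_dia, runModel_pos, clockValue_succ]
  intro t' ht'
  rw [runModel_pos, runModel_pos]
  have h1 := clockValue_le_of_lt ht'
  have h2 := clockValue_pos (t + 1)
  have h3 := clockValue_pos t'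
  obtain ⟨h4, h5⟩ := half_pow_mem ((C t').2 r)
  obtain ⟨h6, h7⟩ := half_pow_mem ((C (t + 1)).2 r)
  nlinarith [mul_pos h2 h6]

theorem runModel_dia_opp (r : ℕ) : ((runModel.{u} C).val (dia (opp r)) (runWorld C t) : ℝ) =
    clockValue t / 2 * (2 - (1 / 2) ^ (C (t + 1)).2 r) := by
  rw [runModel_dia, runModel_opp, clockValue_succ]
  intro t' ht'
  rw [runModel_opp, runModel_opp]
  have h1 := clockValue_le_of_lt ht'
  have h2 := clockValue_pos (t + 1)
  have h3 := clockValue_pos t'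
  obtain ⟨h4, h5⟩ := half_pow_mem ((C t').2 r)
  obtain ⟨h6, h7⟩ := half_pow_mem ((C (t + 1)).2 r)
  nlinarith [mul_pos h3 h4]

/-- At time `t + 1` the conjunction vanishes because `q` is in control; from `t + 2` on the clock is
at most a quarter of its value at `t`. This is the origin of the factor four in `next`. -/
theorem runModel_next {q : Prog} (hq : (C (t + 1)).1 = q) :
    (runModel.{u} C).val (next q) (runWorld C t) = 1 := by
  have hle : (runModel.{u} C).val (dia (and clock (neg (ctrl q)))) (runWorld C t) ≤
      ⟨clockValue t / 4, by linarith [clockValue_pos t], by linarith [clockValue_le t]⟩ := by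
    refine val_dia_le _ _ ?_
    rintro ⟨t'⟩ ht'
    rcases Nat.lt_or_ge (t + 1) t' with h' | h'
    · refine inf_le_left.trans ?_
      change clockValue t' ≤ clockValue t / 4
      have := clockValue_le_of_lt h'
      rw [clockValue_succ] at this
      linarith
    · obtain rfl : t' = t + 1 := le_antisymm h' ht'
      refine inf_le_right.trans ?_
      have : (runModel.{u} C).val (neg (ctrl q)) (runWorld C (t + 1)) = 0 := by
        rw [← Subtype.coe_inj, coe_val_neg, runModel_ctrl, if_pos hq]
        simp
      exact this.trans_le unitInterval.nonneg'
  have hle' : ((runModel.{u} C).val (dia (and clock (neg (ctrl q)))) (runWorld C t) : ℝ) ≤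
    clockValue t / 4 := hle
  rw [next, val_imp_eq_one_iff, coe_val_dbl, coe_val_dbl, runModel_clock]
  refine (min_le_right _ _).trans ?_
  have := min_le_right 1
    (2 * ((runModel.{u} C).val (dia (and clock (neg (ctrl q)))) (runWorld C t) : ℝ))
  linarith

theorem runModel_keep {r : ℕ} (hr : (C (t + 1)).2 r = (C t).2 r) :
    (runModel.{u} C).val (keep r) (runWorld C t) = 1 := by
  rw [keep, val_bic_eq_one_iff, coe_val_dbl, runModel_dia_pos, runModel_pos, hr, min_eq_right]
  · ring
  · have h1 := clockValue_le t
    have h2 := clockValue_pos t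
    obtain ⟨h3, h4⟩ := half_pow_mem ((C t).2 r)
    nlinarith

theorem runModel_keepExcept {r : ℕ} (hr : ∀ r', r' ≠ r → (C (t + 1)).2 r' = (C t).2 r') (m : ℕ) :
    ∀ γ ∈ keepExcept m r, (runModel.{u} C).val γ (runWorld C t) = 1 := by
  intro γ hγ
  obtain ⟨r', hr', rfl⟩ := List.mem_map.1 hγ
  exact runModel_keep C t (hr r' (by simpa using (List.mem_filter.1 hr').2))

theorem forall_mem_map_imp {M : Model.{u}} {w : M.W} {φ : MFm} {L : List MFm}
    (h0 : (M.val φ w : ℝ) = 0 ∨ ∀ γ ∈ L, M.val γ w = 1) :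
    ∀ γ ∈ L.map (imp φ), M.val γ w = 1 := by
  intro γ hγ
  obtain ⟨ψ, hψ, rfl⟩ := List.mem_map.1 hγ
  rcases h0 with h0 | h0
  · exact val_imp_of_zero M w h0 ψ
  · rw [val_imp_eq_one_iff, h0 ψ hψ]
    exact (M.val φ w).2.2

theorem runModel_rules (hC : step (C t) = some (C (t + 1))) (m : ℕ) (q : Prog) :
    ∀ γ ∈ rules m q, (runModel.{u} C).val γ (runWorld C t) = 1 := by
  have hle := clockValue_le t
  have hpos := clockValue_pos t
  have hctrl := runModel_ctrl.{u} C t q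
  by_cases hq : (C t).1 = q
  swap
  · rw [if_neg hq] at hctrl
    have hmul : ∀ φ, ((runModel.{u} C).val (mul (ctrl q) φ) (runWorld C t) : ℝ) = 0 := by
      intro φ
      rw [coe_val_mul, hctrl, max_eq_left]
      linarith [((runModel.{u} C).val φ (runWorld C t)).2.2]
    cases q with
    | halt =>
      intro γ hγ
      rw [rules, List.mem_singleton] at hγ
      rw [hγ, val_neg_eq_one_iff, hctrl]
    | inc r q => exact forall_mem_map_imp (.inl hctrl)
    | loop r b q =>
      rw [rules, List.forall_mem_append]
      exact ⟨forall_mem_map_imp (.inl (hmul _)), forall_mem_map_imp (.inl (hmul _))⟩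
  · rw [if_pos hq] at hctrl
    have hC' : step (q, (C t).2) = some (C (t + 1)) := by rw [← hC, ← hq]
    cases q with
    | halt => simp [step] at hC'
    | inc r q =>
      rw [step, Option.some.injEq] at hC'
      refine forall_mem_map_imp (.inr ?_)
      rw [List.forall_mem_cons, List.forall_mem_cons]
      refine ⟨runModel_next C t (by rw [← hC']), ?_,
        runModel_keepExcept C t (fun r' hr' => by
              rw [← hC']; exact Function.update_of_ne hr' _ _) m⟩
      have hr : (C (t + 1)).2 r = (C t).2 r + 1 := by
        rw [← hC']; exact Function.update_self ..
      rw [val_bic_eq_one_iff, coe_val_dbl, coe_val_dbl, coe_val_plus, runModel_dia_pos,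
        runModel_pos, runModel_clock, hr, pow_succ]
      obtain ⟨h3, h4⟩ := half_pow_mem ((C t).2 r)
      have h5 : clockValue t * (1 / 2) ^ (C t).2 r ≤ clockValue t := by nlinarith
      rw [min_eq_right (a := 1) (b := _ + _) (by linarith),
        min_eq_right (a := 1) (b := 2 * (_ / 2 * _)) (by linarith), min_eq_right (by linarith)]
      ring
    | loop r b q =>
      have hz := runModel_isZero.{u} C t r
      rw [rules, List.forall_mem_append]
      by_cases hs : (C t).2 r = 0
      · rw [step, if_pos hs, Option.some.injEq] at hC'
        rw [if_pos hs] at hz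
        refine ⟨forall_mem_map_imp (.inr ?_), forall_mem_map_imp (.inl ?_)⟩
        · rw [List.forall_mem_cons]
          refine ⟨runModel_next C t (by rw [← hC']), fun γ hγ => ?_⟩
          obtain ⟨r', -, rfl⟩ := List.mem_map.1 hγ
          exact runModel_keep C t (by rw [← hC'])
        · rw [coe_val_mul, coe_val_neg, hctrl, hz]
          norm_num
      · rw [step, if_neg hs, Option.some.injEq] at hC'
        rw [if_neg hs] at hz
        refine ⟨forall_mem_map_imp (.inl ?_), forall_mem_map_imp (.inr ?_)⟩
        · rw [coe_val_mul, hctrl, hz]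
          norm_num
        · rw [List.forall_mem_cons, List.forall_mem_cons]
          refine ⟨runModel_next C t (by rw [← hC']), ?_,
            runModel_keepExcept C t (fun r' hr' => by
              rw [← hC']; exact Function.update_of_ne hr' _ _) m⟩
          obtain ⟨a, ha⟩ := Nat.exists_eq_succ_of_ne_zero hs
          have hr : (C (t + 1)).2 r = a := by
            rw [← hC', ← Nat.succ_sub_one a, ← ha]; exact Function.update_self ..
          rw [val_bic_eq_one_iff, coe_val_plus, coe_val_dbl, coe_val_dbl, runModel_dia_pos,
            runModel_pos, runModel_clock, hr, ha, Nat.succ_eq_add_one, pow_succ]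
          obtain ⟨h3, h4⟩ := half_pow_mem a
          have h5 : clockValue t * (1 / 2) ^ a ≤ clockValue t := by nlinarith
          rw [min_eq_right (a := 1) (b := 2 * (_ / 2 * _)) (by linarith),
            min_eq_right (a := 1) (b := _ + _) (by linarith), min_eq_right (by linarith)]
          ring

theorem runModel_counterAxioms (r : ℕ) :
    ∀ γ ∈ counterAxioms r, (runModel.{u} C).val γ (runWorld C t) = 1 := by
  have hle := clockValue_le t
  have hpos := clockValue_pos t
  have hz := runModel_isZero.{u} C t r
  simp only [counterAxioms, List.forall_mem_cons]
  refine ⟨?_, ?_, ?_, ?_, ?_, by simp⟩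
  · rw [val_bic_eq_one_iff, coe_val_plus, coe_val_triple, runModel_pos, runModel_opp,
      runModel_clock]
    congr 1
    ring
  · rw [val_bic_eq_one_iff, coe_val_plus, coe_val_triple, runModel_dia_pos, runModel_dia_opp,
      runModel_dia_clock]
    congr 1
    ring
  · rw [val_or_neg_eq_one_iff, hz]
    split_ifs <;> simp
  · by_cases h : (C t).2 r = 0
    · refine forall_mem_map_imp (L := [_]) (.inr fun γ hγ => ?_) _ (List.mem_singleton_self _)
      rw [List.mem_singleton.1 hγ, val_bic_eq_one_iff, coe_val_dbl, runModel_pos, runModel_clock,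
        h, min_eq_right (by linarith), pow_zero]
      ring
    · rw [if_neg h] at hz
      exact val_imp_of_zero _ _ hz _
  · by_cases h : (C t).2 r = 0
    · rw [if_pos h] at hz
      exact val_imp_of_zero _ _ (by rw [coe_val_neg, hz, sub_self]) _
    · refine forall_mem_map_imp (L := [_]) (.inr fun γ hγ => ?_) _ (List.mem_singleton_self _)
      rw [List.mem_singleton.1 hγ, val_imp_eq_one_iff, coe_val_dbl, coe_val_triple, runModel_pos,
        runModel_clock]
      obtain ⟨a, ha⟩ := Nat.exists_eq_succ_of_ne_zero h
      obtain ⟨h3, h4⟩ := half_pow_mem a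
      rw [ha, Nat.succ_eq_add_one, pow_succ]
      refine min_le_min_left 1 ?_
      nlinarith

theorem runModel_globalAxioms (hC : step (C t) = some (C (t + 1))) (p : Prog) :
    ∀ γ ∈ globalAxioms p, (runModel.{u} C).val γ (runWorld C t) = 1 := by
  have hle := clockValue_le t
  have hpos := clockValue_pos t
  simp only [globalAxioms, List.forall_mem_cons, List.forall_mem_append, List.mem_flatMap,
    forall_exists_index, and_imp]
  refine ⟨?_, ?_, fun γ r _ hγ => runModel_counterAxioms C t r γ hγ, fun γ q _ hγ => ?_⟩
  · rw [val_imp_eq_one_iff, coe_val_neg, coe_val_dbl, coe_val_dbl, coe_val_dbl, coe_val_dbl,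
      runModel_clock]
    simp only [min_def]
    split_ifs <;> linarith
  · rw [val_bic_eq_one_iff, coe_val_dbl, runModel_dia_clock, runModel_clock,
      min_eq_right (by linarith)]
    ring
  · rcases List.mem_cons.1 hγ with rfl | hγ
    · rw [val_or_neg_eq_one_iff, runModel_ctrl]
      split_ifs <;> simp
    · exact runModel_rules C t hC _ q γ hγ

theorem runModel_runAxioms (hC : ∀ t, step (C t) = some (C (t + 1))) {p : Prog} {n : ℕ}
    (h0 : C 0 = (p, initial n)) :
    ∀ γ ∈ runAxioms p, (runModel.{u} C).val γ (runWorld C 0) = 1 := by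
  have hglob := fun t => runModel_globalAxioms.{u} C t (hC t) p
  have hle := clockValue_le 0
  simp only [runAxioms, List.forall_mem_append, List.forall_mem_map, List.forall_mem_cons]
  refine ⟨⟨hglob 0, fun γ hγ => (val_box_eq_one_iff _ _ _).2 fun w _ => hglob w.down γ hγ⟩, ?_,
    fun r hr => ?_⟩
  · rw [← Subtype.coe_inj, runModel_ctrl, h0, if_pos rfl, Set.Icc.coe_one]
  · have hr0 : r ≠ 0 := by simpa using (List.mem_filter.1 hr).2
    rw [val_bic_eq_one_iff, coe_val_dbl, runModel_pos, runModel_clock, h0,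
      min_eq_right (by linarith)]
    simp only [initial, Function.update_of_ne hr0, pow_zero]
    ring

theorem runModel_inputAxiom {p : Prog} {n : ℕ} (h0 : C 0 = (p, initial n)) :
    (runModel.{u} C).val (inputAxiom n) (runWorld C 0) = 1 := by
  have hle := clockValue_le 0
  have hpos := clockValue_pos 0
  obtain ⟨h3, -⟩ := half_pow_mem n
  rw [inputAxiom, val_bic_eq_one_iff, coe_val_iterate_dbl, coe_val_tsub, runModel_pos,
    runModel_clock, h0]
  simp only [initial, Function.update_self]
  have h1 : clockValue 0 * (1 + (1 / 2) ^ n) - clockValue 0 = clockValue 0 * (1 / 2) ^ n := by ring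
  have h2 : (2 : ℝ) ^ n * (1 / 2) ^ n = 1 := by rw [← mul_pow]; norm_num
  rw [h1, max_eq_right (mul_pos hpos h3).le, mul_left_comm, h2, mul_one, min_eq_right (by linarith)]

end Completeness

theorem exists_run {p : Prog} {n : ℕ} (h : ¬ Halts p n) : ∃ C : ℕ → Prog × Store,
    C 0 = (p, initial n) ∧ ∀ t, step (C t) = some (C (t + 1)) := by
  -- The default value is never used: a reachable configuration without a next step would be a
  -- halting one.
  let C : ℕ → Prog × Store := fun t => (fun c => (step c).getD c)^[t] (p, initial n)
  have hsucc : ∀ t, C (t + 1) = (step (C t)).getD (C t) := fun t =>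
    Function.iterate_succ_apply' _ _ _
  have hsteps : ∀ t, Steps (p, initial n) (C t) ∧ step (C t) = some (C (t + 1)) := by
    have aux : ∀ t, Steps (p, initial n) (C t) → step (C t) = some (C (t + 1)) := by
      intro t ht
      rw [hsucc]
      cases hst : step (C t) with
      | some c => rfl
      | none =>
        refine absurd ⟨(C t).2, ?_⟩ h
        have hhalt : (C t).1 = halt := by
          generalize C t = c at hst
          obtain ⟨q, s⟩ := c
          cases q with
          | halt => rfl
          | inc r q => simp [step] at hst
          | loop r b q =>
            simp only [step] at hst
            split_ifs at hst
        rw [Runs, ← hhalt]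
        exact ht
    intro t
    induction t with
    | zero => exact ⟨.refl, aux 0 .refl⟩
    | succ t ih => exact ⟨ih.1.tail ih.2, aux _ (ih.1.tail ih.2)⟩
  exact ⟨C, rfl, fun t => (hsteps t).2⟩

/-- The conclusion `¬ clock` fails exactly when the clock is positive, which is what the simulation
needs. With clock `0` the encoding carries no information. -/
theorem k4Consequence_iff_halts (p : Prog) (n : ℕ) :
    K4Consequence.{u} (inputAxiom n :: runAxioms p) (neg clock) ↔ Halts p n := by
  constructor
  · intro h
    by_contra hn
    obtain ⟨C, h0, hC⟩ := exists_run hn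
    have := h (runModel C) (runModel_isTransitive C) (runWorld C 0)
      (List.forall_mem_cons.2 ⟨runModel_inputAxiom C h0, runModel_runAxioms C hC h0⟩)
    rw [val_neg_eq_one_iff, runModel_clock] at this
    exact (clockValue_pos 0).ne' this
  · intro h M hM v hv
    rw [List.forall_mem_cons] at hv
    rw [val_neg_eq_one_iff]
    by_contra hne
    exact not_halts_of_countermodel hM hv.2 hv.1 (lt_of_le_of_ne (M.val clock v).2.1 (Ne.symm hne))
      h

end Prog

/-! ### Computability of the reduction and the conclusion -/

theorem primrec_imp {α : Type*} [Primcodable α] {f g : α → MFm} (hf : Primrec f)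
    (hg : Primrec g) : Primrec fun a => MFm.imp (f a) (g a) := by
  rw [← Primrec.encode_iff]
  exact Primrec.nat_add.comp (Primrec.nat_mul.comp (.const 7) (Primrec₂.natPair.comp
    (primrec_toNat.comp hf) (primrec_toNat.comp hg))) (.const 6)

theorem primrec_mul {α : Type*} [Primcodable α] {f g : α → MFm} (hf : Primrec f)
    (hg : Primrec g) : Primrec fun a => MFm.mul (f a) (g a) := by
  rw [← Primrec.encode_iff]
  exact Primrec.nat_add.comp (Primrec.nat_mul.comp (.const 7) (Primrec₂.natPair.comp
    (primrec_toNat.comp hf) (primrec_toNat.comp hg))) (.const 5)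

theorem primrec_inputAxiom : Primrec Prog.inputAxiom := by
  have hdbl : Primrec MFm.dbl :=
    primrec_imp (primrec_imp .id (.const MFm.bot)) .id
  -- Each doubling duplicates the formula, so its size is exponential in `n`; only computability
  -- matters here.
  have hiter : Primrec fun n : ℕ => MFm.dbl^[n] (MFm.tsub (Prog.pos 0) Prog.clock) :=
    Primrec.nat_iterate .id (.const _) (hdbl.comp .snd)
  exact primrec_mul (primrec_imp hiter (.const _)) (primrec_imp (.const _) hiter)

theorem not_computablePred_k4Consequence : ¬ ComputablePred fun p : List MFm × MFm =>
    K4Consequence.{u} p.1 p.2 := by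
  obtain ⟨p, hp⟩ := Prog.exists_undecidable
  refine fun h => hp (ComputablePred.computable_of_manyOneReducible
    ⟨fun n => (Prog.inputAxiom n :: Prog.runAxioms p, MFm.neg Prog.clock), ?_, fun n =>
      (Prog.k4Consequence_iff_halts p n).symm⟩ h)
  exact (Primrec.pair (Primrec.list_cons.comp primrec_inputAxiom (.const _)) (.const _)).to_comp

end LukModal

theorem mainTheorem3 :
    (∀ (Γ : List LukModal.MFm) (φ : LukModal.MFm),
      LukModal.KConsequence.{u} Γ φ ↔
        LukModal.PropConsequence
          (Γ.map LukModal.rootSharp ++ LukModal.Psi (LukModal.theta Γ φ))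
          (LukModal.rootSharp φ)) ∧
    (∀ (Γ : List LukModal.MFm) (φ : LukModal.MFm),
      LukModal.SerialConsequence.{u} Γ φ ↔
        LukModal.PropConsequence
          (Γ.map LukModal.rootSharp ++ LukModal.PsiSerial (LukModal.theta Γ φ))
          (LukModal.rootSharp φ)) ∧
    ComputablePred (fun p : List LukModal.MFm × LukModal.MFm =>
      LukModal.KConsequence.{u} p.1 p.2) ∧
    ¬ ComputablePred (fun p : List LukModal.MFm × LukModal.MFm =>
      LukModal.K4Consequence.{u} p.1 p.2) :=
  ⟨LukModal.kConsequence_iff, LukModal.serialConsequence_iff,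
    LukModal.computablePred_kConsequence, LukModal.not_computablePred_k4Consequence⟩
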